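/- Let $0<\sigma\le 1$ and let $X=(0,\infty)\times\mathbb{S}^1_\sigma$, $\mathbb{S}^1_\sigma=\mathbb{R}/2\pi\sigma\mathbb{Z}$, be the cone with metric $dr^2+r^2d\theta^2$ and measure $r\,dr\,d\theta$. Let $\mathcal{D}_\sigma$ be the Dirac operator $$\mathcal{D}_\sigma\begin{pmatrix}\phi\\ \psi\end{pmatrix}=\begin{pmatrix}-(\partial_r+\frac1{2r})\psi+\frac1r\,i\partial_\theta\psi\\ (\partial_r+\frac1{2r})\phi+\frac1r\,i\partial_\theta\phi\end{pmatrix}$$ in $L^2(X)^2$ with domain $C_c^\infty(X)^2$. For $\mu\in\mathbb{R}$ put $\partial_\mu=\partial_r+\frac{\mu}{r}$, and for $k\in\mathbb{Z}$ let $d_k$ be the operator $d_k(\phi,\psi)=(-\partial_{\frac12-\frac k\sigma}\psi,\ \partial_{\frac12+\frac k\sigma}\phi)$ in $L^2(r\,dr)^2$ with domain $C_c^\infty((0,\infty))^2$. Let $$Y=\{\phi\in L^2(r\,dr):\ \phi',\ \phi/r\in L^2(r\,dr),\ \phi\in C([0,\infty)),\ \phi(0)=0\}^2,$$ with $\phi'$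 the distributional derivative on $(0,\infty)$. Let $K_{\frac12}$ be the modified Bessel function of the second kind of order $\frac12$, and for $\gamma\in[0,2\pi)$ let $Y^\gamma=Y\oplus\mathbb{C}\,(\cos\gamma\, K_{\frac12},\ \sin\gamma\, K_{\frac12})$. Let $d_0^\gamma$ be the operator with domain $Y^\gamma$ and action, for $(\tilde\phi,\tilde\psi)\in Y$ and $c\in\mathbb{C}$, $$d_0^\gamma\left(\begin{pmatrix}\tilde\phi\\ \tilde\psi\end{pmatrix}+c\begin{pmatrix}\cos\gamma\, K_{\frac12}\\ \sin\gamma\, K_{\frac12}\end{pmatrix}\right)=\begin{pmatrix}-\partial_{\frac12}\tilde\psi\\ \partial_{\frac12}\tilde\phi\end{pmatrix}+c\begin{pmatrix}\sin\gamma\, K_{\frac12}\\ -\cos\gamma\, K_{\frac12}\end{pmatrix}.$$ Let $h_k$ be the span of $(e^{-ik\theta/\sigma},e^{-ik\theta/\sigma})$, so that $L^2(r\,dr)^2\otimes h_k$ consists of the spinors $(\phi(r)e^{-ik\theta/\sigma},\psi(r)e^{-ik\theta/\sigma})$ and $L^2(X)^2=\bigoplus_{k\in\mathbb{Z}}L^2(r\,dr)^2\otimes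 h_k$. 1. For every $k\in\mathbb{Z}$ the closure $\overline{d}_k$ has domain $Y$ and acts by $\overline{d}_k(\phi,\psi)=(-\partial_{\frac12-\frac k\sigma}\psi,\ \partial_{\frac12+\frac k\sigma}\phi)$. For $k\neq0$ the operator $d_k$ is essentially self-adjoint, i.e. $\overline{d}_k$ is self-adjoint. 2. The self-adjoint extensions of $\mathcal{D}_\sigma$ are exactly the operators $\mathcal{D}_{\sigma,\gamma}$, $\gamma\in[0,2\pi)$, where $\mathcal{D}_{\sigma,\gamma}$ is the orthogonal sum of operators $(d_0^\gamma\otimes I_2)\oplus\bigoplus_{k\neq0}(\overline{d}_k\otimes I_2)$ with domain $(Y^\gamma\otimes h_0)\oplus\bigoplus_{k\ne0}(Y\otimes h_k)$. (As usual, the domain of an orthogonal sum consists of those $f$ whose components lie in the domains of the summands and for which the series of the images converges in $L^2(X)^2$.) 3. Let $\gamma\in[0,2\pi)$ and $f,g\in L^2(X)^2$. Then $f\in D(\mathcal{D}_{\sigma,\gamma})$ and $\mathcal{D}_{\sigma,\gamma}f=g$ if and only if there are $c\in\mathbb{C}$ and $(\phi_k,\psi_k)\in Y$, $k\in\mathbb{Z}$,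 such that, with both series converging in $L^2(X)^2$, $$f=c\begin{pmatrix}\cos\gamma\, K_{\frac12}(r)\\ \sin\gamma\, K_{\frac12}(r)\end{pmatrix}+\sum_{k\in\mathbb{Z}}\begin{pmatrix}\phi_k(r)e^{-i\frac k\sigma\theta}\\ \psi_k(r)e^{-i\frac k\sigma\theta}\end{pmatrix},$$ $$g=c\begin{pmatrix}\sin\gamma\, K_{\frac12}(r)\\ -\cos\gamma\, K_{\frac12}(r)\end{pmatrix}+\sum_{k\in\mathbb{Z}}\begin{pmatrix}-e^{-i\frac k\sigma\theta}\,\partial_{\frac12-\frac k\sigma}\psi_k(r)\\ e^{-i\frac k\sigma\theta}\,\partial_{\frac12+\frac k\sigma}\phi_k(r)\end{pmatrix}.$$ -/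

import Mathlib

open MeasureTheory Set Filter Topology
open scoped ContDiff ENNReal Real

noncomputable section

namespace DiracCone

/-! ### The radial spinor space `L²((0,∞), r dr)²` -/

/-- The measure `r dr` on the half line `(0, ∞)`. -/
def radialMeasure : Measure ℝ :=
  (volume.restrict (Ioi (0 : ℝ))).withDensity fun r => ENNReal.ofReal r

instance : IsLocallyFiniteMeasure radialMeasure :=
  IsLocallyFiniteMeasure.withDensity_ofReal continuous_id

instance : SFinite radialMeasure := by
  unfold radialMeasure; infer_instance

/-- The complex space `L²(r dr)`. -/
abbrev RadialL2 : Type := Lp ℂ 2 radialMeasure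

/-- The Hilbert space `L²(r dr)²`. -/
abbrev RadialSpinor : Type := WithLp 2 (RadialL2 × RadialL2)

/-- The space `C_c^∞((0,∞))` of complex test functions (extended by zero to the line). -/
def radialTest : Submodule ℂ (ℝ → ℂ) where
  carrier := {u | ContDiff ℝ ∞ u ∧ HasCompactSupport u ∧ tsupport u ⊆ Ioi 0}
  zero_mem' := ⟨contDiff_const, HasCompactSupport.zero, by simp [tsupport]⟩
  add_mem' := fun {u v} hu hv => ⟨hu.1.add hv.1, hu.2.1.add hv.2.1,
    (tsupport_add u v).trans (union_subset hu.2.2 hv.2.2)⟩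
  smul_mem' := fun c u hu => ⟨contDiff_const.smul hu.1, hu.2.1.smul_left,
    (closure_mono (Function.support_const_smul_subset c u)).trans hu.2.2⟩

/-- The function `∂_μ u = u' + (μ / r) u`. -/
def besselExpr (μ : ℝ) (u : ℝ → ℂ) (r : ℝ) : ℂ := deriv u r + (μ / r : ℝ) * u r

lemma memLp_of_radialTest {u : ℝ → ℂ} (hu : u ∈ radialTest) : MemLp u 2 radialMeasure :=
  hu.1.continuous.memLp_of_hasCompactSupport hu.2.1

lemma memLp_besselExpr (μ : ℝ) {u : ℝ → ℂ} (hu : u ∈ radialTest) :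
    MemLp (besselExpr μ u) 2 radialMeasure := by
  have h1 : MemLp (deriv u) 2 radialMeasure :=
    (hu.1.continuous_deriv (by simp)).memLp_of_hasCompactSupport hu.2.1.deriv
  have h2 : tsupport (fun r : ℝ => ((μ / r : ℝ) : ℂ) * u r) ⊆ tsupport u :=
    closure_mono fun r hr => right_ne_zero_of_mul hr
  have h3 : Continuous fun r : ℝ => ((μ / r : ℝ) : ℂ) * u r := by
    refine ContinuousOn.continuous_of_tsupport_subset (s := Ioi 0) ?_ isOpen_Ioi
      (h2.trans hu.2.2)
    refine ContinuousOn.mul ?_ hu.1.continuous.continuousOn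
    refine Complex.continuous_ofReal.comp_continuousOn ?_
    exact continuousOn_const.div continuousOn_id fun r hr => (ne_of_gt hr)
  exact h1.add (h3.memLp_of_hasCompactSupport (hu.2.1.mul_left))

/-- The inclusion `C_c^∞((0,∞)) → L²(r dr)`. -/
def testToL2 : radialTest →ₗ[ℂ] RadialL2 where
  toFun u := (memLp_of_radialTest u.2).toLp u.1
  map_add' _ _ := rfl
  map_smul' _ _ := rfl

/-- The map `∂_μ : C_c^∞((0,∞)) → L²(r dr)`. -/
def testBessel (μ : ℝ) : radialTest →ₗ[ℂ] RadialL2 where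
  toFun u := (memLp_besselExpr μ u.2).toLp (besselExpr μ u.1)
  map_add' u v := by
    rw [← MemLp.toLp_add]
    congr 1
    funext r
    simp only [besselExpr, Pi.add_apply, Submodule.coe_add]
    rw [deriv_add (u.2.1.differentiable (by simp) r) (v.2.1.differentiable (by simp) r)]
    ring
  map_smul' c u := by
    rw [RingHom.id_apply, ← MemLp.toLp_const_smul]
    congr 1
    funext r
    simp only [besselExpr, Pi.smul_apply, Submodule.coe_smul, smul_eq_mul]
    rw [show (c • u.1) = fun r => c * u.1 r from rfl, deriv_const_mul_field]
    ring

lemma radialMeasure_pos {U : Set ℝ} (hU : IsOpen U) (hne : (U ∩ Ioi 0).Nonempty) :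
    radialMeasure U ≠ 0 := by
  intro h
  have h1 : (volume.restrict (Ioi (0 : ℝ))) ({r | ENNReal.ofReal r ≠ 0} ∩ U) = 0 :=
    (withDensity_apply_eq_zero (by fun_prop)).1 h
  rw [Measure.restrict_apply' measurableSet_Ioi] at h1
  have h2 : U ∩ Ioi 0 ⊆ {r : ℝ | ENNReal.ofReal r ≠ 0} ∩ U ∩ Ioi 0 := fun r hr =>
    ⟨⟨by simpa using hr.2, hr.1⟩, hr.2⟩
  exact ((hU.inter isOpen_Ioi).measure_pos volume hne).ne' (measure_mono_null h2 h1)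

lemma testToL2_injective : Function.Injective testToL2 := by
  refine (injective_iff_map_eq_zero _).2 fun u hu => ?_
  have h : u.1 =ᵐ[radialMeasure] 0 := (MemLp.toLp_eq_toLp_iff (memLp_of_radialTest u.2)
    (memLp_of_radialTest (0 : radialTest).2)).1 (hu.trans testToL2.map_zero.symm)
  ext r
  by_contra hr
  exact radialMeasure_pos (isOpen_ne_fun u.2.1.continuous continuous_const)
    ⟨r, hr, u.2.2.2 (subset_tsupport _ hr)⟩ h

/-- The operator `S v ↦ T v` with domain the range of the injective linear map `S`. -/
def ofInjective {V E F : Type*} [AddCommGroup V] [Module ℂ V] [AddCommGroup E] [Module ℂ E]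
    [AddCommGroup F] [Module ℂ F] (S : V →ₗ[ℂ] E) (T : V →ₗ[ℂ] F)
    (hS : Function.Injective S) : E →ₗ.[ℂ] F where
  domain := LinearMap.range S
  toFun := T ∘ₗ (LinearEquiv.ofInjective S hS).symm.toLinearMap

/-- The spinor `(φ, ψ)` with given components. -/
def pair {V E : Type*} [AddCommGroup V] [Module ℂ V] [AddCommGroup E] [Module ℂ E]
    (S T : V →ₗ[ℂ] E) : V →ₗ[ℂ] WithLp 2 (E × E) :=
  (WithLp.linearEquiv 2 ℂ (E × E)).symm.toLinearMap ∘ₗ S.prod T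

lemma pair_injective {V W E : Type*} [AddCommGroup V] [Module ℂ V] [AddCommGroup W] [Module ℂ W]
    [AddCommGroup E] [Module ℂ E] {S : V →ₗ[ℂ] E} {T : W →ₗ[ℂ] E}
    (hS : Function.Injective S) (hT : Function.Injective T) :
    Function.Injective (pair (S ∘ₗ LinearMap.fst ℂ V W) (T ∘ₗ LinearMap.snd ℂ V W)) := by
  intro x y h
  have h' := (WithLp.linearEquiv 2 ℂ (E × E)).symm.injective h
  exact Prod.ext (hS (congrArg Prod.fst h')) (hT (congrArg Prod.snd h'))

/-- The radial Dirac operator `d_k (φ, ψ) = (-∂_{1/2 - k/σ} ψ, ∂_{1/2 + k/σ} φ)` in `L²(r dr)²`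
with domain `C_c^∞((0,∞))²`. -/
def radialDirac (σ : ℝ) (k : ℤ) : RadialSpinor →ₗ.[ℂ] RadialSpinor :=
  ofInjective
    (pair (testToL2 ∘ₗ LinearMap.fst ℂ radialTest radialTest)
      (testToL2 ∘ₗ LinearMap.snd ℂ radialTest radialTest))
    (pair (-(testBessel (1 / 2 - k / σ) ∘ₗ LinearMap.snd ℂ radialTest radialTest))
      (testBessel (1 / 2 + k / σ) ∘ₗ LinearMap.fst ℂ radialTest radialTest))
    (pair_injective testToL2_injective testToL2_injective)

/-! ### The regular space `Y` -/

/-- `ψ` is the distributional derivative of `φ` on `(0, ∞)`. -/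
def HasWeakDeriv (φ ψ : ℝ → ℂ) : Prop :=
  ∀ u ∈ radialTest, ∫ r in Ioi 0, φ r * deriv u r = -∫ r in Ioi 0, ψ r * u r

lemma ae_radial_iff {p : ℝ → Prop} :
    (∀ᵐ r ∂radialMeasure, p r) ↔ ∀ᵐ r ∂(volume.restrict (Ioi (0 : ℝ))), p r := by
  unfold radialMeasure
  rw [ae_withDensity_iff (by fun_prop)]
  refine eventually_congr ?_
  filter_upwards [ae_restrict_mem measurableSet_Ioi] with r hr
  simp only [ne_eq, ENNReal.ofReal_eq_zero, not_le]
  exact ⟨fun h => h hr, fun h _ => h⟩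

lemma integrable_radialMeasure_iff {f : ℝ → ℂ} :
    Integrable f radialMeasure ↔ IntegrableOn (fun r : ℝ => (r : ℂ) * f r) (Ioi 0) := by
  unfold radialMeasure
  refine (integrable_withDensity_iff_integrable_smul₀ (f := Real.toNNReal)
      (measurable_real_toNNReal.aemeasurable)).trans ?_
  refine integrable_congr ?_
  filter_upwards [ae_restrict_mem measurableSet_Ioi] with r hr
  simp [NNReal.smul_def, max_eq_left (le_of_lt (mem_Ioi.1 hr))]

lemma integrableOn_compact (φ : RadialL2) {K : Set ℝ} (hK : K ⊆ Ioi 0) (hKc : IsCompact K) :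
    IntegrableOn φ K := by
  have h2 : IntegrableOn φ K radialMeasure :=
    ((Lp.memLp φ).locallyIntegrable (by norm_num)).integrableOn_isCompact hKc
  have h3 := integrable_radialMeasure_iff.1
    ((integrable_indicator_iff hKc.measurableSet).2 h2)
  have h4 : ContinuousOn (fun r : ℝ => ((r⁻¹ : ℝ) : ℂ)) K :=
    Complex.continuous_ofReal.comp_continuousOn
      (continuousOn_inv₀.mono fun r hr => ne_of_gt (hK hr))
  refine ((h3.mono_set hK).continuousOn_mul h4 hKc).congr_fun (fun r hr => ?_)
    hKc.measurableSet
  have : (r : ℂ) ≠ 0 := by exact_mod_cast ne_of_gt (hK hr)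
  simp [hr, this]

lemma locallyIntegrableOn (φ : RadialL2) : LocallyIntegrableOn φ (Ioi 0) :=
  (locallyIntegrableOn_iff isOpen_Ioi.isLocallyClosed).2 fun _ hK hKc =>
    integrableOn_compact φ hK hKc

lemma integrable_mul_test (φ : RadialL2) {u : ℝ → ℂ} (hu : Continuous u)
    (hc : HasCompactSupport u) (hs : tsupport u ⊆ Ioi 0) :
    IntegrableOn (fun r => φ r * u r) (Ioi 0) := by
  have h := (integrableOn_compact φ hs hc).mul_continuousOn hu.continuousOn hc
  refine IntegrableOn.mono_set (IntegrableOn.of_forall_sdiff_eq_zero h measurableSet_Ioi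
    fun r hr => ?_) Subset.rfl
  rw [image_eq_zero_of_notMem_tsupport hr.2, mul_zero]

lemma integrable_mul_radialTest (φ : RadialL2) {u : ℝ → ℂ} (hu : u ∈ radialTest) :
    IntegrableOn (fun r => φ r * u r) (Ioi 0) :=
  integrable_mul_test φ hu.1.continuous hu.2.1 hu.2.2

lemma integrable_mul_deriv_radialTest (φ : RadialL2) {u : ℝ → ℂ} (hu : u ∈ radialTest) :
    IntegrableOn (fun r => φ r * deriv u r) (Ioi 0) :=
  integrable_mul_test φ (hu.1.continuous_deriv (by simp)) hu.2.1.deriv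
    ((closure_minimal support_deriv_subset (isClosed_tsupport u)).trans hu.2.2)

lemma HasWeakDeriv.congr {φ φ' ψ ψ' : ℝ → ℂ} (h : HasWeakDeriv φ ψ)
    (h1 : φ' =ᵐ[radialMeasure] φ) (h2 : ψ' =ᵐ[radialMeasure] ψ) : HasWeakDeriv φ' ψ' := by
  intro u hu
  have e1 : ∫ r in Ioi 0, φ' r * deriv u r = ∫ r in Ioi 0, φ r * deriv u r :=
    integral_congr_ae ((ae_radial_iff.1 h1).mono fun r hr => by simp only [hr])
  have e2 : ∫ r in Ioi 0, ψ' r * u r = ∫ r in Ioi 0, ψ r * u r :=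
    integral_congr_ae ((ae_radial_iff.1 h2).mono fun r hr => by simp only [hr])
  rw [e1, e2, h u hu]

lemma HasWeakDeriv.add {φ φ' ψ ψ' : RadialL2} (h : HasWeakDeriv φ ψ) (h' : HasWeakDeriv φ' ψ') :
    HasWeakDeriv ⇑(φ + φ') ⇑(ψ + ψ') := by
  refine HasWeakDeriv.congr (φ := fun r => φ r + φ' r) (ψ := fun r => ψ r + ψ' r) ?_
    (Lp.coeFn_add φ φ') (Lp.coeFn_add ψ ψ')
  intro u hu
  simp only [add_mul]
  rw [integral_add (integrable_mul_deriv_radialTest φ hu) (integrable_mul_deriv_radialTest φ' hu),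
    integral_add (integrable_mul_radialTest ψ hu) (integrable_mul_radialTest ψ' hu),
    h u hu, h' u hu]
  ring

lemma HasWeakDeriv.smul {φ ψ : RadialL2} (c : ℂ) (h : HasWeakDeriv φ ψ) :
    HasWeakDeriv ⇑(c • φ) ⇑(c • ψ) := by
  refine HasWeakDeriv.congr (φ := fun r => c * φ r) (ψ := fun r => c * ψ r) ?_
    (Lp.coeFn_smul c φ) (Lp.coeFn_smul c ψ)
  intro u hu
  simp only [mul_assoc]
  rw [integral_const_mul, integral_const_mul, h u hu]
  ring

lemma HasWeakDeriv.zero : HasWeakDeriv ⇑(0 : RadialL2) ⇑(0 : RadialL2) :=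
  HasWeakDeriv.congr (φ := 0) (ψ := 0) (fun u _ => by simp) (Lp.coeFn_zero _ _ _)
    (Lp.coeFn_zero _ _ _)

lemma HasWeakDeriv.unique {φ ψ ψ' : RadialL2} (h : HasWeakDeriv φ ψ) (h' : HasWeakDeriv φ ψ') :
    ψ = ψ' := by
  refine Lp.ext (ae_radial_iff.2 ((ae_restrict_iff' measurableSet_Ioi).2 ?_))
  have := isOpen_Ioi.ae_eq_zero_of_integral_contDiff_smul_eq_zero
    (f := fun r => ψ r - ψ' r) ((locallyIntegrableOn ψ).sub (locallyIntegrableOn ψ'))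
    fun g hg hgc hgs => ?_
  · exact this.mono fun r hr hr' => sub_eq_zero.1 (hr hr')
  · have hu : (fun r => (g r : ℂ)) ∈ radialTest :=
      ⟨Complex.ofRealCLM.contDiff.comp hg, hgc.comp_left (g := ((↑) : ℝ → ℂ)) rfl,
        (closure_mono fun r hr => by simpa using hr).trans hgs⟩
    have e := neg_injective ((h _ hu).symm.trans (h' _ hu))
    have e' : ∫ r, g r • (ψ r - ψ' r) = ∫ r in Ioi 0, g r • (ψ r - ψ' r) := by
      refine (setIntegral_eq_integral_of_forall_compl_eq_zero fun r hr => ?_).symm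
      rw [image_eq_zero_of_notMem_tsupport fun h => hr (hgs h), zero_smul]
    rw [e']
    simp only [Complex.real_smul, mul_comm ((g _ : ℝ) : ℂ), sub_mul]
    rw [integral_sub (integrable_mul_radialTest ψ hu) (integrable_mul_radialTest ψ' hu), e,
      sub_self]

/-- The scalar space of all `φ ∈ L²(r dr)` with `φ', φ / r ∈ L²(r dr)`, `φ ∈ C([0,∞))` and
`φ(0) = 0`; the derivative is taken in the sense of distributions on `(0,∞)`. -/
def regularSpace : Submodule ℂ RadialL2 where
  carrier := {φ | (∃ ψ : RadialL2, HasWeakDeriv φ ψ) ∧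
    MemLp (fun r : ℝ => φ r / (r : ℂ)) 2 radialMeasure ∧
    ∃ g : ℝ → ℂ, ContinuousOn g (Ici 0) ∧ g 0 = 0 ∧ φ =ᵐ[radialMeasure] g}
  zero_mem' := by
    refine ⟨⟨0, HasWeakDeriv.zero⟩, ?_, 0, continuousOn_const, rfl, Lp.coeFn_zero _ _ _⟩
    refine (memLp_congr_ae ?_).2 (MemLp.zero (ε := ℂ))
    filter_upwards [Lp.coeFn_zero ℂ 2 radialMeasure] with r hr
    rw [hr]; simp
  add_mem' := by
    rintro φ φ' ⟨⟨ψ, h1⟩, h2, g, h3, h4, h5⟩ ⟨⟨ψ', h1'⟩, h2', g', h3', h4', h5'⟩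
    refine ⟨⟨ψ + ψ', h1.add h1'⟩, (memLp_congr_ae ?_).2 (h2.add h2'), g + g', h3.add h3',
      by simp [h4, h4'], (Lp.coeFn_add φ φ').trans (h5.add h5')⟩
    filter_upwards [Lp.coeFn_add φ φ'] with r hr
    rw [hr]; simp [add_div]
  smul_mem' := by
    rintro c φ ⟨⟨ψ, h1⟩, h2, g, h3, h4, h5⟩
    refine ⟨⟨c • ψ, h1.smul c⟩, (memLp_congr_ae ?_).2 (h2.const_smul c), c • g, h3.const_smul c,
      by simp [h4], (Lp.coeFn_smul c φ).trans (h5.const_smul c)⟩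
    filter_upwards [Lp.coeFn_smul c φ] with r hr
    rw [hr]; simp [mul_div_assoc]

/-- The distributional derivative `φ ↦ φ'`. -/
def radialDeriv : regularSpace →ₗ[ℂ] RadialL2 where
  toFun φ := φ.2.1.choose
  map_add' φ φ' := (φ + φ').2.1.choose_spec.unique (φ.2.1.choose_spec.add φ'.2.1.choose_spec)
  map_smul' c φ := (c • φ).2.1.choose_spec.unique (φ.2.1.choose_spec.smul c)

/-- The map `φ ↦ φ / r`. -/
def divRadius : regularSpace →ₗ[ℂ] RadialL2 where
  toFun φ := φ.2.2.1.toLp _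
  map_add' φ φ' := by
    rw [← MemLp.toLp_add]
    refine MemLp.toLp_congr _ _ ?_
    filter_upwards [Lp.coeFn_add φ.1 φ'.1] with r hr
    simp only [Submodule.coe_add, hr, Pi.add_apply, add_div]
  map_smul' c φ := by
    rw [RingHom.id_apply, ← MemLp.toLp_const_smul]
    refine MemLp.toLp_congr _ _ ?_
    filter_upwards [Lp.coeFn_smul c φ.1] with r hr
    simp only [Submodule.coe_smul, hr, Pi.smul_apply, smul_eq_mul, mul_div_assoc]

/-- The operator `∂_μ φ = φ' + (μ / r) φ`. -/
def bessel (μ : ℝ) : regularSpace →ₗ[ℂ] RadialL2 := radialDeriv + (μ : ℂ) • divRadius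

/-- The space `Y` of spinors with both components in `regularSpace`. -/
def regularSpinors : Submodule ℂ RadialSpinor :=
  (regularSpace.prod regularSpace).comap
    (WithLp.linearEquiv 2 ℂ (RadialL2 × RadialL2)).toLinearMap

/-- The first component of an element of `Y`. -/
def regularFst : regularSpinors →ₗ[ℂ] regularSpace where
  toFun f := ⟨f.1.fst, f.2.1⟩
  map_add' _ _ := rfl
  map_smul' _ _ := rfl

/-- The second component of an element of `Y`. -/
def regularSnd : regularSpinors →ₗ[ℂ] regularSpace where
  toFun f := ⟨f.1.snd, f.2.2⟩
  map_add' _ _ := rfl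
  map_smul' _ _ := rfl

/-- The operator `(φ, ψ) ↦ (-∂_{1/2 - k/σ} ψ, ∂_{1/2 + k/σ} φ)` with domain `Y`. -/
def radialDiracY (σ : ℝ) (k : ℤ) : RadialSpinor →ₗ.[ℂ] RadialSpinor where
  domain := regularSpinors
  toFun := pair (-(bessel (1 / 2 - k / σ) ∘ₗ regularSnd)) (bessel (1 / 2 + k / σ) ∘ₗ regularFst)

/-! ### The modified Bessel function and the operators `d₀^γ` -/

/-- The modified Bessel function of the second kind
`K_ν(r) = ∫₀^∞ exp(-r cosh t) cosh(ν t) dt`, for `r > 0`. -/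
def besselK (ν r : ℝ) : ℝ :=
  ∫ t in Ioi (0 : ℝ), Real.exp (-r * Real.cosh t) * Real.cosh (ν * t)

lemma besselK_half {r : ℝ} (hr : 0 < r) :
    besselK (1 / 2) r = √(π / (2 * r)) * Real.exp (-r) := by
  let f : ℝ → ℝ := fun t => Real.sinh (t / 2)
  let g : ℝ → ℝ := fun s => 2 * Real.exp (-r) * Real.exp (-(2 * r) * s ^ 2)
  have hf : ∀ t ∈ Ioi (0 : ℝ), HasDerivWithinAt f (Real.cosh (t / 2) * (1 / 2)) (Ioi 0) t :=
    fun t _ => ((hasDerivAt_id t).div_const 2).sinh.hasDerivWithinAt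
  have hinj : InjOn f (Ioi 0) := fun x _ y _ h => by
    have := Real.sinh_injective h
    linarith
  have himg : f '' Ioi 0 = Ioi 0 := by
    ext x
    constructor
    · rintro ⟨t, ht, rfl⟩
      exact Real.sinh_pos_iff.2 (half_pos ht)
    · intro hx
      refine ⟨2 * Real.arsinh x, mul_pos two_pos (Real.arsinh_pos_iff.2 hx), ?_⟩
      simp [f]
  have key : ∀ t : ℝ, |Real.cosh (t / 2) * (1 / 2)| • g (f t) =
      Real.exp (-r * Real.cosh t) * Real.cosh (1 / 2 * t) := by
    intro t
    have h1 : Real.cosh t = 1 + 2 * Real.sinh (t / 2) ^ 2 := by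
      have := Real.cosh_two_mul (t / 2)
      rw [Real.cosh_sq, show 2 * (t / 2) = t by ring] at this
      linarith
    have h2 : Real.exp (-r * Real.cosh t) =
        Real.exp (-r) * Real.exp (-(2 * r) * Real.sinh (t / 2) ^ 2) := by
      rw [← Real.exp_add, h1]; ring_nf
    have h3 := Real.cosh_pos (t / 2)
    simp only [g, f]
    rw [abs_of_pos (by positivity), h2, show 1 / 2 * t = t / 2 by ring, smul_eq_mul]
    ring
  have hsub := integral_image_eq_integral_abs_deriv_smul measurableSet_Ioi hf hinj g
  rw [himg] at hsub
  simp only [key] at hsub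
  rw [besselK, ← hsub]
  simp only [g]
  rw [integral_const_mul, integral_gaussian_Ioi]
  ring

lemma memLp_besselK_half : MemLp (fun r => (besselK (1 / 2) r : ℂ)) 2 radialMeasure := by
  have hc : ContinuousOn (fun r : ℝ => ((√(π / (2 * r)) * Real.exp (-r) : ℝ) : ℂ)) (Ioi 0) := by
    refine Complex.continuous_ofReal.comp_continuousOn ?_
    refine ContinuousOn.mul ?_ (by fun_prop)
    refine Real.continuous_sqrt.comp_continuousOn ?_
    exact continuousOn_const.div (by fun_prop) fun r (hr : 0 < r) => by positivity
  have hm : AEStronglyMeasurable (fun r : ℝ => ((√(π / (2 * r)) * Real.exp (-r) : ℝ) : ℂ))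
      radialMeasure :=
    (hc.aestronglyMeasurable measurableSet_Ioi).mono_ac (withDensity_absolutelyContinuous _ _)
  refine (memLp_congr_ae (ae_radial_iff.2 ?_)).2 ((memLp_two_iff_integrable_sq_norm hm).2 ?_)
  · filter_upwards [ae_restrict_mem measurableSet_Ioi] with r hr
    rw [besselK_half hr]
  · have h1 : Integrable (fun r : ℝ => ((‖((√(π / (2 * r)) * Real.exp (-r) : ℝ) : ℂ)‖ ^ 2 : ℝ) : ℂ))
        radialMeasure := by
      refine integrable_radialMeasure_iff.2 ?_
      have h2 : IntegrableOn (fun r : ℝ => ((π / 2 * Real.exp (-2 * r) : ℝ) : ℂ)) (Ioi 0) :=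
        ((exp_neg_integrableOn_Ioi 0 two_pos).const_mul (π / 2)).ofReal
      refine h2.congr_fun (fun r hr => ?_) measurableSet_Ioi
      have hr' : (0 : ℝ) < r := hr
      have h3 : r * ‖((√(π / (2 * r)) * Real.exp (-r) : ℝ) : ℂ)‖ ^ 2 =
          π / 2 * Real.exp (-2 * r) := by
        rw [Complex.norm_real, Real.norm_eq_abs, sq_abs, mul_pow, Real.sq_sqrt (by positivity),
          ← Real.exp_nat_mul]
        field_simp
        ring_nf
      simp only [← h3, Complex.ofReal_mul]
    exact h1.re

/-- `K_{1/2}` as an element of `L²(r dr)`. -/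
def besselKHalf : RadialL2 := memLp_besselK_half.toLp _

lemma besselKHalf_notMem : besselKHalf ∉ regularSpace := by
  rintro ⟨-, -, g, hg, hg0, h⟩
  have h1 : ∀ᵐ r ∂radialMeasure, (besselK (1 / 2) r : ℂ) = g r :=
    (memLp_besselK_half.coeFn_toLp.symm.trans h)
  have h2 : ∀ᶠ r in 𝓝[Ici 0] (0 : ℝ), ‖g r‖ < 1 := by
    have := (hg 0 self_mem_Ici).norm
    rw [ContinuousWithinAt, hg0, norm_zero] at this
    exact this.eventually (gt_mem_nhds one_pos)
  obtain ⟨δ, hδ, h3⟩ := Metric.mem_nhdsWithin_iff.1 h2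
  have h4 : radialMeasure (Ioo 0 (min δ (1 / 4))) ≠ 0 := by
    refine radialMeasure_pos isOpen_Ioo ?_
    have : 0 < min δ (1 / 4) := lt_min hδ (by norm_num)
    exact ⟨min δ (1 / 4) / 2, ⟨by positivity, by linarith⟩, half_pos this⟩
  obtain ⟨r, hr, hrK⟩ : ∃ r ∈ Ioo 0 (min δ (1 / 4)), (besselK (1 / 2) r : ℂ) = g r := by
    by_contra! hne
    exact h4 (measure_mono_null (fun r hr => hne r hr) h1)
  have hr0 := hr.1
  have hr1 : r < δ := hr.2.trans_le (min_le_left _ _)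
  have hr2 : r < 1 / 4 := hr.2.trans_le (min_le_right _ _)
  have h5 : ‖g r‖ < 1 := h3 ⟨by simpa [abs_of_pos hr0] using hr1, hr0.le⟩
  rw [← hrK, Complex.norm_real, besselK_half hr0, Real.norm_eq_abs,
    abs_of_nonneg (by positivity)] at h5
  have h6 : 2 ≤ √(π / (2 * r)) := by
    refine Real.le_sqrt_of_sq_le ?_
    rw [le_div_iff₀ (by positivity)]
    nlinarith [Real.pi_gt_three]
  have h7 : 3 / 4 ≤ Real.exp (-r) := by
    have := Real.add_one_le_exp (-r)
    linarith
  nlinarith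

/-- The singular spinor `(cos γ K_{1/2}, sin γ K_{1/2})`. -/
def singularSpinor (γ : ℝ) : RadialSpinor :=
  WithLp.toLp 2 ((Real.cos γ : ℂ) • besselKHalf, (Real.sin γ : ℂ) • besselKHalf)

/-- The image `(sin γ K_{1/2}, -cos γ K_{1/2})` of the singular spinor. -/
def singularImage (γ : ℝ) : RadialSpinor :=
  WithLp.toLp 2 ((Real.sin γ : ℂ) • besselKHalf, -((Real.cos γ : ℂ) • besselKHalf))

lemma singularSpinor_notMem (σ γ : ℝ) : singularSpinor γ ∉ (radialDiracY σ 0).domain := by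
  rintro ⟨h1, h2⟩
  refine besselKHalf_notMem ?_
  have h := regularSpace.add_mem (regularSpace.smul_mem (Real.cos γ : ℂ) h1)
    (regularSpace.smul_mem (Real.sin γ : ℂ) h2)
  have e : (Real.cos γ : ℂ) • (Real.cos γ : ℂ) • besselKHalf +
      (Real.sin γ : ℂ) • (Real.sin γ : ℂ) • besselKHalf = besselKHalf := by
    rw [smul_smul, smul_smul, ← add_smul]
    have : (Real.cos γ : ℂ) * Real.cos γ + (Real.sin γ : ℂ) * Real.sin γ = 1 := by
      rw [← Complex.ofReal_mul, ← Complex.ofReal_mul, ← Complex.ofReal_add, ← sq, ← sq,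
        Real.cos_sq_add_sin_sq, Complex.ofReal_one]
    rw [this, one_smul]
  exact e ▸ h

/-- The operator `d₀^γ` with domain `Y^γ = Y ⊕ [(cos γ K_{1/2}, sin γ K_{1/2})]` and action
`f + c (cos γ K_{1/2}, sin γ K_{1/2}) ↦ d₀ f + c (sin γ K_{1/2}, -cos γ K_{1/2})`. -/
def radialDiracExt (σ γ : ℝ) : RadialSpinor →ₗ.[ℂ] RadialSpinor :=
  (radialDiracY σ 0).supSpanSingleton (singularSpinor γ) (singularImage γ)
    (singularSpinor_notMem σ γ)

/-! ### The cone -/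

instance factCircumference (σ : ℝ) [h : Fact (0 < σ)] : Fact (0 < 2 * π * σ) :=
  ⟨mul_pos Real.two_pi_pos h.out⟩

/-- The circle `ℝ / 2πσℤ` of radius `σ`. -/
abbrev ConeCircle (σ : ℝ) : Type := AddCircle (2 * π * σ)

/-- The volume `r dr dθ` of the cone `X = (0,∞) × ℝ / 2πσℤ` with metric `dr² + r² dθ²`
(a measure on `ℝ × ℝ / 2πσℤ` that lives on the set `r > 0`). -/
def coneMeasure (σ : ℝ) [Fact (0 < σ)] : Measure (ℝ × ConeCircle σ) := radialMeasure.prod volume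

instance (σ : ℝ) [Fact (0 < σ)] : IsFiniteMeasureOnCompacts (coneMeasure σ) := by
  unfold coneMeasure; infer_instance

/-- The complex space `L²(X)` of the cone. -/
abbrev ConeL2 (σ : ℝ) [Fact (0 < σ)] : Type := Lp ℂ 2 (coneMeasure σ)

/-- The Hilbert space `L²(X)²`. -/
abbrev ConeSpinor (σ : ℝ) [Fact (0 < σ)] : Type := WithLp 2 (ConeL2 σ × ConeL2 σ)

/-- The space `C_c^∞(X)` of complex test functions supported away from the tip `r = 0` (extended
by zero to `ℝ × ℝ / 2πσℤ`); smoothness is tested on the universal cover `ℝ × ℝ`. -/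
def coneTest (σ : ℝ) : Submodule ℂ (ℝ × ConeCircle σ → ℂ) where
  carrier := {u | ContDiff ℝ ∞ (fun p : ℝ × ℝ => u (p.1, (p.2 : ConeCircle σ))) ∧
    HasCompactSupport u ∧ tsupport u ⊆ Ioi 0 ×ˢ univ}
  zero_mem' := ⟨contDiff_const, HasCompactSupport.zero, by simp [tsupport]⟩
  add_mem' := fun {u v} hu hv => ⟨hu.1.add hv.1, hu.2.1.add hv.2.1,
    (tsupport_add u v).trans (union_subset hu.2.2 hv.2.2)⟩
  smul_mem' := fun c u hu => ⟨contDiff_const.smul hu.1, hu.2.1.smul_left,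
    (closure_mono (Function.support_const_smul_subset c u)).trans hu.2.2⟩

/-- The partial derivative `∂_r u`. -/
def partialRadius {σ : ℝ} (u : ℝ × ConeCircle σ → ℂ) (p : ℝ × ConeCircle σ) : ℂ :=
  deriv (fun s : ℝ => u (s, p.2)) p.1

/-- The partial derivative `∂_θ u`. -/
def partialAngle {σ : ℝ} (u : ℝ × ConeCircle σ → ℂ) (p : ℝ × ConeCircle σ) : ℂ :=
  deriv (fun t : ℝ => u (p.1, p.2 + (t : ConeCircle σ))) 0

/-- The expression `ε (∂_r + 1 / (2 r)) u + (1 / r) i ∂_θ u`. -/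
def coneExpr {σ : ℝ} (ε : ℝ) (u : ℝ × ConeCircle σ → ℂ) (p : ℝ × ConeCircle σ) : ℂ :=
  ε * (partialRadius u p + (1 / (2 * p.1) : ℝ) * u p) +
    (1 / p.1 : ℝ) * (Complex.I * partialAngle u p)

lemma isOpenQuotientMap_cover (σ : ℝ) :
    IsOpenQuotientMap (Prod.map id ((↑) : ℝ → ConeCircle σ) : ℝ × ℝ → ℝ × ConeCircle σ) :=
  IsOpenQuotientMap.id.prodMap QuotientAddGroup.isOpenQuotientMap_mk

lemma continuous_coneTest {σ : ℝ} {u : ℝ × ConeCircle σ → ℂ} (hu : u ∈ coneTest σ) :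
    Continuous u :=
  (isOpenQuotientMap_cover σ).continuous_comp_iff.1 hu.1.continuous

lemma hasDerivAt_radius {σ : ℝ} {u : ℝ × ConeCircle σ → ℂ} (hu : u ∈ coneTest σ) (r t : ℝ) :
    HasDerivAt (fun s : ℝ => u (s, (t : ConeCircle σ)))
      (fderiv ℝ (fun p : ℝ × ℝ => u (p.1, (p.2 : ConeCircle σ))) (r, t) (1, 0)) r := by
  have h := (hu.1.differentiable (by simp) (r, t)).hasFDerivAt
  exact h.comp_hasDerivAt r ((hasDerivAt_id r).prodMk (hasDerivAt_const r t))

lemma hasDerivAt_angle {σ : ℝ} {u : ℝ × ConeCircle σ → ℂ} (hu : u ∈ coneTest σ) (r t : ℝ) :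
    HasDerivAt (fun s : ℝ => u (r, (t : ConeCircle σ) + (s : ConeCircle σ)))
      (fderiv ℝ (fun p : ℝ × ℝ => u (p.1, (p.2 : ConeCircle σ))) (r, t) (0, 1)) 0 := by
  have h := (hu.1.differentiable (by simp) (r, t + 0)).hasFDerivAt
  have h' := h.comp_hasDerivAt (0 : ℝ)
    ((hasDerivAt_const (0 : ℝ) r).prodMk ((hasDerivAt_id (0 : ℝ)).const_add t))
  simpa [Function.comp_def] using h'

lemma continuous_partialRadius {σ : ℝ} {u : ℝ × ConeCircle σ → ℂ} (hu : u ∈ coneTest σ) :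
    Continuous (partialRadius u) := by
  refine (isOpenQuotientMap_cover σ).continuous_comp_iff.1 ?_
  refine ((hu.1.continuous_fderiv (by simp)).clm_apply continuous_const).congr
    (f := fun p : ℝ × ℝ =>
      fderiv ℝ (fun p : ℝ × ℝ => u (p.1, (p.2 : ConeCircle σ))) p ((1, 0) : ℝ × ℝ)) fun p => ?_
  exact (hasDerivAt_radius hu p.1 p.2).deriv.symm

lemma continuous_partialAngle {σ : ℝ} {u : ℝ × ConeCircle σ → ℂ} (hu : u ∈ coneTest σ) :
    Continuous (partialAngle u) := by
  refine (isOpenQuotientMap_cover σ).continuous_comp_iff.1 ?_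
  refine ((hu.1.continuous_fderiv (by simp)).clm_apply continuous_const).congr
    (f := fun p : ℝ × ℝ =>
      fderiv ℝ (fun p : ℝ × ℝ => u (p.1, (p.2 : ConeCircle σ))) p ((0, 1) : ℝ × ℝ)) fun p => ?_
  exact (hasDerivAt_angle hu p.1 p.2).deriv.symm

lemma coneExpr_eq_zero {σ : ℝ} (ε : ℝ) {u : ℝ × ConeCircle σ → ℂ} {p : ℝ × ConeCircle σ}
    (hp : p ∉ tsupport u) : coneExpr ε u p = 0 := by
  have h : u =ᶠ[𝓝 p] 0 := notMem_tsupport_iff_eventuallyEq.1 hp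
  have h1 : (fun s : ℝ => u (s, p.2)) =ᶠ[𝓝 p.1] fun _ => 0 :=
    (Continuous.tendsto (f := fun s : ℝ => (s, p.2)) (by fun_prop) p.1).eventually h
  have h2 : (fun t : ℝ => u (p.1, p.2 + (t : ConeCircle σ))) =ᶠ[𝓝 0] fun _ => 0 := by
    have hc : Continuous fun t : ℝ => (p.1, p.2 + (t : ConeCircle σ)) :=
      continuous_const.prodMk (continuous_const.add (AddCircle.continuous_mk' _))
    have ht := hc.tendsto 0
    rw [AddCircle.coe_zero, add_zero] at ht
    exact ht.eventually h
  simp [coneExpr, partialRadius, partialAngle, h1.deriv_eq, h2.deriv_eq, h.eq_of_nhds]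

lemma tsupport_coneExpr {σ : ℝ} (ε : ℝ) (u : ℝ × ConeCircle σ → ℂ) :
    tsupport (coneExpr ε u) ⊆ tsupport u :=
  closure_minimal (fun _ hp => by_contra fun h => hp (coneExpr_eq_zero ε h)) (isClosed_tsupport u)

lemma memLp_coneTest {σ : ℝ} [Fact (0 < σ)] {u : ℝ × ConeCircle σ → ℂ} (hu : u ∈ coneTest σ) :
    MemLp u 2 (coneMeasure σ) :=
  (continuous_coneTest hu).memLp_of_hasCompactSupport hu.2.1

lemma memLp_coneExpr {σ : ℝ} [Fact (0 < σ)] (ε : ℝ) {u : ℝ × ConeCircle σ → ℂ}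
    (hu : u ∈ coneTest σ) : MemLp (coneExpr ε u) 2 (coneMeasure σ) := by
  have hc : Continuous (coneExpr ε u) := by
    refine ContinuousOn.continuous_of_tsupport_subset ?_ (isOpen_Ioi.prod isOpen_univ)
      ((tsupport_coneExpr ε u).trans hu.2.2)
    have h0 : ∀ p ∈ (Ioi 0 ×ˢ univ : Set (ℝ × ConeCircle σ)), p.1 ≠ 0 := fun p hp => ne_of_gt hp.1
    have h1 : ContinuousOn (fun p : ℝ × ConeCircle σ => ((1 / (2 * p.1) : ℝ) : ℂ))
        (Ioi 0 ×ˢ univ) :=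
      Complex.continuous_ofReal.comp_continuousOn (continuousOn_const.div (by fun_prop)
        fun p hp => mul_ne_zero two_ne_zero (h0 p hp))
    have h2 : ContinuousOn (fun p : ℝ × ConeCircle σ => ((1 / p.1 : ℝ) : ℂ)) (Ioi 0 ×ˢ univ) :=
      Complex.continuous_ofReal.comp_continuousOn (continuousOn_const.div (by fun_prop) h0)
    exact (continuousOn_const.mul ((continuous_partialRadius hu).continuousOn.add
      (h1.mul (continuous_coneTest hu).continuousOn))).add
      (h2.mul (continuousOn_const.mul (continuous_partialAngle hu).continuousOn))
  exact hc.memLp_of_hasCompactSupport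
    (hu.2.1.of_isClosed_subset (isClosed_tsupport _) (tsupport_coneExpr ε u))

/-- The inclusion `C_c^∞(X) → L²(X)`. -/
def coneTestToL2 (σ : ℝ) [Fact (0 < σ)] : coneTest σ →ₗ[ℂ] ConeL2 σ where
  toFun u := (memLp_coneTest u.2).toLp u.1
  map_add' _ _ := rfl
  map_smul' _ _ := rfl

lemma differentiableAt_radius {σ : ℝ} {u : ℝ × ConeCircle σ → ℂ} (hu : u ∈ coneTest σ)
    (p : ℝ × ConeCircle σ) : DifferentiableAt ℝ (fun s : ℝ => u (s, p.2)) p.1 := by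
  obtain ⟨r, x⟩ := p
  obtain ⟨t, rfl⟩ := QuotientAddGroup.mk_surjective x
  exact (hasDerivAt_radius hu r t).differentiableAt

lemma differentiableAt_angle {σ : ℝ} {u : ℝ × ConeCircle σ → ℂ} (hu : u ∈ coneTest σ)
    (p : ℝ × ConeCircle σ) :
    DifferentiableAt ℝ (fun t : ℝ => u (p.1, p.2 + (t : ConeCircle σ))) 0 := by
  obtain ⟨r, x⟩ := p
  obtain ⟨t, rfl⟩ := QuotientAddGroup.mk_surjective x
  exact (hasDerivAt_angle hu r t).differentiableAt

/-- The map `ε (∂_r + 1 / (2 r)) + (1 / r) i ∂_θ : C_c^∞(X) → L²(X)`. -/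
def coneTestExpr (σ : ℝ) [Fact (0 < σ)] (ε : ℝ) : coneTest σ →ₗ[ℂ] ConeL2 σ where
  toFun u := (memLp_coneExpr ε u.2).toLp (coneExpr ε u.1)
  map_add' u v := by
    rw [← MemLp.toLp_add]
    congr 1
    funext p
    have h1 : partialRadius (u.1 + v.1) p = partialRadius u.1 p + partialRadius v.1 p :=
      deriv_add (differentiableAt_radius u.2 p) (differentiableAt_radius v.2 p)
    have h2 : partialAngle (u.1 + v.1) p = partialAngle u.1 p + partialAngle v.1 p :=
      deriv_add (differentiableAt_angle u.2 p) (differentiableAt_angle v.2 p)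
    simp only [coneExpr, Pi.add_apply, Submodule.coe_add, h1, h2]
    ring
  map_smul' c u := by
    rw [RingHom.id_apply, ← MemLp.toLp_const_smul]
    congr 1
    funext p
    have h1 : partialRadius (c • u.1) p = c * partialRadius u.1 p := deriv_const_mul_field c
    have h2 : partialAngle (c • u.1) p = c * partialAngle u.1 p := deriv_const_mul_field c
    simp only [coneExpr, Pi.smul_apply, Submodule.coe_smul, smul_eq_mul, h1, h2]
    ring

lemma coneTestToL2_injective (σ : ℝ) [Fact (0 < σ)] : Function.Injective (coneTestToL2 σ) := by
  refine (injective_iff_map_eq_zero _).2 fun u hu => ?_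
  have h : u.1 =ᵐ[coneMeasure σ] 0 := (MemLp.toLp_eq_toLp_iff (memLp_coneTest u.2)
    (memLp_coneTest (0 : coneTest σ).2)).1 (hu.trans (coneTestToL2 σ).map_zero.symm)
  ext p
  by_contra hp
  have ho : IsOpen {q | u.1 q ≠ 0} := isOpen_ne_fun (continuous_coneTest u.2) continuous_const
  obtain ⟨U, V, hU, hV, hpU, hpV, hUV⟩ := isOpen_prod_iff.1 ho p.1 p.2 hp
  have h0 : (coneMeasure σ) (U ×ˢ V) = 0 := measure_mono_null hUV h
  rw [coneMeasure, Measure.prod_prod, mul_eq_zero] at h0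
  rcases h0 with h0 | h0
  · exact radialMeasure_pos hU ⟨p.1, hpU, (u.2.2.2 (subset_tsupport _ hp)).1⟩ h0
  · exact (hV.measure_pos volume ⟨p.2, hpV⟩).ne' h0

/-- The Dirac operator on the cone,
`D_σ (φ, ψ) = (-(∂_r + 1/(2r)) ψ + (1/r) i ∂_θ ψ, (∂_r + 1/(2r)) φ + (1/r) i ∂_θ φ)`,
in `L²(X)²` with domain `C_c^∞(X)²`. -/
def dirac (σ : ℝ) [Fact (0 < σ)] : ConeSpinor σ →ₗ.[ℂ] ConeSpinor σ :=
  ofInjective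
    (pair (coneTestToL2 σ ∘ₗ LinearMap.fst ℂ (coneTest σ) (coneTest σ))
      (coneTestToL2 σ ∘ₗ LinearMap.snd ℂ (coneTest σ) (coneTest σ)))
    (pair (coneTestExpr σ (-1) ∘ₗ LinearMap.snd ℂ (coneTest σ) (coneTest σ))
      (coneTestExpr σ 1 ∘ₗ LinearMap.fst ℂ (coneTest σ) (coneTest σ)))
    (pair_injective (coneTestToL2_injective σ) (coneTestToL2_injective σ))

/-! ### Angular modes and the operators `D_{σ,γ}` -/

lemma memLp_mode (σ : ℝ) [Fact (0 < σ)] (k : ℤ) (φ : RadialL2) :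
    MemLp (fun p : ℝ × ConeCircle σ => φ p.1 * fourier (-k) p.2) 2 (coneMeasure σ) := by
  have h : MemLp (fun p : ℝ × ConeCircle σ => φ p.1) 2 (coneMeasure σ) :=
    (Lp.memLp φ).comp_fst volume
  have hf : Continuous fun p : ℝ × ConeCircle σ => fourier (-k) p.2 := by fun_prop
  refine (memLp_congr_norm (h.1.mul hf.aestronglyMeasurable) h.1 (Eventually.of_forall
    fun p => ?_)).2 h
  rw [Pi.mul_apply, norm_mul, fourier_apply, Circle.norm_coe, mul_one]

lemma ae_comp_fst (σ : ℝ) [Fact (0 < σ)] {f g : ℝ → ℂ} (h : f =ᵐ[radialMeasure] g) :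
    ∀ᵐ p ∂(coneMeasure σ), f p.1 = g p.1 :=
  Measure.quasiMeasurePreserving_fst.ae h

/-- The map `φ(r) ↦ φ(r) e^{-ikθ/σ}` from `L²(r dr)` to `L²(X)`; on `ℝ / 2πσℤ` the character
`fourier n` is `θ ↦ exp(2πi n θ / (2πσ)) = exp(i n θ / σ)`. -/
def scalarMode (σ : ℝ) [Fact (0 < σ)] (k : ℤ) : RadialL2 →ₗ[ℂ] ConeL2 σ where
  toFun φ := (memLp_mode σ k φ).toLp _
  map_add' φ φ' := by
    rw [← MemLp.toLp_add]
    refine MemLp.toLp_congr _ _ ?_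
    filter_upwards [ae_comp_fst σ (Lp.coeFn_add φ φ')] with p hp
    simp only [hp, Pi.add_apply, add_mul]
  map_smul' c φ := by
    rw [RingHom.id_apply, ← MemLp.toLp_const_smul]
    refine MemLp.toLp_congr _ _ ?_
    filter_upwards [ae_comp_fst σ (Lp.coeFn_smul c φ)] with p hp
    simp only [hp, Pi.smul_apply, smul_eq_mul, mul_assoc]

/-- The map `(φ(r), ψ(r)) ↦ (φ(r) e^{-ikθ/σ}, ψ(r) e^{-ikθ/σ})` from `L²(r dr)²` onto
`L²(r dr)² ⊗ h_k ⊆ L²(X)²`. -/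
def mode (σ : ℝ) [Fact (0 < σ)] (k : ℤ) : RadialSpinor →ₗ[ℂ] ConeSpinor σ :=
  pair (scalarMode σ k ∘ₗ WithLp.fstₗ 2 ℂ RadialL2 RadialL2) (scalarMode σ k ∘ₗ WithLp.sndₗ 2 ℂ RadialL2 RadialL2)

lemma inner_scalarMode (σ : ℝ) [Fact (0 < σ)] (j k : ℤ) (φ ψ : RadialL2) :
    inner ℂ (scalarMode σ j φ) (scalarMode σ k ψ) =
      if j = k then (2 * π * σ : ℝ) * inner ℂ φ ψ else 0 := by
  have h1 : inner ℂ (scalarMode σ j φ) (scalarMode σ k ψ) =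
      ∫ p : ℝ × ConeCircle σ, inner ℂ (φ p.1) (ψ p.1) *
        (fourier j p.2 * fourier (-k) p.2) ∂(radialMeasure.prod volume) := by
    rw [L2.inner_def]
    refine integral_congr_ae ?_
    filter_upwards [(memLp_mode σ j φ).coeFn_toLp, (memLp_mode σ k ψ).coeFn_toLp] with p h1 h2
    simp only [scalarMode, LinearMap.coe_mk, AddHom.coe_mk, h1, h2, RCLike.inner_apply, map_mul,
      ← fourier_neg, neg_neg]
    ring
  have h2 : ∫ x : ConeCircle σ, fourier j x * fourier (-k) x =
      if j = k then ((2 * π * σ : ℝ) : ℂ) else 0 := by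
    have h3 := congrFun (fourierCoeff_fourier (T := 2 * π * σ) j) k
    rw [fourierCoeff, AddCircle.integral_haarAddCircle, inv_smul_eq_iff₀
      (Fact.out (p := 0 < 2 * π * σ)).ne'] at h3
    simp only [smul_eq_mul, mul_comm (fourier (-k) _)] at h3
    rw [h3]
    by_cases hjk : j = k
    · subst hjk; simp
    · simp [hjk, Ne.symm hjk]
  rw [h1, integral_prod_mul (fun r => inner ℂ (φ r) (ψ r))
    (fun x : ConeCircle σ => fourier j x * fourier (-k) x), h2, ← L2.inner_def]
  split_ifs <;> ring

lemma inner_mode (σ : ℝ) [Fact (0 < σ)] (j k : ℤ) (f g : RadialSpinor) :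
    inner ℂ (mode σ j f) (mode σ k g) =
      if j = k then (2 * π * σ : ℝ) * inner ℂ f g else 0 := by
  rw [WithLp.prod_inner_apply, WithLp.prod_inner_apply]
  have h1 := inner_scalarMode σ j k f.fst g.fst
  have h2 := inner_scalarMode σ j k f.snd g.snd
  refine (congrArg₂ (· + ·) h1 h2).trans ?_
  split_ifs
  · exact (mul_add _ _ _).symm
  · simp

lemma eq_zero_of_hasSum_mode {σ : ℝ} [Fact (0 < σ)] {a : ℤ → RadialSpinor}
    (h : HasSum (fun k => mode σ k (a k)) 0) (j : ℤ) : a j = 0 := by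
  have h1 := ContinuousLinearMap.hasSum (innerSL ℂ (mode σ j (a j))) h
  have h2 : ∀ k, innerSL ℂ (mode σ j (a j)) (mode σ k (a k)) =
      if k = j then (2 * π * σ : ℝ) * inner ℂ (a j) (a j) else 0 := fun k => by
    rw [innerSL_apply_apply, inner_mode]
    by_cases hk : j = k
    · subst hk; simp
    · rw [if_neg hk, if_neg (Ne.symm hk)]
  simp only [h2, map_zero] at h1
  have h3 := h1.unique (hasSum_ite_eq j _)
  have h4 : ((2 * π * σ : ℝ) : ℂ) ≠ 0 :=
    Complex.ofReal_ne_zero.2 (Fact.out (p := 0 < 2 * π * σ)).ne'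
  exact inner_self_eq_zero.1 ((mul_eq_zero.1 h3.symm).resolve_left h4)

/-- The graph of the orthogonal sum of the operators `A k ⊗ I₂` on `L²(r dr)² ⊗ h_k`: the pairs
`(∑ a_k e^{-ikθ/σ}, ∑ (A_k a_k) e^{-ikθ/σ})` with `a_k` in the domain of `A k` and both series
convergent in `L²(X)²`. -/
def modeSumGraph (σ : ℝ) [Fact (0 < σ)] (A : ℤ → RadialSpinor →ₗ.[ℂ] RadialSpinor) :
    Submodule ℂ (ConeSpinor σ × ConeSpinor σ) where
  carrier := {p | ∃ a b : ℤ → RadialSpinor, (∀ k, (a k, b k) ∈ (A k).graph) ∧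
    HasSum (fun k => mode σ k (a k)) p.1 ∧ HasSum (fun k => mode σ k (b k)) p.2}
  zero_mem' := ⟨0, 0, fun k => (A k).graph.zero_mem, by simp, by simp⟩
  add_mem' := by
    rintro p q ⟨a, b, h, ha, hb⟩ ⟨a', b', h', ha', hb'⟩
    refine ⟨a + a', b + b', fun k => (A k).graph.add_mem (h k) (h' k), ?_, ?_⟩
    · simpa using ha.add ha'
    · simpa using hb.add hb'
  smul_mem' := by
    rintro c p ⟨a, b, h, ha, hb⟩
    refine ⟨c • a, c • b, fun k => (A k).graph.smul_mem c (h k), ?_, ?_⟩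
    · simpa using ha.const_smul c
    · simpa using hb.const_smul c

/-- The orthogonal sum `⨁ A_k ⊗ I₂`. -/
def modeSum (σ : ℝ) [Fact (0 < σ)] (A : ℤ → RadialSpinor →ₗ.[ℂ] RadialSpinor) :
    ConeSpinor σ →ₗ.[ℂ] ConeSpinor σ :=
  (modeSumGraph σ A).toLinearPMap

lemma modeSum_graph (σ : ℝ) [Fact (0 < σ)] (A : ℤ → RadialSpinor →ₗ.[ℂ] RadialSpinor) :
    (modeSum σ A).graph = modeSumGraph σ A := by
  refine Submodule.toLinearPMap_graph_eq _ ?_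
  rintro ⟨f, g⟩ ⟨a, b, h, ha, hb⟩ hf
  obtain rfl : f = 0 := hf
  have hb0 : ∀ k, b k = 0 := fun k => by
    have h1 := h k
    rw [eq_zero_of_hasSum_mode ha k] at h1
    exact LinearPMap.graph_fst_eq_zero_snd _ h1 rfl
  simp only [hb0, map_zero] at hb
  exact hb.unique hasSum_zero

/-- The operator `D_{σ,γ} = (d₀^γ ⊗ I₂) ⊕ ⨁_{k ≠ 0} (d_k ⊗ I₂)`, with domain
`(Y^γ ⊗ h_0) ⊕ ⨁_{k ≠ 0} (Y ⊗ h_k)`. -/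
def diracExt (σ γ : ℝ) [Fact (0 < σ)] : ConeSpinor σ →ₗ.[ℂ] ConeSpinor σ :=
  modeSum σ fun k => if k = 0 then radialDiracExt σ γ else radialDiracY σ k

end DiracCone

end

open DiracCone

/-!
The operators `d_k` and `D_σ` are studied through their graphs, submodules of `H × H`, and the
boundary form `⟪A f, f'⟫ - ⟪f, A f'⟫`; the adjoint of a graph is its annihilator under this form
(`mem_adjoint_iff_boundaryForm`), and the double adjoint is the closure
(`adjoint_adjoint_eq_topologicalClosure`).

*Radial operators.* The adjoint of `d_k` is the maximal operator, defined by the weak equations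
`∂_{1/2+k/σ} φ = g₂`, `∂_{1/2-k/σ} ψ = -g₁` (`mem_adjoint_graph_radialDirac`). For a solution of
`∂_μ f = g` with `f, g ∈ L²(r dr)`, the energy identity
`(r^m |f|²)' = (m - 2μ) r^(m-1) |f|² + 2 r^m Re(conj f · g)` shows that `f / r ∈ L²(r dr)` as soon as
`μ > 1` or `μ < 0` (`BesselRel.memLp_div`), and then `f` is continuous up to `r = 0` with value
zero there (`BesselRel.exists_regular`). As `σ ≤ 1`, for `k ≠ 0` both exponents `1/2 ± k/σ` lie in
this range, so that the maximal domain is `Y`. For `k = 0` both exponents are `1/2`, and `√r f(r)`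
has a limit at `0`; subtracting a multiple of `K_{1/2}` removes it
(`BesselRel.exists_sub_smul_besselK`), so that the maximal domain is `Y` plus a plane of boundary
values `c ∈ ℂ²`, on which the boundary form is a nonzero multiple of
`conj c₂ · d₁ - conj c₁ · d₂` (`boundaryForm_singularPair`). On `Y` the boundary form vanishes. Hence
the closure of `d_k` is the operator on `Y` (`closure_radialDirac`), it is self-adjoint for `k ≠ 0`,
and `d_0^γ` is self-adjoint, its domain being a Lagrangian line of boundary values.

*The cone.* By Fourier series in `θ` the spaces `L²(r dr)² ⊗ h_k` form an orthogonal decomposition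
of `L²(X)²` (`exists_hasSum_mode`), and an orthogonal sum of self-adjoint operators is self-adjoint
(`isSelfAdjoint_modeSum`). Since `D_σ` acts on the `k`-th mode as `d_k`, the components of an element
of the adjoint of `D_σ` lie in the adjoints of the `d_k` (`component_mem_adjoint`). As `D_σ` is
symmetric and test functions vanish near the tip, `D_σ ≤ D_{σ,γ}` for all `γ`. Conversely a
self-adjoint extension is contained in the adjoint of `D_σ`, so only the mode `k = 0` contributes to
its boundary form; its boundary values form an isotropic subset of `ℂ²`, contained in a line
`ℂ (cos γ, sin γ)` with real `γ` (`exists_angle_of_isotropic`), and the extension is `D_{σ,γ}`.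
-/

namespace DiracCone

/-! ### Primitives on the half line -/

/-- `F` is a primitive of `h` on `(0, ∞)` in the sense of Lebesgue: `h` is integrable on compact
subintervals of `(0, ∞)` and `F b - F a = ∫ h` over `[a, b]`. -/
def IsPrimitive {E : Type*} [NormedAddCommGroup E] [NormedSpace ℝ E] (F h : ℝ → E) : Prop :=
  ∀ ⦃a b : ℝ⦄, 0 < a → a ≤ b → IntervalIntegrable h volume a b ∧ ∫ x in a..b, h x = F b - F a

section IsPrimitive

variable {E : Type*} [NormedAddCommGroup E] [NormedSpace ℝ E] {F G h k : ℝ → E}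

lemma IsPrimitive.congr_deriv (hF : IsPrimitive F h)
    (hk : ∀ᵐ r ∂volume.restrict (Ioi (0 : ℝ)), h r = k r) : IsPrimitive F k := by
  intro a b ha hab
  have h1 : ∀ᵐ r ∂volume.restrict (uIoc a b), h r = k r := by
    refine ae_mono (Measure.restrict_mono ?_ le_rfl) hk
    rw [uIoc_of_le hab]
    exact fun r hr => ha.trans hr.1
  refine ⟨(hF ha hab).1.congr_ae h1, ?_⟩
  rw [← (hF ha hab).2]
  exact intervalIntegral.integral_congr_ae_restrict (h1.mono fun r hr => hr.symm)

lemma IsPrimitive.add (hF : IsPrimitive F h) (hG : IsPrimitive G k) :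
    IsPrimitive (fun r => F r + G r) fun r => h r + k r := by
  intro a b ha hab
  obtain ⟨h1, h2⟩ := hF ha hab
  obtain ⟨h3, h4⟩ := hG ha hab
  refine ⟨h1.add h3, ?_⟩
  rw [intervalIntegral.integral_add h1 h3, h2, h4, sub_add_sub_comm]

lemma IsPrimitive.continuousOn (hF : IsPrimitive F h) : ContinuousOn F (Ioi 0) := by
  intro r hr
  have hr' : (0 : ℝ) < r := hr
  refine ContinuousAt.continuousWithinAt ?_
  have hab : r / 2 ≤ 2 * r := by linarith
  have hi := (hF (half_pos hr') hab).1
  have hc := intervalIntegral.continuousOn_primitive_interval' hi left_mem_uIcc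
  rw [uIcc_of_le hab] at hc
  have hc2 : ContinuousOn F (Icc (r / 2) (2 * r)) := by
    refine (hc.add (continuousOn_const (c := F (r / 2)))).congr fun x hx => ?_
    simp only [Pi.add_apply, (hF (half_pos hr') hx.1).2, sub_add_cancel]
  exact hc2.continuousAt (Icc_mem_nhds (by linarith) (by linarith))

lemma IsPrimitive.clm_comp {E' : Type*} [NormedAddCommGroup E'] [NormedSpace ℝ E']
    [CompleteSpace E] [CompleteSpace E']
    (L : E →L[ℝ] E') (hF : IsPrimitive F h) :
    IsPrimitive (fun r => L (F r)) fun r => L (h r) := by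
  intro a b ha hab
  obtain ⟨h1, h2⟩ := hF ha hab
  refine ⟨?_, ?_⟩
  · rw [intervalIntegrable_iff] at h1 ⊢
    exact L.integrable_comp h1
  · rw [L.intervalIntegral_comp_comm h1, h2, map_sub]

lemma isPrimitive_of_hasDerivAt [CompleteSpace E] (hF : ∀ r, 0 < r → HasDerivAt F (h r) r)
    (hh : ContinuousOn h (Ioi 0)) : IsPrimitive F h := by
  intro a b ha hab
  have hs : uIcc a b ⊆ Ioi 0 := by
    rw [uIcc_of_le hab]; exact fun r hr => ha.trans_le hr.1
  have hi : IntervalIntegrable h volume a b := (hh.mono hs).intervalIntegrable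
  exact ⟨hi, intervalIntegral.integral_eq_sub_of_hasDerivAt (fun r hr => hF r (hs hr)) hi⟩

end IsPrimitive

lemma IsPrimitive.mul_real {F G h k : ℝ → ℝ} (hF : IsPrimitive F h) (hG : IsPrimitive G k) :
    IsPrimitive (fun r => F r * G r) fun r => h r * G r + F r * k r := by
  intro a b ha hab
  obtain ⟨h1, h2⟩ := hF ha hab
  obtain ⟨h3, h4⟩ := hG ha hab
  have hs : uIcc a b ⊆ Ioi 0 := by
    rw [uIcc_of_le hab]; exact fun r hr => ha.trans_le hr.1
  refine ⟨(h1.mul_continuousOn (hG.continuousOn.mono hs)).add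
    (h3.continuousOn_mul (hF.continuousOn.mono hs)), ?_⟩
  -- the representatives below agree with `F`, `G` on `[a, b]` and are absolutely continuous there
  let F' : ℝ → ℝ := fun x => (∫ t in a..x, h t) + F a
  let G' : ℝ → ℝ := fun x => (∫ t in a..x, k t) + G a
  have eF : ∀ x ∈ Icc a b, F' x = F x := fun x hx => by
    simp only [F', (hF ha hx.1).2]; ring
  have eG : ∀ x ∈ Icc a b, G' x = G x := fun x hx => by
    simp only [G', (hG ha hx.1).2]; ring
  have cst : ∀ c : ℝ, AbsolutelyContinuousOnInterval (fun _ => c) a b := fun c =>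
    ((LipschitzWith.const c).lipschitzOnWith (s := uIcc a b)).absolutelyContinuousOnInterval
  have aF : AbsolutelyContinuousOnInterval F' a b :=
    (h1.absolutelyContinuousOnInterval_intervalIntegral left_mem_uIcc).add (cst _)
  have aG : AbsolutelyContinuousOnInterval G' a b :=
    (h3.absolutelyContinuousOnInterval_intervalIntegral left_mem_uIcc).add (cst _)
  have key := aF.integral_deriv_mul_eq_sub aG
  rw [eF a ⟨le_rfl, hab⟩, eF b ⟨hab, le_rfl⟩, eG a ⟨le_rfl, hab⟩, eG b ⟨hab, le_rfl⟩] at key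
  rw [← key]
  refine intervalIntegral.integral_congr_ae ?_
  filter_upwards [h1.ae_hasDerivAt_integral, h3.ae_hasDerivAt_integral] with x hx1 hx2 hx
  have hx' := uIoc_subset_uIcc hx
  have d1 : deriv F' x = h x := ((hx1 hx' a left_mem_uIcc).add_const (F a)).deriv
  have d2 : deriv G' x = k x := ((hx2 hx' a left_mem_uIcc).add_const (G a)).deriv
  rw [uIcc_of_le hab] at hx'
  rw [d1, d2, eF x hx', eG x hx']

/-- The product rule for primitives, from that for absolutely continuous functions applied to real
and imaginary parts. -/
lemma IsPrimitive.mul {F G h k : ℝ → ℂ} (hF : IsPrimitive F h) (hG : IsPrimitive G k) :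
    IsPrimitive (fun r => F r * G r) fun r => h r * G r + F r * k r := by
  have r1 := hF.clm_comp Complex.reCLM
  have i1 := hF.clm_comp Complex.imCLM
  have r2 := hG.clm_comp Complex.reCLM
  have i2 := hG.clm_comp Complex.imCLM
  have A := ((r1.mul_real r2).add ((i1.mul_real i2).clm_comp (-ContinuousLinearMap.id ℝ ℝ))).clm_comp
    Complex.ofRealCLM
  have B := (((r1.mul_real i2).add (i1.mul_real r2)).clm_comp Complex.ofRealCLM).clm_comp
    (ContinuousLinearMap.mul ℝ ℂ Complex.I)
  have key := A.add B
  convert key using 1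
  · funext r
    refine Complex.ext (by simp; ring) (by simp)
  · funext r
    refine Complex.ext (by simp; ring) (by simp; ring)

lemma IsPrimitive.conj {F h : ℝ → ℂ} (hF : IsPrimitive F h) :
    IsPrimitive (fun r => (starRingEnd ℂ) (F r)) fun r => (starRingEnd ℂ) (h r) :=
  hF.clm_comp (Complex.conjCLE : ℂ →L[ℝ] ℂ)

/-! ### Weak derivatives on the half line -/

lemma integral_Ioi_eq_intervalIntegral {w : ℝ → ℂ} {a b : ℝ} (ha : 0 < a) (hab : a ≤ b)
    (hw : ∀ r, r ∉ Ioc a b → w r = 0) : ∫ r in Ioi 0, w r = ∫ r in a..b, w r := by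
  rw [intervalIntegral.integral_of_le hab]
  refine setIntegral_eq_of_subset_of_forall_sdiff_eq_zero measurableSet_Ioi
    (fun r hr => ha.trans hr.1) fun r hr => hw r hr.2

lemma exists_Icc_of_radialTest {u : ℝ → ℂ} (hu : HasCompactSupport u) (hs : tsupport u ⊆ Ioi 0) :
    ∃ a b : ℝ, 0 < a ∧ a < b ∧ tsupport u ⊆ Ioo a b := by
  rcases (tsupport u).eq_empty_or_nonempty with h | h
  · exact ⟨1, 2, one_pos, one_lt_two, by simp [h]⟩
  · have h1 := hu.isCompact.sInf_mem h
    have h2 := hu.isCompact.sSup_mem h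
    have h3 : 0 < sInf (tsupport u) := hs h1
    have h4 := csInf_le hu.isCompact.bddBelow h2
    refine ⟨sInf (tsupport u) / 2, sSup (tsupport u) + 1, by positivity, by linarith,
      fun r hr => ⟨?_, ?_⟩⟩
    · linarith [csInf_le hu.isCompact.bddBelow hr]
    · linarith [le_csSup hu.isCompact.bddAbove hr]

lemma isPrimitive_radialTest {u : ℝ → ℂ} (hu : u ∈ radialTest) : IsPrimitive u (deriv u) :=
  isPrimitive_of_hasDerivAt (fun r _ => (hu.1.differentiable (by simp) r).hasDerivAt)
    (hu.1.continuous_deriv (by simp)).continuousOn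

lemma IsPrimitive.hasWeakDeriv {F h : ℝ → ℂ} (hF : IsPrimitive F h) : HasWeakDeriv F h := by
  intro u hu
  obtain ⟨a, b, ha, hab, hs⟩ := exists_Icc_of_radialTest hu.2.1 hu.2.2
  have h0 : ∀ r, r ∉ Ioo a b → u r = 0 := fun r hr =>
    image_eq_zero_of_notMem_tsupport fun h => hr (hs h)
  have h0' : ∀ r, r ∉ Ioo a b → deriv u r = 0 := fun r hr => by
    refine Function.notMem_support.1 fun h => hr (hs (support_deriv_subset h))
  have hsub : ∀ r, r ∉ Ioc a b → r ∉ Ioo a b := fun r hr h => hr ⟨h.1, h.2.le⟩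
  have key := ((hF.mul (isPrimitive_radialTest hu)) ha hab.le).2
  have hsI : uIcc a b ⊆ Ioi 0 := by
    rw [uIcc_of_le hab.le]; exact fun r hr => ha.trans_le hr.1
  have i1 : IntervalIntegrable (fun r => h r * u r) volume a b :=
    (hF ha hab.le).1.mul_continuousOn hu.1.continuous.continuousOn
  have i2 : IntervalIntegrable (fun r => F r * deriv u r) volume a b :=
    ((hF.continuousOn.mono hsI).mul (hu.1.continuous_deriv (by simp)).continuousOn).intervalIntegrable
  simp only [intervalIntegral.integral_add i1 i2, show u a = 0 from h0 a fun h => h.1.false,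
    show u b = 0 from h0 b fun h => h.2.false] at key
  rw [integral_Ioi_eq_intervalIntegral ha hab.le fun r hr => by rw [h0' r (hsub r hr), mul_zero],
    integral_Ioi_eq_intervalIntegral ha hab.le fun r hr => by rw [h0 r (hsub r hr), mul_zero]]
  linear_combination key

lemma ofReal_mem_radialTest {g : ℝ → ℝ} (hg : ContDiff ℝ ∞ g) (hc : HasCompactSupport g)
    (hs : tsupport g ⊆ Ioi 0) : (fun r => (g r : ℂ)) ∈ radialTest :=
  ⟨Complex.ofRealCLM.contDiff.comp hg, hc.comp_left (g := ((↑) : ℝ → ℂ)) rfl,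
    (closure_mono fun r hr => by simpa using hr).trans hs⟩

/-- A test function with vanishing integral is the derivative of a test function. -/
lemma exists_deriv_eq_of_integral_eq_zero {v : ℝ → ℂ} (hv : v ∈ radialTest)
    (h0 : ∫ r, v r = 0) : ∃ w ∈ radialTest, deriv w = v := by
  obtain ⟨a, b, ha, hab, hs⟩ := exists_Icc_of_radialTest hv.2.1 hv.2.2
  have hz : ∀ r, r ∉ Ioo a b → v r = 0 := fun r hr =>
    image_eq_zero_of_notMem_tsupport fun h => hr (hs h)
  have hvc : Continuous v := hv.1.continuous
  have hd : ∀ r, HasDerivAt (fun x => ∫ t in a..x, v t) (v r) r := fun r =>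
    hvc.integral_hasStrictDerivAt a r |>.hasDerivAt
  have hd' : deriv (fun x => ∫ t in a..x, v t) = v := funext fun r => (hd r).deriv
  have hleft : ∀ x ≤ a, ∫ t in a..x, v t = 0 := fun x hx => by
    refine (intervalIntegral.integral_congr (g := fun _ => 0) fun t ht => ?_).trans (by simp)
    rw [uIcc_of_ge hx] at ht
    exact hz t fun h => absurd h.1 (not_lt.2 ht.2)
  have hright : ∀ x, b ≤ x → ∫ t in a..x, v t = 0 := fun x hx => by
    rw [← h0, intervalIntegral.integral_of_le (hab.le.trans hx)]
    exact setIntegral_eq_integral_of_forall_compl_eq_zero fun t ht =>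
      hz t fun h => ht ⟨h.1, h.2.le.trans hx⟩
  have hsupp : tsupport (fun x => ∫ t in a..x, v t) ⊆ Icc a b := by
    refine closure_minimal (fun x hx => ?_) isClosed_Icc
    by_contra h
    rcases le_or_gt x a with h1 | h1
    · exact hx (hleft x h1)
    · exact hx (hright x (not_lt.1 fun h2 => h ⟨h1.le, h2.le⟩))
  refine ⟨fun x => ∫ t in a..x, v t, ⟨?_, ?_, ?_⟩, hd'⟩
  · rw [contDiff_infty_iff_deriv, hd']
    exact ⟨fun r => (hd r).differentiableAt, hv.1⟩
  · exact HasCompactSupport.of_support_subset_isCompact isCompact_Icc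
      ((subset_tsupport _).trans hsupp)
  · exact hsupp.trans fun r hr => ha.trans_le hr.1

lemma integrable_radialTest_mul {f : ℝ → ℂ} (hf : LocallyIntegrableOn f (Ioi 0)) {u : ℝ → ℂ}
    (hu : u ∈ radialTest) : IntegrableOn (fun r => f r * u r) (Ioi 0) := by
  have h1 : IntegrableOn f (tsupport u) :=
    (locallyIntegrableOn_iff isOpen_Ioi.isLocallyClosed).1 hf _ hu.2.2 hu.2.1
  have h2 := h1.mul_continuousOn hu.1.continuous.continuousOn hu.2.1
  refine IntegrableOn.mono_set (IntegrableOn.of_forall_sdiff_eq_zero h2 measurableSet_Ioi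
    fun r hr => ?_) Subset.rfl
  rw [image_eq_zero_of_notMem_tsupport hr.2, mul_zero]

lemma integral_Ioi_radialTest {u : ℝ → ℂ} (hu : u ∈ radialTest) :
    ∫ r in Ioi 0, u r = ∫ r, u r :=
  setIntegral_eq_integral_of_forall_compl_eq_zero fun _ hr =>
    image_eq_zero_of_notMem_tsupport fun h => hr (hu.2.2 h)

/-- The du Bois-Reymond lemma on the half line. -/
lemma ae_const_of_hasWeakDeriv_zero {f : ℝ → ℂ} (hf : LocallyIntegrableOn f (Ioi 0))
    (h : HasWeakDeriv f 0) : ∃ c : ℂ, ∀ᵐ r ∂volume.restrict (Ioi (0 : ℝ)), f r = c := by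
  let φ : ContDiffBump (1 : ℝ) := ⟨1 / 4, 1 / 2, by norm_num, by norm_num⟩
  let ρ : ℝ → ℂ := fun r => (φ.normed volume r : ℂ)
  have hρ : ρ ∈ radialTest := by
    refine ofReal_mem_radialTest φ.contDiff_normed φ.hasCompactSupport_normed ?_
    rw [φ.tsupport_normed_eq, Real.closedBall_eq_Icc]
    exact fun r hr => lt_of_lt_of_le (by norm_num [φ]) hr.1
  have hρ1 : ∫ r, ρ r = 1 := by
    rw [integral_complex_ofReal, φ.integral_normed, Complex.ofReal_one]
  have key : ∀ u ∈ radialTest,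
      ∫ r in Ioi 0, f r * u r = (∫ r, u r) * ∫ r in Ioi 0, f r * ρ r := by
    intro u hu
    have hv : u + (-∫ r, u r) • ρ ∈ radialTest :=
      radialTest.add_mem hu (radialTest.smul_mem _ hρ)
    have iu : Integrable u := hu.1.continuous.integrable_of_hasCompactSupport hu.2.1
    have iρ : Integrable ρ := hρ.1.continuous.integrable_of_hasCompactSupport hρ.2.1
    obtain ⟨w, hw, hwd⟩ := exists_deriv_eq_of_integral_eq_zero hv (by
      simp only [Pi.add_apply, Pi.smul_apply, smul_eq_mul]
      rw [integral_add iu (iρ.const_mul _), integral_const_mul, hρ1]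
      ring)
    have h1 := h w hw
    simp only [hwd, Pi.zero_apply, zero_mul, integral_zero, neg_zero, Pi.add_apply, Pi.smul_apply,
      smul_eq_mul, mul_add] at h1
    simp only [mul_left_comm (f _)] at h1
    rw [integral_add (integrable_radialTest_mul hf hu)
      ((integrable_radialTest_mul hf hρ).const_mul _), integral_const_mul] at h1
    linear_combination h1
  refine ⟨∫ r in Ioi 0, f r * ρ r, (ae_restrict_iff' measurableSet_Ioi).2 ?_⟩
  have hc : LocallyIntegrableOn (fun _ : ℝ => ∫ r in Ioi 0, f r * ρ r) (Ioi (0 : ℝ)) :=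
    (continuous_const.locallyIntegrable).locallyIntegrableOn _
  refine (isOpen_Ioi.ae_eq_zero_of_integral_contDiff_smul_eq_zero (hf.sub hc)
    fun g hg hgc hgs => ?_).mono fun r hr hr' => sub_eq_zero.1 (hr hr')
  have hu := ofReal_mem_radialTest hg hgc hgs
  have e' : ∫ r, g r • (f r - ∫ r in Ioi 0, f r * ρ r) =
      ∫ r in Ioi 0, g r • (f r - ∫ r in Ioi 0, f r * ρ r) := by
    refine (setIntegral_eq_integral_of_forall_compl_eq_zero fun r hr => ?_).symm
    rw [image_eq_zero_of_notMem_tsupport fun h => hr (hgs h), zero_smul]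
  refine e'.trans ?_
  simp only [Complex.real_smul, mul_comm ((g _ : ℝ) : ℂ), sub_mul]
  rw [integral_sub (integrable_radialTest_mul hf hu) (integrable_radialTest_mul hc hu), key _ hu,
    integral_const_mul, integral_Ioi_radialTest hu]
  ring

lemma isPrimitive_integral {h : ℝ → ℂ} (hh : LocallyIntegrableOn h (Ioi 0)) :
    IsPrimitive (fun r => ∫ t in (1 : ℝ)..r, h t) h := by
  have hi : ∀ a b : ℝ, 0 < a → 0 < b → IntervalIntegrable h volume a b := fun a b ha hb => by
    refine intervalIntegrable_iff.2 (IntegrableOn.mono_set ?_ uIoc_subset_uIcc)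
    exact (locallyIntegrableOn_iff isOpen_Ioi.isLocallyClosed).1 hh _
      (fun r hr => (lt_min ha hb).trans_le hr.1) isCompact_uIcc
  intro a b ha hab
  have hb := ha.trans_le hab
  exact ⟨hi a b ha hb, (intervalIntegral.integral_interval_sub_left (hi 1 b one_pos hb)
    (hi 1 a one_pos ha)).symm⟩

/-- A weakly differentiable function has a representative that is the primitive of its weak
derivative. -/
lemma HasWeakDeriv.exists_isPrimitive {f h : ℝ → ℂ} (hf : LocallyIntegrableOn f (Ioi 0))
    (hh : LocallyIntegrableOn h (Ioi 0)) (hw : HasWeakDeriv f h) :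
    ∃ F, IsPrimitive F h ∧ ∀ᵐ r ∂volume.restrict (Ioi (0 : ℝ)), f r = F r := by
  have hH := isPrimitive_integral hh
  have hHl : LocallyIntegrableOn (fun r => ∫ t in (1 : ℝ)..r, h t) (Ioi 0) :=
    hH.continuousOn.locallyIntegrableOn measurableSet_Ioi
  obtain ⟨c, hc⟩ := ae_const_of_hasWeakDeriv_zero (hf.sub hHl) (by
    intro u hu
    have hu' : deriv u ∈ radialTest := ⟨hu.1.deriv' , hu.2.1.deriv,
      (closure_minimal support_deriv_subset (isClosed_tsupport u)).trans hu.2.2⟩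
    simp only [Pi.sub_apply, sub_mul, Pi.zero_apply, zero_mul, integral_zero, neg_zero]
    rw [integral_sub (integrable_radialTest_mul hf hu') (integrable_radialTest_mul hHl hu'),
      hw u hu, hH.hasWeakDeriv u hu, sub_self])
  refine ⟨fun r => (∫ t in (1 : ℝ)..r, h t) + c, fun a b ha hab => ?_, hc.mono fun r hr => ?_⟩
  · obtain ⟨h1, h2⟩ := hH ha hab
    exact ⟨h1, by rw [h2]; ring⟩
  · rw [← hr]; simp

/-! ### The weighted space `L²(r dr)` -/

lemma aestronglyMeasurable_radial_iff {f : ℝ → ℂ} :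
    AEStronglyMeasurable f radialMeasure ↔
      AEStronglyMeasurable f (volume.restrict (Ioi (0 : ℝ))) := by
  constructor
  · rintro ⟨g, hg, h⟩
    exact ⟨g, hg, ae_radial_iff.1 h⟩
  · rintro ⟨g, hg, h⟩
    exact ⟨g, hg, ae_radial_iff.2 h⟩

lemma integral_radialMeasure (f : ℝ → ℂ) :
    ∫ r, f r ∂radialMeasure = ∫ r in Ioi (0 : ℝ), (r : ℂ) * f r := by
  unfold radialMeasure
  refine (integral_withDensity_eq_integral_smul₀ (f := Real.toNNReal)
    measurable_real_toNNReal.aemeasurable f).trans ?_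
  refine setIntegral_congr_fun measurableSet_Ioi fun r hr => ?_
  simp [NNReal.smul_def, max_eq_left (le_of_lt (mem_Ioi.1 hr))]

lemma memLp_radial_iff {f : ℝ → ℂ} :
    MemLp f 2 radialMeasure ↔ AEStronglyMeasurable f (volume.restrict (Ioi (0 : ℝ))) ∧
      IntegrableOn (fun r => r * ‖f r‖ ^ 2) (Ioi 0) := by
  have key : AEStronglyMeasurable f radialMeasure →
      (MemLp f 2 radialMeasure ↔ IntegrableOn (fun r => r * ‖f r‖ ^ 2) (Ioi 0)) := fun hm => by
    rw [memLp_two_iff_integrable_sq_norm hm]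
    constructor
    · intro h
      have h1 := integrable_radialMeasure_iff.1 h.ofReal
      have h2 : IntegrableOn (fun r : ℝ => ((r : ℂ) * ((‖f r‖ ^ 2 : ℝ) : ℂ)).re) (Ioi 0) := h1.re
      refine h2.congr_fun (fun r _ => ?_) measurableSet_Ioi
      simp only [← Complex.ofReal_mul, Complex.ofReal_re]
    · intro h
      have h1 : Integrable (fun r => ((‖f r‖ ^ 2 : ℝ) : ℂ)) radialMeasure := by
        refine integrable_radialMeasure_iff.2 ?_
        have h2 : IntegrableOn (fun r => ((r * ‖f r‖ ^ 2 : ℝ) : ℂ)) (Ioi 0) := h.ofReal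
        refine h2.congr_fun (fun r _ => ?_) measurableSet_Ioi
        simp only [Complex.ofReal_mul]
      refine h1.re.congr (Eventually.of_forall fun r => ?_)
      exact Complex.ofReal_re _
  exact ⟨fun h => ⟨aestronglyMeasurable_radial_iff.1 h.1, (key h.1).1 h⟩,
    fun h => (key (aestronglyMeasurable_radial_iff.2 h.1)).2 h.2⟩

lemma integrableOn_sq_norm (f : RadialL2) : IntegrableOn (fun r => r * ‖f r‖ ^ 2) (Ioi 0) :=
  (memLp_radial_iff.1 (Lp.memLp f)).2

/-- As `1 / r` is not integrable at `0`, integrability of `q / r` forces small values of `q` near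
`0`. -/
lemma exists_le_near_zero {q : ℝ → ℝ} (hq : IntegrableOn (fun r => q r / r) (Ioi 0)) {ε δ : ℝ}
    (hε : 0 < ε) (hδ : 0 < δ) : ∃ a ∈ Ioo 0 ε, q a ≤ δ := by
  by_contra! h
  have h1 : IntegrableOn (fun r : ℝ => r⁻¹) (Ioo 0 ε) := by
    refine Integrable.mono' ((hq.mono_set Ioo_subset_Ioi_self).const_mul δ⁻¹)
      measurable_inv.aestronglyMeasurable ?_
    filter_upwards [ae_restrict_mem measurableSet_Ioo] with r hr
    have hr0 := hr.1
    have hq := (h r hr).le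
    rw [Real.norm_eq_abs, abs_of_pos (by positivity), inv_eq_one_div r, inv_mul_eq_div,
      div_div, div_le_div_iff₀ hr0 (by positivity)]
    nlinarith
  have h2 : IntervalIntegrable (fun r : ℝ => r⁻¹) volume 0 ε := by
    rw [intervalIntegrable_iff_integrableOn_Ioc_of_le hε.le, integrableOn_Ioc_iff_integrableOn_Ioo]
    exact h1
  rw [intervalIntegrable_inv_iff] at h2
  rcases h2 with h2 | h2
  · exact hε.ne h2
  · exact h2 left_mem_uIcc

lemma exists_le_near_infty {q : ℝ → ℝ} (hq : IntegrableOn (fun r => q r / r) (Ioi 0)) {M δ : ℝ}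
    (hM : 0 < M) (hδ : 0 < δ) : ∃ b, M < b ∧ q b ≤ δ := by
  by_contra! h
  refine not_integrableOn_Ioi_inv (a := M) ?_
  refine Integrable.mono' ((hq.mono_set (Ioi_subset_Ioi hM.le)).const_mul δ⁻¹)
    measurable_inv.aestronglyMeasurable ?_
  filter_upwards [ae_restrict_mem measurableSet_Ioi] with r hr
  have hr0 : 0 < r := hM.trans hr
  have hq := (h r hr).le
  rw [Real.norm_eq_abs, abs_of_pos (by positivity), inv_eq_one_div r, inv_mul_eq_div,
    div_div, div_le_div_iff₀ hr0 (by positivity)]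
  nlinarith

/-! ### Energy estimates for `∂_μ` -/

lemma IsPrimitive.sub_le {P p q : ℝ → ℝ} (hP : IsPrimitive P p) (hq : IntegrableOn q (Ioi 0))
    (hq0 : ∀ r, 0 < r → 0 ≤ q r) {a b : ℝ} (ha : 0 < a) (hab : a ≤ b)
    (hpq : ∀ r ∈ Icc a b, p r ≤ q r) : P b - P a ≤ ∫ r in Ioi 0, q r := by
  have hs : Ioc a b ⊆ Ioi 0 := fun r hr => ha.trans hr.1
  rw [← (hP ha hab).2]
  refine (intervalIntegral.integral_mono_on hab (hP ha hab).1 ?_ hpq).trans ?_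
  · rw [intervalIntegrable_iff_integrableOn_Ioc_of_le hab]
    exact hq.mono_set hs
  · rw [intervalIntegral.integral_of_le hab]
    refine setIntegral_mono_set hq ?_ hs.eventuallyLE
    filter_upwards [ae_restrict_mem measurableSet_Ioi] with r hr using hq0 r hr

section Energy

variable {μ : ℝ} {F g : ℝ → ℂ}

lemma isPrimitive_sq_norm (hF : IsPrimitive F fun r => g r - ((μ / r : ℝ) : ℂ) * F r) :
    IsPrimitive (fun r => ‖F r‖ ^ 2) fun r =>
      -(2 * μ / r) * ‖F r‖ ^ 2 + 2 * ((starRingEnd ℂ) (F r) * g r).re := by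
  have h := (hF.conj.mul hF).clm_comp Complex.reCLM
  convert h using 1
  · funext r
    rw [← Complex.normSq_eq_norm_sq, Complex.normSq_apply]
    simp
  · funext r
    rw [← Complex.normSq_eq_norm_sq, Complex.normSq_apply]
    simp
    ring

lemma isPrimitive_mul_sq_norm (hF : IsPrimitive F fun r => g r - ((μ / r : ℝ) : ℂ) * F r) :
    IsPrimitive (fun r => r ^ 2 * ‖F r‖ ^ 2) fun r => 2 * r * ‖F r‖ ^ 2 + r ^ 2 *
      (-(2 * μ / r) * ‖F r‖ ^ 2 + 2 * ((starRingEnd ℂ) (F r) * g r).re) := by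
  refine IsPrimitive.mul_real ?_ (isPrimitive_sq_norm hF)
  refine isPrimitive_of_hasDerivAt (fun r _ => ?_) (by fun_prop)
  simpa using hasDerivAt_pow 2 r

lemma abs_re_conj_mul_le (z w : ℂ) : |((starRingEnd ℂ) z * w).re| ≤ ‖z‖ * ‖w‖ := by
  refine (Complex.abs_re_le_norm _).trans ?_
  rw [norm_mul, RCLike.norm_conj]

/-- Young's inequality with the weights of the energy identities. -/
lemma two_mul_le_weighted {r c : ℝ} (hr : 0 < r) (hc : 0 < c) (x y : ℝ) :
    2 * (x * y) ≤ c / r * x ^ 2 + r * y ^ 2 / c := by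
  have h : c / r * x ^ 2 + r * y ^ 2 / c - 2 * (x * y) = (c * x - r * y) ^ 2 / (r * c) := by
    field_simp; ring
  have : 0 ≤ (c * x - r * y) ^ 2 / (r * c) := by positivity
  linarith

variable (hF : IsPrimitive F fun r => g r - ((μ / r : ℝ) : ℂ) * F r)
  (hF2 : IntegrableOn (fun r => r * ‖F r‖ ^ 2) (Ioi 0))
  (hg2 : IntegrableOn (fun r => r * ‖g r‖ ^ 2) (Ioi 0))

include hF hF2 hg2

/-- For `μ > 1` the increase of the energy `r² |F|²` is controlled by the integral of `r³ |g|²`, and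
the energy is small along a sequence tending to `0`. -/
lemma exists_bound_of_one_lt (hμ : 1 < μ) : ∃ C, ∀ r, 0 < r → ‖F r‖ ^ 2 ≤ C := by
  have hc : 0 < 2 * μ - 2 := by linarith
  refine ⟨1 + (∫ r in Ioi 0, r * ‖g r‖ ^ 2) / (2 * μ - 2), fun b hb => ?_⟩
  have hq : IntegrableOn (fun r => r ^ 2 * ‖F r‖ ^ 2 / r) (Ioi 0) := by
    refine hF2.congr_fun (fun r hr => ?_) measurableSet_Ioi
    have : r ≠ 0 := ne_of_gt hr
    field_simp
  obtain ⟨a, ⟨ha, hab⟩, hFa⟩ := exists_le_near_zero hq hb (δ := b ^ 2) (by positivity)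
  have h := (isPrimitive_mul_sq_norm hF).sub_le (q := fun r => b ^ 2 / (2 * μ - 2) *
    (r * ‖g r‖ ^ 2)) (hg2.const_mul _) (fun r hr => by positivity) ha hab.le fun r hr => by
      have hr0 : 0 < r := ha.trans_le hr.1
      have h1 := abs_le.1 (abs_re_conj_mul_le (F r) (g r))
      have h2 := two_mul_le_weighted hr0 hc ‖F r‖ ‖g r‖
      have h3 : r ^ 2 * (2 * ((starRingEnd ℂ) (F r) * g r).re) ≤
          r ^ 2 * ((2 * μ - 2) / r * ‖F r‖ ^ 2 + r * ‖g r‖ ^ 2 / (2 * μ - 2)) :=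
        mul_le_mul_of_nonneg_left (by linarith) (by positivity)
      have h4 : r ^ 2 * (r * ‖g r‖ ^ 2 / (2 * μ - 2)) ≤ b ^ 2 * (r * ‖g r‖ ^ 2 / (2 * μ - 2)) := by
        have : r ^ 2 ≤ b ^ 2 := pow_le_pow_left₀ hr0.le hr.2 2
        exact mul_le_mul_of_nonneg_right this (by positivity)
      have h5 : r ^ 2 * ((2 * μ - 2) / r * ‖F r‖ ^ 2) = (2 * μ - 2) * r * ‖F r‖ ^ 2 := by
        field_simp
      have h6 : r ^ 2 * (-(2 * μ / r) * ‖F r‖ ^ 2) = -(2 * μ * r * ‖F r‖ ^ 2) := by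
        field_simp
      have h7 : b ^ 2 / (2 * μ - 2) * (r * ‖g r‖ ^ 2) = b ^ 2 * (r * ‖g r‖ ^ 2 / (2 * μ - 2)) := by
        ring
      nlinarith
  rw [integral_const_mul] at h
  have h8 : b ^ 2 * ‖F b‖ ^ 2 ≤ b ^ 2 * (1 + (∫ r in Ioi 0, r * ‖g r‖ ^ 2) / (2 * μ - 2)) := by
    have : b ^ 2 / (2 * μ - 2) * (∫ r in Ioi 0, r * ‖g r‖ ^ 2) =
      b ^ 2 * ((∫ r in Ioi 0, r * ‖g r‖ ^ 2) / (2 * μ - 2)) := by ring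
    linarith
  exact le_of_mul_le_mul_left h8 (by positivity)

/-- For `μ < 0` the decrease of the energy `|F|²` is controlled by the integral of `r |g|²`, and the
energy is bounded along a sequence tending to infinity. -/
lemma exists_bound_of_neg (hμ : μ < 0) : ∃ C, ∀ r, 0 < r → ‖F r‖ ^ 2 ≤ C := by
  have hc : 0 < -(2 * μ) := by linarith
  refine ⟨1 + (∫ r in Ioi 0, r * ‖g r‖ ^ 2) / -(2 * μ), fun a ha => ?_⟩
  have hq : IntegrableOn (fun r => r ^ 2 * ‖F r‖ ^ 2 / r) (Ioi 0) := by
    refine hF2.congr_fun (fun r hr => ?_) measurableSet_Ioi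
    have : r ≠ 0 := ne_of_gt hr
    field_simp
  obtain ⟨b, hb, hFb⟩ := exists_le_near_infty hq (M := max a 1) (lt_max_of_lt_left ha) one_pos
  have hab : a < b := (le_max_left _ _).trans_lt hb
  have hb1 : 1 < b := (le_max_right _ _).trans_lt hb
  have h := ((isPrimitive_sq_norm hF).clm_comp (-ContinuousLinearMap.id ℝ ℝ)).sub_le
    (q := fun r => (-(2 * μ))⁻¹ * (r * ‖g r‖ ^ 2)) (hg2.const_mul _) (fun r hr => by positivity)
    ha hab.le fun r hr => by
      have hr0 : 0 < r := ha.trans_le hr.1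
      have h1 := abs_le.1 (abs_re_conj_mul_le (F r) (g r))
      have h2 := two_mul_le_weighted hr0 hc ‖F r‖ ‖g r‖
      have h3 : r * ‖g r‖ ^ 2 / -(2 * μ) = (-(2 * μ))⁻¹ * (r * ‖g r‖ ^ 2) := by ring
      have h4 : -(2 * μ) / r * ‖F r‖ ^ 2 = -(2 * μ / r) * ‖F r‖ ^ 2 := by ring
      simp only [neg_apply, ContinuousLinearMap.id_apply]
      linarith
  rw [integral_const_mul] at h
  simp only [neg_apply, ContinuousLinearMap.id_apply] at h
  have h5 : ‖F b‖ ^ 2 ≤ 1 := by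
    have : 1 ≤ b ^ 2 := by nlinarith
    nlinarith [sq_nonneg ‖F b‖]
  rw [div_eq_inv_mul]
  linarith

omit hF2 in
/-- Hardy's inequality in the form of an energy estimate: a bounded `F` with `∂_μ F ∈ L²(r dr)`,
`μ ≠ 0`, satisfies `F / r ∈ L²(r dr)`. -/
lemma integrableOn_div_of_bound (hμ : μ ≠ 0) {C : ℝ} (hC : ∀ r, 0 < r → ‖F r‖ ^ 2 ≤ C) :
    IntegrableOn (fun r => ‖F r‖ ^ 2 / r) (Ioi 0) := by
  have hc : 0 < |μ| := abs_pos.2 hμ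
  have hcont : ContinuousOn (fun r => ‖F r‖ ^ 2 / r) (Ioi 0) :=
    (hF.continuousOn.norm.pow 2).div continuousOn_id fun r hr => ne_of_gt hr
  -- the sign `s` of `μ` makes the quadratic term of the energy identity positive
  obtain ⟨s, hs, hsμ⟩ : ∃ s : ℝ, |s| = 1 ∧ s * μ = |μ| := by
    rcases lt_or_gt_of_ne hμ with h | h
    · exact ⟨-1, by simp, by rw [abs_of_neg h]; ring⟩
    · exact ⟨1, by simp, by rw [abs_of_pos h]; ring⟩
  have hbd : ∀ a b : ℝ, 0 < a → a ≤ b → ∫ r in a..b, ‖F r‖ ^ 2 / r ≤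
      (C + |μ|⁻¹ * ∫ r in Ioi 0, r * ‖g r‖ ^ 2) / |μ| := by
    intro a b ha hab
    have hsub : Icc a b ⊆ Ioi 0 := fun r hr => ha.trans_le hr.1
    have h1 := (isPrimitive_sq_norm hF).clm_comp (s • ContinuousLinearMap.id ℝ ℝ)
    have h2 : IsPrimitive (fun r => |μ| * ∫ t in (1 : ℝ)..r, ‖F t‖ ^ 2 / t)
        fun r => |μ| * (‖F r‖ ^ 2 / r) := by
      intro a b ha hab
      have hi : ∀ x y : ℝ, 0 < x → 0 < y → IntervalIntegrable (fun r => ‖F r‖ ^ 2 / r) volume x y :=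
        fun x y hx hy => (hcont.mono fun r hr => (lt_min hx hy).trans_le hr.1).intervalIntegrable
      have hb := ha.trans_le hab
      refine ⟨(hi a b ha hb).const_mul _, ?_⟩
      rw [intervalIntegral.integral_const_mul, ← mul_sub,
        intervalIntegral.integral_interval_sub_left (hi 1 b one_pos hb) (hi 1 a one_pos ha)]
    have h := (h1.add h2).sub_le (q := fun r => |μ|⁻¹ * (r * ‖g r‖ ^ 2)) (hg2.const_mul _)
      (fun r hr => by positivity) ha hab fun r hr => by
        have hr0 : 0 < r := ha.trans_le hr.1
        have h3 : |s * ((starRingEnd ℂ) (F r) * g r).re| ≤ ‖F r‖ * ‖g r‖ := by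
          rw [abs_mul, hs, one_mul]; exact abs_re_conj_mul_le (F r) (g r)
        have h3 := abs_le.1 h3
        have h4 := two_mul_le_weighted hr0 hc ‖F r‖ ‖g r‖
        have h5 : s * (-(2 * μ / r) * ‖F r‖ ^ 2) = -2 * (|μ| / r * ‖F r‖ ^ 2) := by
          rw [← hsμ]; ring
        have h6 : |μ| * (‖F r‖ ^ 2 / r) = |μ| / r * ‖F r‖ ^ 2 := by ring
        have h7 : r * ‖g r‖ ^ 2 / |μ| = |μ|⁻¹ * (r * ‖g r‖ ^ 2) := by ring
        simp only [smul_apply, ContinuousLinearMap.id_apply, smul_eq_mul,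
          mul_add]
        linarith
    rw [integral_const_mul] at h
    simp only [smul_apply, ContinuousLinearMap.id_apply, smul_eq_mul] at h
    have h8 := (h2 ha hab).2
    rw [intervalIntegral.integral_const_mul] at h8
    have h9 : s * ‖F a‖ ^ 2 - s * ‖F b‖ ^ 2 ≤ C := by
      have := hC a ha
      have := hC b (ha.trans_le hab)
      have := sq_nonneg ‖F a‖
      have := sq_nonneg ‖F b‖
      rcases abs_eq (zero_le_one) |>.1 hs with h | h <;> rw [h] <;> linarith
    rw [le_div_iff₀ hc]
    linarith
  have ha : Tendsto (fun n : ℕ => 1 / ((n : ℝ) + 1)) atTop (𝓝 0) :=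
    tendsto_one_div_add_atTop_nhds_zero_nat
  have hb : Tendsto (fun n : ℕ => (n : ℝ) + 1) atTop atTop :=
    tendsto_atTop_add_const_right _ _ tendsto_natCast_atTop_atTop
  have hle : ∀ n : ℕ, 1 / ((n : ℝ) + 1) ≤ (n : ℝ) + 1 := fun n => by
    rw [div_le_iff₀ (by positivity)]
    nlinarith [(Nat.cast_nonneg n : (0 : ℝ) ≤ n)]
  have cov : AECover (volume.restrict (Ioi (0 : ℝ))) atTop
      fun n : ℕ => Ioi (1 / ((n : ℝ) + 1)) ∩ Iic ((n : ℝ) + 1) :=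
    (aecover_Ioi_of_Ioi ha).inter (aecover_Iic hb).restrict
  have hsub : ∀ n : ℕ, Ioc (1 / ((n : ℝ) + 1)) ((n : ℝ) + 1) ⊆ Ioi 0 := fun n r hr =>
    lt_trans (by positivity) hr.1
  refine cov.integrable_of_integral_norm_bounded
    ((C + |μ|⁻¹ * ∫ r in Ioi 0, r * ‖g r‖ ^ 2) / |μ|) (fun n => ?_) (Eventually.of_forall fun n => ?_)
  · refine IntegrableOn.mono_measure ?_ Measure.restrict_le_self
    have : IntegrableOn (fun r => ‖F r‖ ^ 2 / r) (Icc (1 / ((n : ℝ) + 1)) ((n : ℝ) + 1)) :=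
      (hcont.mono fun r hr => lt_of_lt_of_le (by positivity) hr.1).integrableOn_Icc
    exact this.mono_set Ioc_subset_Icc_self
  · rw [Ioi_inter_Iic, Measure.restrict_restrict measurableSet_Ioc,
      inter_eq_left.2 (hsub n)]
    refine le_trans (le_of_eq ?_) (hbd _ _ (by positivity) (hle n))
    rw [intervalIntegral.integral_of_le (hle n)]
    refine setIntegral_congr_fun measurableSet_Ioc fun r hr => ?_
    have : 0 < r := hsub n hr
    exact Real.norm_of_nonneg (by positivity)

end Energy

/-! ### The maximal operator `∂_μ` on `L²(r dr)` -/

/-- The graph of the maximal operator `∂_μ` in `L²(r dr)`: `f' + (μ / r) f = g` in the sense of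
distributions on `(0, ∞)`. -/
def BesselRel (μ : ℝ) (f g : RadialL2) : Prop :=
  HasWeakDeriv f fun r => g r - ((μ / r : ℝ) : ℂ) * f r

lemma locallyIntegrableOn_mul_div (μ : ℝ) {f : ℝ → ℂ} (hf : LocallyIntegrableOn f (Ioi 0)) :
    LocallyIntegrableOn (fun r => ((μ / r : ℝ) : ℂ) * f r) (Ioi 0) := by
  rw [locallyIntegrableOn_iff isOpen_Ioi.isLocallyClosed] at hf ⊢
  intro K hK hKc
  refine (hf K hK hKc).continuousOn_mul (Complex.continuous_ofReal.comp_continuousOn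
    (continuousOn_const.div continuousOn_id fun r hr => ne_of_gt (hK hr))) hKc

lemma BesselRel.exists_isPrimitive {μ : ℝ} {f g : RadialL2} (h : BesselRel μ f g) :
    ∃ F : ℝ → ℂ, IsPrimitive F (fun r => g r - ((μ / r : ℝ) : ℂ) * F r) ∧
      f =ᵐ[radialMeasure] F := by
  obtain ⟨F, hF, hfF⟩ := HasWeakDeriv.exists_isPrimitive (locallyIntegrableOn f)
    ((locallyIntegrableOn g).sub (locallyIntegrableOn_mul_div μ (locallyIntegrableOn f))) h
  refine ⟨F, hF.congr_deriv (hfF.mono fun r hr => ?_), ae_radial_iff.2 hfF⟩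
  simp only [Pi.sub_apply, hr]

lemma IsPrimitive.besselRel {μ : ℝ} {f g : RadialL2} {F G : ℝ → ℂ}
    (h : IsPrimitive F (fun r => G r - ((μ / r : ℝ) : ℂ) * F r)) (hf : f =ᵐ[radialMeasure] F)
    (hg : g =ᵐ[radialMeasure] G) : BesselRel μ f g := by
  refine h.hasWeakDeriv.congr hf ?_
  filter_upwards [hf, hg] with r h1 h2
  rw [h1, h2]

lemma BesselRel.smul {μ : ℝ} {f g : RadialL2} (c : ℂ) (h : BesselRel μ f g) :
    BesselRel μ (c • f) (c • g) := by
  obtain ⟨F, hF, hfF⟩ := h.exists_isPrimitive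
  refine IsPrimitive.besselRel (F := fun r => c * F r) (G := fun r => c * g r) ?_
    ((Lp.coeFn_smul c f).trans (hfF.const_smul c)) (Lp.coeFn_smul c g)
  convert hF.clm_comp (ContinuousLinearMap.mul ℝ ℂ c) using 1
  · funext r
    rfl
  · funext r
    change c * g r - ((μ / r : ℝ) : ℂ) * (c * F r) = c * (g r - ((μ / r : ℝ) : ℂ) * F r)
    ring

lemma integrableOn_sq_norm_congr {f : RadialL2} {F : ℝ → ℂ} (h : f =ᵐ[radialMeasure] F) :
    IntegrableOn (fun r => r * ‖F r‖ ^ 2) (Ioi 0) :=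
  (integrableOn_sq_norm f).congr ((ae_radial_iff.1 h).mono fun r hr => by simp only [hr])

lemma memLp_div_iff {f : RadialL2} {F : ℝ → ℂ} (h : f =ᵐ[radialMeasure] F) :
    MemLp (fun r : ℝ => f r / (r : ℂ)) 2 radialMeasure ↔
      IntegrableOn (fun r => ‖F r‖ ^ 2 / r) (Ioi 0) := by
  have hm : AEStronglyMeasurable (fun r : ℝ => f r / (r : ℂ)) (volume.restrict (Ioi (0 : ℝ))) :=
    (aestronglyMeasurable_radial_iff.1 (Lp.aestronglyMeasurable f)).div₀
      Complex.continuous_ofReal.aestronglyMeasurable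
  rw [memLp_radial_iff, and_iff_right hm]
  refine integrable_congr ?_
  filter_upwards [ae_radial_iff.1 h, ae_restrict_mem measurableSet_Ioi] with r hr hr0
  have hr0 : 0 < r := hr0
  rw [hr, norm_div, Complex.norm_real, Real.norm_of_nonneg hr0.le]
  field_simp

lemma BesselRel.memLp_div_of_bound {μ : ℝ} (hμ : μ ≠ 0) {f g : RadialL2} {F : ℝ → ℂ}
    (hF : IsPrimitive F (fun r => g r - ((μ / r : ℝ) : ℂ) * F r)) (hfF : f =ᵐ[radialMeasure] F)
    {C : ℝ} (hC : ∀ r, 0 < r → ‖F r‖ ^ 2 ≤ C) :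
    MemLp (fun r : ℝ => f r / (r : ℂ)) 2 radialMeasure :=
  (memLp_div_iff hfF).2 (integrableOn_div_of_bound hF (integrableOn_sq_norm g) hμ hC)

/-- Off the critical strip `0 ≤ μ ≤ 1` the maximal domain of `∂_μ` carries the Hardy bound. -/
lemma BesselRel.memLp_div {μ : ℝ} (hμ : 1 < μ ∨ μ < 0) {f g : RadialL2} (h : BesselRel μ f g) :
    MemLp (fun r : ℝ => f r / (r : ℂ)) 2 radialMeasure := by
  obtain ⟨F, hF, hfF⟩ := h.exists_isPrimitive
  have hF2 := integrableOn_sq_norm_congr hfF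
  rcases hμ with hμ | hμ
  · obtain ⟨C, hC⟩ := exists_bound_of_one_lt hF hF2 (integrableOn_sq_norm g) hμ
    exact memLp_div_of_bound (by linarith) hF hfF hC
  · obtain ⟨C, hC⟩ := exists_bound_of_neg hF hF2 (integrableOn_sq_norm g) hμ
    exact memLp_div_of_bound hμ.ne hF hfF hC

/-- A function with `F', F / r ∈ L²(r dr)` tends to zero at the origin. -/
lemma tendsto_zero_of_integrableOn_div {F h : ℝ → ℂ} (hF : IsPrimitive F h)
    (hh : IntegrableOn (fun r => r * ‖h r‖ ^ 2) (Ioi 0))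
    (hd : IntegrableOn (fun r => ‖F r‖ ^ 2 / r) (Ioi 0)) :
    Tendsto F (𝓝[>] 0) (𝓝 0) := by
  have hq : IntegrableOn (fun r => ‖F r‖ ^ 2 / r + r * ‖h r‖ ^ 2) (Ioi 0) := hd.add hh
  have hP := isPrimitive_sq_norm (μ := 0) (F := F) (g := h) (by simpa using hF)
  have hle : ∀ b, 0 < b → ‖F b‖ ^ 2 ≤ ∫ r in (0 : ℝ)..b, (‖F r‖ ^ 2 / r + r * ‖h r‖ ^ 2) := by
    intro b hb
    refine le_of_forall_pos_le_add fun δ hδ => ?_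
    obtain ⟨a, ⟨ha, hab⟩, hFa⟩ := exists_le_near_zero hd hb hδ
    have := hP.sub_le (q := (Iic b).indicator fun r => ‖F r‖ ^ 2 / r + r * ‖h r‖ ^ 2)
      (hq.indicator measurableSet_Iic) (fun r hr => ?_)
      ha hab.le fun r hr => ?_
    · rw [integral_indicator measurableSet_Iic, Measure.restrict_restrict measurableSet_Iic,
        inter_comm, Ioi_inter_Iic, ← intervalIntegral.integral_of_le hb.le] at this
      linarith
    · rw [indicator_apply]
      split_ifs <;> positivity
    · have hr0 : 0 < r := ha.trans_le hr.1
      rw [indicator_of_mem (show r ∈ Iic b from hr.2)]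
      have h1 := abs_le.1 (abs_re_conj_mul_le (F r) (h r))
      have h2 := two_mul_le_weighted hr0 one_pos ‖F r‖ ‖h r‖
      have h3 : (1 : ℝ) / r * ‖F r‖ ^ 2 = ‖F r‖ ^ 2 / r := by ring
      simp only [mul_zero, zero_div, neg_zero, zero_mul, zero_add]
      linarith
  have hlim : Tendsto (fun b => ∫ r in (0 : ℝ)..b, (‖F r‖ ^ 2 / r + r * ‖h r‖ ^ 2)) (𝓝[>] 0)
      (𝓝 0) := by
    have hi : IntervalIntegrable (fun r => ‖F r‖ ^ 2 / r + r * ‖h r‖ ^ 2) volume 0 1 := by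
      rw [intervalIntegrable_iff_integrableOn_Ioc_of_le zero_le_one]
      exact hq.mono_set fun r hr => hr.1
    have hc := intervalIntegral.continuousOn_primitive_interval' hi left_mem_uIcc
    have h0 := (hc 0 left_mem_uIcc).tendsto
    rw [intervalIntegral.integral_same, uIcc_of_le zero_le_one] at h0
    refine h0.mono_left (nhdsWithin_le_iff.2 ?_)
    exact mem_of_superset (Ioo_mem_nhdsGT zero_lt_one) Ioo_subset_Icc_self
  have h2 : Tendsto (fun b => ‖F b‖ ^ 2) (𝓝[>] 0) (𝓝 0) :=
    squeeze_zero' (Eventually.of_forall fun b => by positivity)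
      (eventually_nhdsWithin_of_forall hle) hlim
  have h3 := h2.sqrt
  simp only [Real.sqrt_zero, Real.sqrt_sq (norm_nonneg _)] at h3
  exact tendsto_zero_iff_norm_tendsto_zero.2 h3

lemma continuousOn_indicator_Ioi {F : ℝ → ℂ} (hF : ContinuousOn F (Ioi 0))
    (h0 : Tendsto F (𝓝[>] 0) (𝓝 0)) : ContinuousOn ((Ioi 0).indicator F) (Ici 0) := by
  intro r hr
  rcases (mem_Ici.1 hr).eq_or_lt with rfl | hr
  · rw [ContinuousWithinAt, indicator_of_notMem (by simp), ← Ioi_insert, nhdsWithin_insert,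
      tendsto_sup]
    refine ⟨?_, h0.congr' (eventually_nhdsWithin_of_forall fun r hr => ?_)⟩
    · rw [tendsto_pure_left]
      intro s hs
      rw [indicator_of_notMem (by simp)]
      exact mem_of_mem_nhds hs
    · rw [indicator_of_mem hr]
  · refine ContinuousAt.continuousWithinAt ?_
    refine (hF.continuousAt (Ioi_mem_nhds hr)).congr ?_
    filter_upwards [Ioi_mem_nhds hr] with x hx
    rw [indicator_of_mem hx]

lemma mem_regularSpace_of_memLp_div {f h : RadialL2} (hw : HasWeakDeriv f h)
    (hd : MemLp (fun r : ℝ => f r / (r : ℂ)) 2 radialMeasure) : f ∈ regularSpace := by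
  obtain ⟨F, hF, hfF⟩ := HasWeakDeriv.exists_isPrimitive (locallyIntegrableOn f)
    (locallyIntegrableOn h) hw
  refine ⟨⟨h, hw⟩, hd, (Ioi 0).indicator F, ?_, indicator_of_notMem (by simp) _, ?_⟩
  · exact continuousOn_indicator_Ioi hF.continuousOn (tendsto_zero_of_integrableOn_div hF
      (integrableOn_sq_norm h) ((memLp_div_iff (ae_radial_iff.2 hfF)).1 hd))
  · refine ae_radial_iff.2 ?_
    filter_upwards [hfF, ae_restrict_mem measurableSet_Ioi] with r hr hr0
    rw [indicator_of_mem hr0, hr]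

lemma besselRel_bessel (μ : ℝ) (φ : regularSpace) : BesselRel μ φ (bessel μ φ) := by
  refine HasWeakDeriv.congr φ.2.1.choose_spec EventuallyEq.rfl ?_
  have e : bessel μ φ = radialDeriv φ + (μ : ℂ) • divRadius φ := rfl
  have e1 : (divRadius φ : ℝ → ℂ) =ᵐ[radialMeasure] _ := φ.2.2.1.coeFn_toLp
  filter_upwards [Lp.coeFn_add (radialDeriv φ) ((μ : ℂ) • divRadius φ),
    Lp.coeFn_smul (μ : ℂ) (divRadius φ), e1] with r h1 h2 h3
  rw [e, h1, Pi.add_apply, h2, Pi.smul_apply, h3, smul_eq_mul]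
  change _ = radialDeriv φ r
  push_cast
  ring

lemma BesselRel.exists_regular {μ : ℝ} {f g : RadialL2} (h : BesselRel μ f g)
    (hd : MemLp (fun r : ℝ => f r / (r : ℂ)) 2 radialMeasure) :
    ∃ φ : regularSpace, (φ : RadialL2) = f ∧ bessel μ φ = g := by
  have hw : HasWeakDeriv f (g - (μ : ℂ) • hd.toLp _ : RadialL2) := by
    refine HasWeakDeriv.congr h EventuallyEq.rfl ?_
    filter_upwards [Lp.coeFn_sub g ((μ : ℂ) • hd.toLp _), Lp.coeFn_smul (μ : ℂ) (hd.toLp _),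
      hd.coeFn_toLp] with r h1 h2 h3
    rw [h1, Pi.sub_apply, h2, Pi.smul_apply, h3, smul_eq_mul]
    push_cast
    ring
  let φ : regularSpace := ⟨f, mem_regularSpace_of_memLp_div hw hd⟩
  refine ⟨φ, rfl, ?_⟩
  have e : radialDeriv φ = g - (μ : ℂ) • hd.toLp _ := φ.2.1.choose_spec.unique hw
  have e2 : bessel μ φ = radialDeriv φ + (μ : ℂ) • hd.toLp _ := rfl
  rw [e2, e, sub_add_cancel]

/-- The regular representative of a regular function tends to zero at the origin. -/
lemma tendsto_zero_of_regular {μ : ℝ} {f g : RadialL2} {F : ℝ → ℂ}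
    (hF : IsPrimitive F (fun r => g r - ((μ / r : ℝ) : ℂ) * F r)) (hfF : f =ᵐ[radialMeasure] F)
    (hd : MemLp (fun r : ℝ => f r / (r : ℂ)) 2 radialMeasure) :
    Tendsto F (𝓝[>] 0) (𝓝 0) := by
  have h2 : MemLp (fun r => g r - (μ : ℂ) * (f r / r)) 2 radialMeasure :=
    (Lp.memLp g).sub (hd.const_mul (μ : ℂ))
  refine tendsto_zero_of_integrableOn_div hF ?_ ((memLp_div_iff hfF).1 hd)
  refine (memLp_radial_iff.1 h2).2.congr ((ae_radial_iff.1 hfF).mono fun r hr => ?_)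
  simp only [hr]
  congr 3
  push_cast
  ring

/-! ### The boundary pairing of `∂_μ` and `∂_{1-μ}` -/

lemma inner_radial (f g : RadialL2) {F G : ℝ → ℂ} (hf : f =ᵐ[radialMeasure] F)
    (hg : g =ᵐ[radialMeasure] G) :
    IntegrableOn (fun r : ℝ => (r : ℂ) * ((starRingEnd ℂ) (F r) * G r)) (Ioi 0) ∧
      inner ℂ f g = ∫ r in Ioi (0 : ℝ), (r : ℂ) * ((starRingEnd ℂ) (F r) * G r) := by
  have e : (fun r => inner ℂ (f r) (g r)) =ᵐ[radialMeasure]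
      fun r => (starRingEnd ℂ) (F r) * G r := by
    filter_upwards [hf, hg] with r h1 h2
    rw [h1, h2, RCLike.inner_apply, mul_comm]
  constructor
  · exact integrable_radialMeasure_iff.1 ((L2.integrable_inner f g).congr e)
  · rw [L2.inner_def, integral_congr_ae e, integral_radialMeasure]

lemma IsPrimitive.integral_eq_zero {P p : ℝ → ℂ} (hP : IsPrimitive P p)
    (hp : IntegrableOn p (Ioi 0)) (hPi : IntegrableOn P (Ioi 0))
    (h0 : Tendsto P (𝓝[>] 0) (𝓝 0)) : ∫ r in Ioi 0, p r = 0 := by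
  have hinf : Tendsto P atTop (𝓝 (P 1 + ∫ r in Ioi 1, p r)) := by
    have h1 := intervalIntegral_tendsto_integral_Ioi (1 : ℝ)
      (hp.mono_set (Ioi_subset_Ioi zero_le_one)) tendsto_id
    refine (h1.const_add (P 1)).congr' ?_
    filter_upwards [eventually_ge_atTop 1] with b hb
    simp only [id, (hP one_pos hb).2, add_sub_cancel]
  have hinf0 : P 1 + ∫ r in Ioi 1, p r = 0 := by
    refine IntegrableAtFilter.eq_zero_of_tendsto (l := atTop) (f := P)
      ⟨Ioi 0, Ioi_mem_atTop _, hPi⟩ (fun s hs => ?_) hinf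
    rcases mem_atTop_sets.1 hs with ⟨b, hb⟩
    rw [← top_le_iff, ← Real.volume_Ici (a := b)]
    exact measure_mono hb
  have hzero : ∫ r in (0 : ℝ)..1, p r = P 1 := by
    have hi : IntervalIntegrable p volume 0 1 := by
      rw [intervalIntegrable_iff_integrableOn_Ioc_of_le zero_le_one]
      exact hp.mono_set fun r hr => hr.1
    have hc := intervalIntegral.continuousOn_primitive_interval_left
      (f := p) (μ := volume) (a := 0) (b := 1)
      ((intervalIntegrable_iff').1 hi)
    have h1 := (hc 0 left_mem_uIcc).tendsto
    rw [uIcc_of_le zero_le_one] at h1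
    have h2 : Tendsto (fun a => ∫ r in a..1, p r) (𝓝[>] 0) (𝓝 (∫ r in (0 : ℝ)..1, p r)) :=
      h1.mono_left (nhdsWithin_le_iff.2
        (mem_of_superset (Ioo_mem_nhdsGT zero_lt_one) Ioo_subset_Icc_self))
    have h3 : Tendsto (fun a => ∫ r in a..1, p r) (𝓝[>] 0) (𝓝 (P 1 - 0)) := by
      refine (h0.const_sub (P 1)).congr' ?_
      filter_upwards [Ioo_mem_nhdsGT zero_lt_one] with a ha
      exact ((hP ha.1 ha.2.le).2).symm
    simpa using tendsto_nhds_unique h2 h3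
  rw [← Ioc_union_Ioi_eq_Ioi zero_le_one, setIntegral_union (Ioc_disjoint_Ioi le_rfl)
    measurableSet_Ioi (hp.mono_set fun r hr => hr.1) (hp.mono_set (Ioi_subset_Ioi zero_le_one)),
    ← intervalIntegral.integral_of_le zero_le_one, hzero, hinf0]

/-- Integration by parts for `∂_μ` and `∂_{1-μ}` when the boundary term at the origin vanishes. -/
lemma inner_add_inner_eq_zero {μ ν : ℝ} (hμν : μ + ν = 1) {f g f' g' : RadialL2} {F F' : ℝ → ℂ}
    (hF : IsPrimitive F (fun r => g r - ((μ / r : ℝ) : ℂ) * F r)) (hfF : f =ᵐ[radialMeasure] F)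
    (hF' : IsPrimitive F' (fun r => g' r - ((ν / r : ℝ) : ℂ) * F' r))
    (hfF' : f' =ᵐ[radialMeasure] F')
    (h0 : Tendsto (fun r : ℝ => (r : ℂ) * ((starRingEnd ℂ) (F r) * F' r)) (𝓝[>] 0) (𝓝 0)) :
    inner ℂ f g' + inner ℂ g f' = 0 := by
  have hr : IsPrimitive (fun r : ℝ => (r : ℂ)) fun _ => 1 :=
    isPrimitive_of_hasDerivAt (fun r _ => (hasDerivAt_id r).ofReal_comp) continuousOn_const
  have hP := hr.mul (hF.conj.mul hF')
  obtain ⟨i1, e1⟩ := inner_radial f g' hfF EventuallyEq.rfl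
  obtain ⟨i2, e2⟩ := inner_radial g f' EventuallyEq.rfl hfF'
  obtain ⟨i3, -⟩ := inner_radial f f' hfF hfF'
  have i4 := i1.add i2
  have hP' : IsPrimitive (fun r : ℝ => (r : ℂ) * ((starRingEnd ℂ) (F r) * F' r)) fun r =>
      (r : ℂ) * ((starRingEnd ℂ) (F r) * g' r) + (r : ℂ) * ((starRingEnd ℂ) (g r) * F' r) := by
    refine hP.congr_deriv ((ae_restrict_iff' measurableSet_Ioi).2 (Eventually.of_forall
      fun r hr => ?_))
    have hr0 : (r : ℂ) ≠ 0 := by exact_mod_cast ne_of_gt hr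
    have hμν' : (μ : ℂ) + ν = 1 := by exact_mod_cast hμν
    simp only [map_sub, map_mul, Complex.conj_ofReal]
    push_cast
    field_simp
    linear_combination (-(starRingEnd ℂ) (F r) * F' r) * hμν'
  rw [e1, e2, ← integral_add i1 i2]
  exact hP'.integral_eq_zero i4 i3 h0

lemma inner_add_inner_of_regular {μ ν : ℝ} (hμν : μ + ν = 1) {f g f' g' : RadialL2}
    (h : BesselRel μ f g) (hd : MemLp (fun r : ℝ => f r / (r : ℂ)) 2 radialMeasure)
    (h' : BesselRel ν f' g') (hd' : MemLp (fun r : ℝ => f' r / (r : ℂ)) 2 radialMeasure) :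
    inner ℂ f g' + inner ℂ g f' = 0 := by
  obtain ⟨F, hF, hfF⟩ := h.exists_isPrimitive
  obtain ⟨F', hF', hfF'⟩ := h'.exists_isPrimitive
  refine inner_add_inner_eq_zero hμν hF hfF hF' hfF' ?_
  have t1 := tendsto_zero_of_regular hF hfF hd
  have t2 := tendsto_zero_of_regular hF' hfF' hd'
  have t3 : Tendsto (fun r : ℝ => (r : ℂ)) (𝓝[>] 0) (𝓝 0) := by
    have := (Complex.continuous_ofReal.tendsto 0).mono_left (nhdsWithin_le_nhds (s := Ioi 0))
    simpa using this
  have t4 := (Complex.continuous_conj.tendsto 0).comp t1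
  simpa using t3.mul (t4.mul t2)

/-! ### The critical operator `∂_{1/2}` and the function `K_{1/2}` -/

lemma besselKHalf_ae : besselKHalf =ᵐ[radialMeasure]
    fun r => ((√(π / (2 * r)) * Real.exp (-r) : ℝ) : ℂ) := by
  refine memLp_besselK_half.coeFn_toLp.trans (ae_radial_iff.2 ?_)
  filter_upwards [ae_restrict_mem measurableSet_Ioi] with r hr
  rw [besselK_half hr]

lemma sqrt_mul_besselK {r : ℝ} (hr : 0 < r) :
    √r * (√(π / (2 * r)) * Real.exp (-r)) = √(π / 2) * Real.exp (-r) := by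
  rw [← mul_assoc, ← Real.sqrt_mul hr.le]
  congr 2
  field_simp

lemma isPrimitive_besselK : IsPrimitive (fun r => ((√(π / (2 * r)) * Real.exp (-r) : ℝ) : ℂ))
    fun r => -((√(π / (2 * r)) * Real.exp (-r) : ℝ) : ℂ) -
      ((1 / 2 / r : ℝ) : ℂ) * ((√(π / (2 * r)) * Real.exp (-r) : ℝ) : ℂ) := by
  have hc : ContinuousOn (fun r : ℝ => √(π / (2 * r)) * Real.exp (-r)) (Ioi 0) := by
    refine ContinuousOn.mul (Real.continuous_sqrt.comp_continuousOn ?_) (by fun_prop)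
    exact continuousOn_const.div (by fun_prop) fun r (hr : 0 < r) => by positivity
  have hc2 : ContinuousOn (fun r : ℝ => 1 / 2 / r) (Ioi 0) :=
    continuousOn_const.div continuousOn_id fun r hr => ne_of_gt hr
  refine isPrimitive_of_hasDerivAt (fun r hr => ?_)
    ((Complex.continuous_ofReal.comp_continuousOn hc).neg.sub
      ((Complex.continuous_ofReal.comp_continuousOn hc2).mul
        (Complex.continuous_ofReal.comp_continuousOn hc)))
  have hp : 0 < π / (2 * r) := by positivity
  have h1 : HasDerivAt (fun r : ℝ => π / (2 * r)) (-(π / (2 * r)) / r) r := by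
    have h := ((hasDerivAt_id r).const_mul 2).inv (by simpa using hr.ne')
    have := h.const_mul π
    refine this.congr_deriv ?_ |>.congr_of_eventuallyEq ?_
    · simp only [id]; field_simp
    · exact Eventually.of_forall fun x => by simp [div_eq_mul_inv]
  have h2 := (h1.sqrt hp.ne').mul (hasDerivAt_neg r).exp
  have h3 := h2.ofReal_comp
  refine h3.congr_deriv ?_
  have h4 : -(π / (2 * r)) / r / (2 * √(π / (2 * r))) = -(1 / 2 / r * √(π / (2 * r))) := by
    have h5 : √(π / (2 * r)) ≠ 0 := (Real.sqrt_pos.2 hp).ne'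
    rw [div_eq_iff (by positivity)]
    have h6 := Real.mul_self_sqrt hp.le
    linear_combination (1 / r) * h6
  rw [h4]
  push_cast
  ring

lemma besselRel_besselK : BesselRel (1 / 2) besselKHalf (-besselKHalf) :=
  isPrimitive_besselK.besselRel besselKHalf_ae ((Lp.coeFn_neg _).trans besselKHalf_ae.neg)

lemma one_sub_exp_neg_le_sqrt {r : ℝ} (hr : 0 < r) : 1 - Real.exp (-r) ≤ √r := by
  rcases le_or_gt r 1 with h | h
  · have h1 := Real.add_one_le_exp (-r)
    have h2 : r ≤ √r := Real.le_sqrt_of_sq_le (by nlinarith)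
    linarith
  · have h1 := Real.exp_pos (-r)
    have h2 : 1 ≤ √r := Real.one_le_sqrt.2 h.le
    linarith

/-- An element of the maximal domain of `∂_{1/2}` has a boundary value: `√r F(r)` differs from a
constant by `O(√r)`. -/
lemma exists_boundary_value {F g : ℝ → ℂ}
    (hF : IsPrimitive F fun r => g r - ((1 / 2 / r : ℝ) : ℂ) * F r)
    (hgm : AEStronglyMeasurable g (volume.restrict (Ioi (0 : ℝ))))
    (hg2 : IntegrableOn (fun r => r * ‖g r‖ ^ 2) (Ioi 0)) :
    ∃ (β : ℂ) (C : ℝ), ∀ r, 0 < r → ‖(√r : ℂ) * F r - β‖ ≤ √r * C := by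
  have hs : IsPrimitive (fun r : ℝ => (√r : ℂ)) fun r => ((1 / (2 * √r) : ℝ) : ℂ) := by
    refine isPrimitive_of_hasDerivAt (fun r hr => (Real.hasDerivAt_sqrt hr.ne').ofReal_comp) ?_
    refine Complex.continuous_ofReal.comp_continuousOn (continuousOn_const.div (by fun_prop) ?_)
    exact fun r hr => by have := Real.sqrt_pos.2 hr; positivity
  have hP : IsPrimitive (fun r : ℝ => (√r : ℂ) * F r) fun r => (√r : ℂ) * g r := by
    refine (hs.mul hF).congr_deriv ((ae_restrict_iff' measurableSet_Ioi).2 (Eventually.of_forall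
      fun r hr => ?_))
    have hr0 : (0 : ℝ) < r := hr
    have h1 : (√r : ℂ) ≠ 0 := by exact_mod_cast (Real.sqrt_pos.2 hr0).ne'
    have h2 : (r : ℂ) = √r * √r := by exact_mod_cast (Real.mul_self_sqrt hr0.le).symm
    have h3 : (((1 / 2 / r : ℝ)) : ℂ) = 1 / (2 * (√r * √r)) := by
      push_cast; rw [← h2]; field_simp
    rw [h3]
    push_cast
    field_simp
    ring
  set p : ℝ → ℂ := fun r => (√r : ℂ) * g r with hp
  set N := ∫ r in Ioi 0, r * ‖g r‖ ^ 2 with hN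
  have hpn : ∀ t > 0, ∀ s > 0, ‖p s‖ ≤ (1 / t + t * (s * ‖g s‖ ^ 2)) / 2 := by
    intro t ht s hs
    have h1 : ‖p s‖ = √s * ‖g s‖ := by
      rw [hp, norm_mul, Complex.norm_real, Real.norm_of_nonneg (Real.sqrt_nonneg s)]
    have h2 : s * ‖g s‖ ^ 2 = (√s * ‖g s‖) ^ 2 := by rw [mul_pow, Real.sq_sqrt hs.le]
    rw [h1, h2]
    have h3 : 1 / t + t * (√s * ‖g s‖) ^ 2 - 2 * (√s * ‖g s‖) =
        (1 - t * (√s * ‖g s‖)) ^ 2 / t := by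
      field_simp; ring
    have h4 : 0 ≤ (1 - t * (√s * ‖g s‖)) ^ 2 / t := by positivity
    linarith
  have hpm : AEStronglyMeasurable p (volume.restrict (Ioi (0 : ℝ))) :=
    (Complex.continuous_ofReal.comp Real.continuous_sqrt).aestronglyMeasurable.mul hgm
  have hdom : ∀ t > 0, ∀ r > 0, IntegrableOn (fun s => (1 / t + t * (s * ‖g s‖ ^ 2)) / 2)
      (Ioc 0 r) := fun t ht r hr =>
    ((integrableOn_const (by simp)).add ((hg2.mono_set fun s hs => hs.1).const_mul t)).div_const 2
  have hpi : ∀ r > 0, IntegrableOn p (Ioc 0 r) := fun r hr => by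
    refine Integrable.mono' (hdom 1 one_pos r hr) (hpm.mono_measure
      (Measure.restrict_mono (fun s hs => hs.1) le_rfl)) ?_
    filter_upwards [ae_restrict_mem measurableSet_Ioc] with s hs using hpn 1 one_pos s hs.1
  have hpI : ∀ r > 0, IntervalIntegrable p volume 0 r := fun r hr => by
    rw [intervalIntegrable_iff_integrableOn_Ioc_of_le hr.le]; exact hpi r hr
  refine ⟨(√1 : ℝ) * F 1 - ∫ s in (0 : ℝ)..1, p s, (1 + N) / 2, fun r hr => ?_⟩
  have e1 : (√r : ℂ) * F r - ((√1 : ℝ) * F 1 - ∫ s in (0 : ℝ)..1, p s) =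
      ∫ s in (0 : ℝ)..r, p s := by
    rcases le_total 1 r with h | h
    · rw [← intervalIntegral.integral_add_adjacent_intervals (hpI 1 one_pos) (hP one_pos h).1,
        (hP one_pos h).2]
      ring
    · rw [← intervalIntegral.integral_add_adjacent_intervals (hpI r hr) (hP hr h).1, (hP hr h).2]
      ring
  rw [e1]
  have hsr := Real.sqrt_pos.2 hr
  refine (intervalIntegral.norm_integral_le_integral_norm hr.le).trans ?_
  rw [intervalIntegral.integral_of_le hr.le]
  refine (setIntegral_mono_on (hpi r hr).norm (hdom (√r) hsr r hr) measurableSet_Ioc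
    fun s hs => hpn _ hsr s hs.1).trans ?_
  rw [integral_div, integral_add (integrable_const _)
    ((hg2.mono_set fun s hs => hs.1).const_mul _), integral_const_mul]
  have h1 : ∫ s in Ioc 0 r, s * ‖g s‖ ^ 2 ≤ N := by
    refine setIntegral_mono_set hg2 ?_ (LE.le.eventuallyLE fun s hs => hs.1)
    filter_upwards [ae_restrict_mem measurableSet_Ioi] with s hs
    have : (0 : ℝ) < s := hs
    positivity
  have h2 : ∫ s in Ioc 0 r, (1 / √r : ℝ) = √r := by
    rw [setIntegral_const, Measure.real, Real.volume_Ioc, sub_zero, ENNReal.toReal_ofReal hr.le,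
      smul_eq_mul, mul_one_div, Real.div_sqrt]
  rw [h2]
  nlinarith

/-- The maximal domain of `∂_{1/2}` is spanned by the regular functions and `K_{1/2}`. -/
lemma BesselRel.exists_sub_smul_besselK {f g : RadialL2} (h : BesselRel (1 / 2) f g) :
    ∃ c : ℂ, MemLp (fun r : ℝ => (f - c • besselKHalf : RadialL2) r / (r : ℂ)) 2
      radialMeasure := by
  obtain ⟨F, hF, hfF⟩ := h.exists_isPrimitive
  obtain ⟨β, C, hβ⟩ := exists_boundary_value hF
    (aestronglyMeasurable_radial_iff.1 (Lp.aestronglyMeasurable g)) (integrableOn_sq_norm g)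
  have hκ : 0 < √(π / 2) := Real.sqrt_pos.2 (by positivity)
  have hκ' : (√(π / 2) : ℂ) ≠ 0 := by exact_mod_cast hκ.ne'
  let c : ℂ := β / √(π / 2)
  let K : ℝ → ℂ := fun r => ((√(π / (2 * r)) * Real.exp (-r) : ℝ) : ℂ)
  have hrep : (f - c • besselKHalf : RadialL2) =ᵐ[radialMeasure] fun r => F r + -c * K r := by
    filter_upwards [Lp.coeFn_sub f (c • besselKHalf), Lp.coeFn_smul c besselKHalf, hfF,
      besselKHalf_ae] with r h1 h2 h3 h4
    rw [h1, Pi.sub_apply, h2, Pi.smul_apply, h3, h4, smul_eq_mul]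
    simp only [K]
    ring
  have hprim : IsPrimitive (fun r => F r + -c * K r) fun r =>
      (g + c • besselKHalf : RadialL2) r - ((1 / 2 / r : ℝ) : ℂ) * (F r + -c * K r) := by
    refine (hF.add (isPrimitive_besselK.clm_comp (ContinuousLinearMap.mul ℝ ℂ (-c)))).congr_deriv ?_
    filter_upwards [ae_radial_iff.1 (Lp.coeFn_add g (c • besselKHalf)),
      ae_radial_iff.1 (Lp.coeFn_smul c besselKHalf), ae_radial_iff.1 besselKHalf_ae]
      with r h1 h2 h4
    rw [h1, Pi.add_apply, h2, Pi.smul_apply, h4, smul_eq_mul]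
    change g r - _ * F r + -c * (-K r - _ * K r) = g r + c * K r - _
    ring
  refine ⟨c, BesselRel.memLp_div_of_bound (by norm_num) hprim hrep (C := (C + ‖β‖) ^ 2)
    fun r hr => ?_⟩
  have hsr := Real.sqrt_pos.2 hr
  refine pow_le_pow_left₀ (norm_nonneg _) ?_ 2
  have h1 : (√r : ℂ) * (F r + -c * K r) =
      ((√r : ℂ) * F r - β) + β * ((1 - Real.exp (-r) : ℝ) : ℂ) := by
    have h2 : (√r : ℂ) * K r = √(π / 2) * Real.exp (-r) := by
      simp only [K]
      exact_mod_cast sqrt_mul_besselK hr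
    have h3 : c * √(π / 2) = β := div_mul_cancel₀ _ hκ'
    push_cast at h2 ⊢
    linear_combination (-c) * h2 - Complex.exp (-r) * h3
  have h4 : √r * ‖F r + -c * K r‖ ≤ √r * (C + ‖β‖) := by
    have h5 : √r * ‖F r + -c * K r‖ = ‖(√r : ℂ) * (F r + -c * K r)‖ := by
      rw [norm_mul, Complex.norm_real, Real.norm_of_nonneg hsr.le]
    rw [h5, h1]
    refine (norm_add_le _ _).trans ?_
    rw [norm_mul, Complex.norm_real, Real.norm_of_nonneg
      (by have := Real.exp_le_one_iff.2 (neg_nonpos.2 hr.le); linarith)]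
    have := mul_le_mul_of_nonneg_left (one_sub_exp_neg_le_sqrt hr) (norm_nonneg β)
    linarith [hβ r hr]
  exact le_of_mul_le_mul_left h4 hsr

/-- The boundary term of a regular function against `K_{1/2}` vanishes, as
`r f(r) K_{1/2}(r) = O(√r) f(r)`. -/
lemma inner_add_inner_besselK {f g : RadialL2} (h : BesselRel (1 / 2) f g)
    (hd : MemLp (fun r : ℝ => f r / (r : ℂ)) 2 radialMeasure) :
    inner ℂ f (-besselKHalf) + inner ℂ g besselKHalf = 0 := by
  obtain ⟨F, hF, hfF⟩ := h.exists_isPrimitive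
  have hK : IsPrimitive (fun r => ((√(π / (2 * r)) * Real.exp (-r) : ℝ) : ℂ)) fun r =>
      (-besselKHalf : RadialL2) r -
        ((1 / 2 / r : ℝ) : ℂ) * ((√(π / (2 * r)) * Real.exp (-r) : ℝ) : ℂ) := by
    refine isPrimitive_besselK.congr_deriv ?_
    filter_upwards [ae_radial_iff.1 (Lp.coeFn_neg besselKHalf), ae_radial_iff.1 besselKHalf_ae]
      with r h1 h2
    rw [h1, Pi.neg_apply, h2]
  refine inner_add_inner_eq_zero (by norm_num) hF hfF hK besselKHalf_ae ?_
  have t1 := (Complex.continuous_conj.tendsto 0).comp (tendsto_zero_of_regular hF hfF hd)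
  have t2 : Tendsto (fun r : ℝ => ((√r * (√(π / 2) * Real.exp (-r)) : ℝ) : ℂ)) (𝓝[>] 0) (𝓝 0) := by
    have hc : Continuous fun r : ℝ => ((√r * (√(π / 2) * Real.exp (-r)) : ℝ) : ℂ) := by fun_prop
    have := (hc.tendsto 0).mono_left (nhdsWithin_le_nhds (s := Ioi 0))
    simpa using this
  have t3 := t1.mul t2
  rw [map_zero, zero_mul] at t3
  refine t3.congr' (eventually_nhdsWithin_of_forall fun r hr => ?_)
  have hr0 : (0 : ℝ) < r := hr
  have h1 : √r * (√(π / 2) * Real.exp (-r)) = r * (√(π / (2 * r)) * Real.exp (-r)) := by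
    rw [← sqrt_mul_besselK hr0, ← mul_assoc, Real.mul_self_sqrt hr0.le]
  simp only [Function.comp_apply, h1, Complex.ofReal_mul]
  ring

lemma besselKHalf_ne_zero : besselKHalf ≠ 0 := fun h =>
  besselKHalf_notMem (h ▸ regularSpace.zero_mem)

lemma inner_besselK_self_ne_zero : inner ℂ besselKHalf besselKHalf ≠ 0 :=
  inner_self_ne_zero.2 besselKHalf_ne_zero

/-! ### Testing against `C_c^∞((0,∞))` -/

lemma smul_mem_radialTest {a : ℝ → ℂ} (ha : ContDiffOn ℝ ∞ a (Ioi 0)) {w : ℝ → ℂ}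
    (hw : w ∈ radialTest) : (fun r => a r * w r) ∈ radialTest := by
  have hs : tsupport (fun r => a r * w r) ⊆ tsupport w :=
    closure_mono fun r hr => right_ne_zero_of_mul hr
  refine ⟨contDiff_iff_contDiffAt.2 fun r => ?_, hw.2.1.mul_left, hs.trans hw.2.2⟩
  by_cases hr : r ∈ tsupport w
  · exact (ha.contDiffAt (Ioi_mem_nhds (hw.2.2 hr))).mul hw.1.contDiffAt
  · have h0 : (fun r => a r * w r) =ᶠ[𝓝 r] fun _ => 0 := by
      filter_upwards [notMem_tsupport_iff_eventuallyEq.1 hr] with x hx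
      rw [hx, Pi.zero_apply, mul_zero]
    exact contDiffAt_const.congr_of_eventuallyEq h0

lemma conj_mem_radialTest {w : ℝ → ℂ} (hw : w ∈ radialTest) :
    (fun r => (starRingEnd ℂ) (w r)) ∈ radialTest :=
  ⟨Complex.conjCLE.contDiff.comp hw.1, hw.2.1.comp_left (g := starRingEnd ℂ) (map_zero _),
    (closure_mono fun r hr => by simpa using hr).trans hw.2.2⟩

lemma mul_conj_mem_radialTest {u : ℝ → ℂ} (hu : u ∈ radialTest) :
    (fun r : ℝ => (r : ℂ) * (starRingEnd ℂ) (u r)) ∈ radialTest :=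
  smul_mem_radialTest Complex.ofRealCLM.contDiff.contDiffOn (conj_mem_radialTest hu)

lemma exists_mul_conj_eq {w : ℝ → ℂ} (hw : w ∈ radialTest) :
    ∃ u ∈ radialTest, (fun r : ℝ => (r : ℂ) * (starRingEnd ℂ) (u r)) = w := by
  have h1 : ContDiffOn ℝ ∞ (fun r : ℝ => ((r⁻¹ : ℝ) : ℂ)) (Ioi 0) :=
    Complex.ofRealCLM.contDiff.comp_contDiffOn
      (contDiffOn_id.inv fun r hr => ne_of_gt hr)
  refine ⟨_, smul_mem_radialTest h1 (conj_mem_radialTest hw), funext fun r => ?_⟩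
  by_cases hr : r ∈ tsupport w
  · have hr0 : (r : ℂ) ≠ 0 := by exact_mod_cast ne_of_gt (hw.2.2 hr)
    simp only [map_mul, Complex.conj_ofReal, Complex.conj_conj]
    push_cast
    field_simp
  · simp [image_eq_zero_of_notMem_tsupport hr]

lemma inner_testToL2 (u : radialTest) (g : RadialL2) :
    inner ℂ (testToL2 u) g =
      ∫ r in Ioi (0 : ℝ), g r * ((r : ℂ) * (starRingEnd ℂ) (u.1 r)) := by
  rw [(inner_radial (testToL2 u) g (memLp_of_radialTest u.2).coeFn_toLp EventuallyEq.rfl).2]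
  congr 1
  funext r
  ring

lemma inner_testBessel (μ : ℝ) (u : radialTest) (f : RadialL2) :
    inner ℂ (testBessel μ u) f =
      (∫ r in Ioi 0, f r * deriv (fun r : ℝ => (r : ℂ) * (starRingEnd ℂ) (u.1 r)) r) -
      ∫ r in Ioi (0 : ℝ), ((((1 - μ) / r : ℝ) : ℂ) * f r) *
        ((r : ℂ) * (starRingEnd ℂ) (u.1 r)) := by
  have hw := mul_conj_mem_radialTest u.2
  rw [(inner_radial (testBessel μ u) f (memLp_besselExpr μ u.2).coeFn_toLp EventuallyEq.rfl).2,
    ← integral_sub (integrable_mul_deriv_radialTest f hw) (integrable_radialTest_mul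
      (locallyIntegrableOn_mul_div (1 - μ) (locallyIntegrableOn f)) hw)]
  refine setIntegral_congr_fun measurableSet_Ioi fun r hr => ?_
  have hr0 : (r : ℂ) ≠ 0 := by exact_mod_cast ne_of_gt hr
  have hd : HasDerivAt u.1 (deriv u.1 r) r := (u.2.1.differentiable (by simp) r).hasDerivAt
  have hd2 : HasDerivAt (fun r => (starRingEnd ℂ) (u.1 r)) ((starRingEnd ℂ) (deriv u.1 r)) r :=
    (Complex.conjCLE : ℂ →L[ℝ] ℂ).hasFDerivAt.comp_hasDerivAt r hd
  have hd3 := ((hasDerivAt_id r).ofReal_comp.mul hd2).deriv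
  have hd4 : deriv (fun r : ℝ => (r : ℂ) * (starRingEnd ℂ) (u.1 r)) r =
      ((1 : ℝ) : ℂ) * (starRingEnd ℂ) (u.1 r) + (r : ℂ) * (starRingEnd ℂ) (deriv u.1 r) := hd3
  simp only [hd4, besselExpr, map_add, map_mul, Complex.conj_ofReal]
  push_cast
  field_simp
  ring

/-- The adjoint of `∂_μ` on test functions is the maximal operator `-∂_{1-μ}`. -/
lemma forall_inner_testBessel_iff {μ : ℝ} {f g : RadialL2} :
    (∀ u : radialTest, inner ℂ (testBessel μ u) f = inner ℂ (testToL2 u) g) ↔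
      BesselRel (1 - μ) f (-g) := by
  have key : ∀ w ∈ radialTest,
      ∫ r in Ioi (0 : ℝ), ((-g : RadialL2) r - (((1 - μ) / r : ℝ) : ℂ) * f r) * w r =
        -(∫ r in Ioi 0, g r * w r) -
          ∫ r in Ioi (0 : ℝ), ((((1 - μ) / r : ℝ) : ℂ) * f r) * w r := by
    intro w hw
    rw [← integral_neg, ← integral_sub (f := fun r => -(g r * w r)) (integrable_mul_radialTest g hw).neg
      (integrable_radialTest_mul (locallyIntegrableOn_mul_div (1 - μ) (locallyIntegrableOn f)) hw)]
    refine integral_congr_ae ?_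
    filter_upwards [ae_radial_iff.1 (Lp.coeFn_neg g)] with r hr
    rw [hr, Pi.neg_apply]
    ring
  constructor
  · intro h w hw
    obtain ⟨u, hu, rfl⟩ := exists_mul_conj_eq hw
    have h1 := h ⟨u, hu⟩
    rw [inner_testBessel, inner_testToL2] at h1
    rw [key _ hw]
    linear_combination h1
  · intro h u
    have hw := mul_conj_mem_radialTest u.2
    have h1 := h _ hw
    rw [key _ hw] at h1
    rw [inner_testBessel, inner_testToL2]
    linear_combination h1

lemma eq_zero_of_forall_inner_testToL2 {f : RadialL2}
    (h : ∀ u : radialTest, inner ℂ (testToL2 u) f = 0) : f = 0 := by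
  refine HasWeakDeriv.unique (φ := 0) (fun w hw => ?_) HasWeakDeriv.zero
  obtain ⟨u, hu, rfl⟩ := exists_mul_conj_eq hw
  rw [← inner_testToL2 ⟨u, hu⟩, h, neg_zero]
  refine (integral_congr_ae ?_).trans (integral_zero ℝ ℂ)
  filter_upwards [ae_radial_iff.1 (Lp.coeFn_zero ℂ 2 radialMeasure)] with r hr
  rw [hr, Pi.zero_apply, zero_mul]

lemma besselRel_test (μ : ℝ) (u : radialTest) : BesselRel μ (testToL2 u) (testBessel μ u) := by
  refine IsPrimitive.besselRel (F := u.1) (G := besselExpr μ u.1) ?_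
    (memLp_of_radialTest u.2).coeFn_toLp (memLp_besselExpr μ u.2).coeFn_toLp
  convert isPrimitive_radialTest u.2 using 1
  funext r
  simp [besselExpr]

/-! ### Graphs of unbounded operators and the boundary form -/

section BoundaryForm

variable {E : Type*} [NormedAddCommGroup E] [InnerProductSpace ℂ E]

/-- The boundary form `⟪A f, f'⟫ - ⟪f, A f'⟫` of two points `(f, A f)`, `(f', A f')` of a graph. -/
noncomputable def boundaryForm (x y : E × E) : ℂ :=
  inner ℂ x.2 y.1 - inner ℂ x.1 y.2

lemma boundaryForm_add_left (x x' y : E × E) :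
    boundaryForm (x + x') y = boundaryForm x y + boundaryForm x' y := by
  simp only [boundaryForm, Prod.fst_add, Prod.snd_add, inner_add_left]; ring

lemma boundaryForm_add_right (x y y' : E × E) :
    boundaryForm x (y + y') = boundaryForm x y + boundaryForm x y' := by
  simp only [boundaryForm, Prod.fst_add, Prod.snd_add, inner_add_right]; ring

lemma boundaryForm_swap (x y : E × E) :
    boundaryForm x y = -(starRingEnd ℂ) (boundaryForm y x) := by
  simp only [boundaryForm, map_sub, inner_conj_symm]; ring

lemma boundaryForm_eq_zero_comm {x y : E × E} : boundaryForm x y = 0 ↔ boundaryForm y x = 0 := by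
  rw [boundaryForm_swap x y, neg_eq_zero, map_eq_zero]

lemma mem_adjoint_iff_boundaryForm {g : Submodule ℂ (E × E)} {y : E × E} :
    y ∈ g.adjoint ↔ ∀ x ∈ g, boundaryForm x y = 0 := by
  rw [Submodule.mem_adjoint_iff]
  exact ⟨fun h x hx => h x.1 x.2 hx, fun h a b hab => h (a, b) hab⟩

lemma adjoint_antitone {g g' : Submodule ℂ (E × E)} (h : g ≤ g') : g'.adjoint ≤ g.adjoint :=
  fun _ hy => mem_adjoint_iff_boundaryForm.2 fun x hx =>
    mem_adjoint_iff_boundaryForm.1 hy x (h hx)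

/-- The double adjoint of a graph in a Hilbert space is its closure. -/
lemma adjoint_adjoint_eq_topologicalClosure [CompleteSpace E] (g : Submodule ℂ (E × E)) :
    g.adjoint.adjoint = g.topologicalClosure := by
  let e : (E × E) ≃L[ℂ] WithLp 2 (E × E) := (WithLp.prodContinuousLinearEquiv 2 ℂ E E).symm
  let G : Submodule ℂ (WithLp 2 (E × E)) := g.map (e : (E × E) →ₗ[ℂ] WithLp 2 (E × E))
  have inner_e : ∀ x y : E × E, inner ℂ (e x) (e y) = inner ℂ x.1 y.1 + inner ℂ x.2 y.2 :=
    fun x y => WithLp.prod_inner_apply _ _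
  have hperp : ∀ z : E × E, e z ∈ Gᗮ ↔ (-z.2, z.1) ∈ g.adjoint := by
    intro z
    rw [Submodule.mem_orthogonal, mem_adjoint_iff_boundaryForm]
    constructor
    · intro h x hx
      have := h (e x) (Submodule.mem_map_of_mem hx)
      rw [inner_e] at this
      simp only [boundaryForm, inner_neg_right]
      linear_combination -this
    · rintro h _ ⟨x, hx, rfl⟩
      have := h x hx
      simp only [boundaryForm, inner_neg_right] at this
      refine (inner_e x z).trans ?_
      linear_combination -this
  ext y
  have h1 : y ∈ g.topologicalClosure ↔ e y ∈ Gᗮᗮ := by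
    rw [Submodule.orthogonal_orthogonal_eq_closure]
    change y ∈ closure (g : Set (E × E)) ↔ e y ∈ closure (G : Set (WithLp 2 (E × E)))
    have : (G : Set (WithLp 2 (E × E))) = e.toHomeomorph '' g := rfl
    rw [this, ← e.toHomeomorph.image_closure]
    exact (e.injective.mem_set_image).symm
  rw [h1, mem_adjoint_iff_boundaryForm, Submodule.mem_orthogonal]
  constructor
  · intro h w hw
    obtain ⟨z, rfl⟩ := e.surjective w
    have := h _ ((hperp z).1 hw)
    simp only [boundaryForm, inner_neg_left] at this
    rw [inner_e]
    linear_combination this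
  · rintro h ⟨a, b⟩ hab
    have := h (e (b, -a)) ((hperp _).2 (by simpa using hab))
    rw [inner_e] at this
    simp only [inner_neg_left] at this
    simp only [boundaryForm]
    linear_combination this

lemma isSelfAdjoint_iff_graph [CompleteSpace E] {A : E →ₗ.[ℂ] E}
    (hA : Dense (A.domain : Set E)) : IsSelfAdjoint A ↔ A.graph.adjoint = A.graph := by
  rw [← LinearPMap.adjoint_graph_eq_graph_adjoint hA, LinearPMap.isSelfAdjoint_def]
  exact ⟨fun h => by rw [h], LinearPMap.eq_of_eq_graph⟩

lemma dense_of_forall_inner_eq_zero [CompleteSpace E] {S : Submodule ℂ E}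
    (h : ∀ y, (∀ x ∈ S, inner ℂ x y = 0) → y = 0) : Dense (S : Set E) := by
  rw [Submodule.dense_iff_topologicalClosure_eq_top, Submodule.topologicalClosure_eq_top_iff,
    Submodule.eq_bot_iff]
  exact fun y hy => h y fun x hx => (Submodule.mem_orthogonal S y).1 hy x hx

lemma mem_graph_supSpanSingleton {A : E →ₗ.[ℂ] E} {x y : E} (hx : x ∉ A.domain) {z : E × E} :
    z ∈ (A.supSpanSingleton x y hx).graph ↔ ∃ c : ℂ, z - c • (x, y) ∈ A.graph := by
  have hmk : ∀ (x' : E) (hx' : x' ∈ A.domain) (c : ℂ),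
      (x' + c • x, A ⟨x', hx'⟩ + c • y) ∈ (A.supSpanSingleton x y hx).graph := by
    intro x' hx' c
    refine (LinearPMap.mem_graph_iff _).2 ⟨⟨x' + c • x, Submodule.mem_sup.2 ⟨x', hx', _,
      Submodule.mem_span_singleton.2 ⟨c, rfl⟩, rfl⟩⟩, rfl, ?_⟩
    exact A.supSpanSingleton_apply_mk x y hx x' hx' c
  constructor
  · intro hz
    have hd : z.1 ∈ (A.supSpanSingleton x y hx).domain :=
      LinearPMap.mem_domain_of_mem_graph (y := z.2) hz
    obtain ⟨x', hx', w, hw, hz1⟩ := Submodule.mem_sup.1 hd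
    obtain ⟨c, rfl⟩ := Submodule.mem_span_singleton.1 hw
    refine ⟨c, (LinearPMap.mem_graph_iff _).2 ⟨⟨x', hx'⟩, ?_, ?_⟩⟩
    · simp [← hz1]
    · have := LinearPMap.mem_graph_snd_inj' _ hz (hmk x' hx' c) hz1.symm
      simp only [Prod.snd_sub, Prod.smul_snd, this, add_sub_cancel_right]
  · rintro ⟨c, hc⟩
    obtain ⟨⟨x', hx'⟩, h1, h2⟩ := (LinearPMap.mem_graph_iff _).1 hc
    have e : z = (x' + c • x, A ⟨x', hx'⟩ + c • y) := by
      refine Prod.ext ?_ ?_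
      · simp only at h1
        simp [h1]
      · simp [h2]
    rw [e]
    exact hmk x' hx' c

lemma mem_graph_ofInjective {V E F : Type*} [AddCommGroup V] [Module ℂ V] [AddCommGroup E]
    [Module ℂ E] [AddCommGroup F] [Module ℂ F] {S : V →ₗ[ℂ] E} {T : V →ₗ[ℂ] F}
    (hS : Function.Injective S) {x : E × F} :
    x ∈ (ofInjective S T hS).graph ↔ ∃ v, x = (S v, T v) := by
  rw [LinearPMap.mem_graph_iff]
  constructor
  · rintro ⟨⟨_, v, rfl⟩, h1, h2⟩
    refine ⟨v, Prod.ext h1.symm (h2.symm.trans ?_)⟩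
    change T ((LinearEquiv.ofInjective S hS).symm (LinearEquiv.ofInjective S hS v)) = T v
    rw [LinearEquiv.symm_apply_apply]
  · rintro ⟨v, rfl⟩
    refine ⟨⟨S v, v, rfl⟩, rfl, ?_⟩
    change T ((LinearEquiv.ofInjective S hS).symm (LinearEquiv.ofInjective S hS v)) = T v
    rw [LinearEquiv.symm_apply_apply]

end BoundaryForm

lemma inner_spinor {E : Type*} [NormedAddCommGroup E] [InnerProductSpace ℂ E]
    (x y : WithLp 2 (E × E)) :
    inner ℂ x y = inner ℂ x.fst y.fst + inner ℂ x.snd y.snd :=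
  WithLp.prod_inner_apply x y

lemma spinor_ext {E : Type*} {x y : WithLp 2 (E × E)} (h1 : x.fst = y.fst) (h2 : x.snd = y.snd) :
    x = y :=
  (WithLp.ofLp_injective 2) (Prod.ext h1 h2)

/-! ### The radial operators -/

lemma mem_graph_radialDirac {σ : ℝ} {k : ℤ} {x : RadialSpinor × RadialSpinor} :
    x ∈ (radialDirac σ k).graph ↔ ∃ u v : radialTest,
      x = (WithLp.toLp 2 (testToL2 u, testToL2 v),
        WithLp.toLp 2 (-testBessel (1 / 2 - k / σ) v, testBessel (1 / 2 + k / σ) u)) := by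
  rw [radialDirac, mem_graph_ofInjective]
  exact ⟨fun ⟨w, h⟩ => ⟨w.1, w.2, h⟩, fun ⟨u, v, h⟩ => ⟨(u, v), h⟩⟩

lemma dense_domain_radialDirac (σ : ℝ) (k : ℤ) :
    Dense ((radialDirac σ k).domain : Set RadialSpinor) := by
  refine dense_of_forall_inner_eq_zero fun y hy => ?_
  have key : ∀ u v : radialTest,
      inner ℂ (testToL2 u) y.fst + inner ℂ (testToL2 v) y.snd = 0 := fun u v => by
    have := hy _ (LinearPMap.mem_domain_of_mem_graph (mem_graph_radialDirac.2 ⟨u, v, rfl⟩))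
    rwa [inner_spinor] at this
  refine spinor_ext (eq_zero_of_forall_inner_testToL2 fun u => ?_)
    (eq_zero_of_forall_inner_testToL2 fun v => ?_)
  · simpa using key u 0
  · simpa using key 0 v

/-- The adjoint of `d_k` is the maximal operator. -/
lemma mem_adjoint_graph_radialDirac {σ : ℝ} {k : ℤ} {x : RadialSpinor × RadialSpinor} :
    x ∈ (radialDirac σ k).graph.adjoint ↔ BesselRel (1 / 2 + k / σ) x.1.fst x.2.snd ∧
      BesselRel (1 / 2 - k / σ) x.1.snd (-x.2.fst) := by
  have h1 := forall_inner_testBessel_iff (μ := 1 / 2 - k / σ) (f := x.1.fst) (g := -x.2.snd)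
  have h2 := forall_inner_testBessel_iff (μ := 1 / 2 + k / σ) (f := x.1.snd) (g := x.2.fst)
  rw [neg_neg, show 1 - (1 / 2 - (k : ℝ) / σ) = 1 / 2 + k / σ by ring] at h1
  rw [show 1 - (1 / 2 + (k : ℝ) / σ) = 1 / 2 - k / σ by ring] at h2
  rw [← h1, ← h2, mem_adjoint_iff_boundaryForm]
  have key : ∀ u v : radialTest, boundaryForm (WithLp.toLp 2 (testToL2 u, testToL2 v),
        WithLp.toLp 2 (-testBessel (1 / 2 - k / σ) v, testBessel (1 / 2 + k / σ) u)) x =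
      -inner ℂ (testBessel (1 / 2 - k / σ) v) x.1.fst +
        inner ℂ (testBessel (1 / 2 + k / σ) u) x.1.snd -
      (inner ℂ (testToL2 u) x.2.fst + inner ℂ (testToL2 v) x.2.snd) := fun u v => by
    rw [boundaryForm, inner_spinor, inner_spinor]
    simp only [WithLp.toLp_fst, WithLp.toLp_snd, inner_neg_left]
  constructor
  · intro h
    have h' : ∀ u v : radialTest, _ = _ := fun u v =>
      (key u v).symm.trans (h _ (mem_graph_radialDirac.2 ⟨u, v, rfl⟩))
    constructor
    · intro v
      have := h' 0 v
      simp only [map_zero, inner_zero_left, add_zero, zero_add] at this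
      rw [inner_neg_right]
      linear_combination -this
    · intro u
      have := h' u 0
      simp only [map_zero, inner_zero_left, add_zero, zero_add, neg_zero] at this
      linear_combination this
  · rintro ⟨h3, h4⟩ y hy
    obtain ⟨u, v, rfl⟩ := mem_graph_radialDirac.1 hy
    have h5 := h3 v
    rw [inner_neg_right] at h5
    rw [key, h4 u, h5]
    ring

lemma radialDirac_graph_le_adjoint (σ : ℝ) (k : ℤ) :
    (radialDirac σ k).graph ≤ (radialDirac σ k).graph.adjoint := by
  intro x hx
  obtain ⟨u, v, rfl⟩ := mem_graph_radialDirac.1 hx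
  refine mem_adjoint_graph_radialDirac.2 ⟨besselRel_test _ u, ?_⟩
  simpa using besselRel_test _ v

lemma mem_graph_radialDiracY {σ : ℝ} {k : ℤ} {x : RadialSpinor × RadialSpinor} :
    x ∈ (radialDiracY σ k).graph ↔ x ∈ (radialDirac σ k).graph.adjoint ∧
      MemLp (fun r : ℝ => x.1.fst r / (r : ℂ)) 2 radialMeasure ∧
      MemLp (fun r : ℝ => x.1.snd r / (r : ℂ)) 2 radialMeasure := by
  rw [mem_adjoint_graph_radialDirac, LinearPMap.mem_graph_iff]
  constructor
  · rintro ⟨f, h1, h2⟩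
    have e1 : x.2.fst = -bessel (1 / 2 - k / σ) (regularSnd f) := by rw [← h2]; rfl
    have e2 : x.2.snd = bessel (1 / 2 + k / σ) (regularFst f) := by rw [← h2]; rfl
    rw [← h1, e1, e2, neg_neg]
    exact ⟨⟨besselRel_bessel _ (regularFst f), besselRel_bessel _ (regularSnd f)⟩,
      (regularFst f).2.2.1, (regularSnd f).2.2.1⟩
  · rintro ⟨⟨h1, h2⟩, h3, h4⟩
    obtain ⟨φ, hφ, hφ'⟩ := h1.exists_regular h3
    obtain ⟨ψ, hψ, hψ'⟩ := h2.exists_regular h4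
    have hm : x.1 ∈ regularSpinors :=
      ⟨show x.1.fst ∈ regularSpace from hφ ▸ φ.2, show x.1.snd ∈ regularSpace from hψ ▸ ψ.2⟩
    have eφ : regularFst ⟨x.1, hm⟩ = φ := Subtype.ext hφ.symm
    have eψ : regularSnd ⟨x.1, hm⟩ = ψ := Subtype.ext hψ.symm
    refine ⟨⟨x.1, hm⟩, rfl, spinor_ext ?_ ?_⟩
    · change -bessel (1 / 2 - k / σ) (regularSnd ⟨x.1, hm⟩) = _
      rw [eψ, hψ', neg_neg]
    · change bessel (1 / 2 + k / σ) (regularFst ⟨x.1, hm⟩) = _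
      rw [eφ, hφ']

lemma boundaryForm_radialDiracY {σ : ℝ} {k : ℤ} {x y : RadialSpinor × RadialSpinor}
    (hx : x ∈ (radialDiracY σ k).graph) (hy : y ∈ (radialDiracY σ k).graph) :
    boundaryForm x y = 0 := by
  obtain ⟨h1, hx1, hx2⟩ := mem_graph_radialDiracY.1 hx
  obtain ⟨h2, hy1, hy2⟩ := mem_graph_radialDiracY.1 hy
  obtain ⟨x1, x2⟩ := mem_adjoint_graph_radialDirac.1 h1
  obtain ⟨y1, y2⟩ := mem_adjoint_graph_radialDirac.1 h2
  have p1 := inner_add_inner_of_regular (by ring) x1 hx1 y2 hy2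
  have p2 := inner_add_inner_of_regular (by ring) x2 hx2 y1 hy1
  rw [inner_neg_right] at p1
  rw [inner_neg_left] at p2
  rw [boundaryForm, inner_spinor, inner_spinor]
  linear_combination p1 - p2

/-- For `|k / σ| ≥ 1` the maximal and the minimal operator agree. -/
lemma adjoint_graph_radialDirac_of_ne {σ : ℝ} (hσ0 : 0 < σ) (hσ : σ ≤ 1) {k : ℤ} (hk : k ≠ 0) :
    (radialDirac σ k).graph.adjoint = (radialDiracY σ k).graph := by
  refine le_antisymm (fun x hx => ?_) fun x hx => (mem_graph_radialDiracY.1 hx).1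
  obtain ⟨h1, h2⟩ := mem_adjoint_graph_radialDirac.1 hx
  have hν : 1 ≤ (k : ℝ) / σ ∨ (k : ℝ) / σ ≤ -1 := by
    rcases lt_or_gt_of_ne hk with h | h
    · right
      have : (k : ℝ) ≤ -1 := by exact_mod_cast Int.le_sub_one_of_lt h
      rw [div_le_iff₀ hσ0]; linarith
    · left
      have : (1 : ℝ) ≤ k := by exact_mod_cast h
      rw [le_div_iff₀ hσ0]; linarith
  refine mem_graph_radialDiracY.2 ⟨hx, h1.memLp_div ?_, h2.memLp_div ?_⟩
  · rcases hν with h | h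
    · left; linarith
    · right; linarith
  · rcases hν with h | h
    · right; linarith
    · left; linarith

/-! ### Boundary values in the mode `k = 0` -/

/-- The point `(c₁ K, c₂ K) ↦ (c₂ K, -c₁ K)`, `K = K_{1/2}`, of the graph of the adjoint of `d_0`;
the pair `(c₁, c₂)` plays the role of boundary values. -/
noncomputable def singularPair (c : ℂ × ℂ) : RadialSpinor × RadialSpinor :=
  (WithLp.toLp 2 (c.1 • besselKHalf, c.2 • besselKHalf),
    WithLp.toLp 2 (c.2 • besselKHalf, -(c.1 • besselKHalf)))

lemma singularPair_mem_adjoint (σ : ℝ) (c : ℂ × ℂ) :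
    singularPair c ∈ (radialDirac σ 0).graph.adjoint := by
  refine mem_adjoint_graph_radialDirac.2 ⟨?_, ?_⟩
  · simpa [singularPair] using besselRel_besselK.smul c.1
  · simpa [singularPair] using besselRel_besselK.smul c.2

lemma singularPair_smul (a : ℂ) (c : ℂ × ℂ) : singularPair (a • c) = a • singularPair c := by
  refine Prod.ext (spinor_ext ?_ ?_) (spinor_ext ?_ ?_) <;> simp [singularPair, smul_smul]

lemma boundaryForm_singularPair (c d : ℂ × ℂ) :
    boundaryForm (singularPair c) (singularPair d) =
      2 * inner ℂ besselKHalf besselKHalf *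
        ((starRingEnd ℂ) c.2 * d.1 - (starRingEnd ℂ) c.1 * d.2) := by
  rw [boundaryForm, inner_spinor, inner_spinor]
  simp only [singularPair, WithLp.toLp_fst, WithLp.toLp_snd, inner_neg_left, inner_neg_right,
    inner_smul_left, inner_smul_right]
  ring

lemma boundaryForm_radialDiracY_singularPair {σ : ℝ} {x : RadialSpinor × RadialSpinor}
    (hx : x ∈ (radialDiracY σ 0).graph) (c : ℂ × ℂ) : boundaryForm x (singularPair c) = 0 := by
  obtain ⟨h, hx1, hx2⟩ := mem_graph_radialDiracY.1 hx
  obtain ⟨x1, x2⟩ := mem_adjoint_graph_radialDirac.1 h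
  simp only [Int.cast_zero, zero_div, add_zero, sub_zero] at x1 x2
  have p1 := inner_add_inner_besselK x1 hx1
  have p2 := inner_add_inner_besselK x2 hx2
  rw [inner_neg_right] at p1 p2
  rw [inner_neg_left] at p2
  rw [boundaryForm, inner_spinor, inner_spinor]
  simp only [singularPair, WithLp.toLp_fst, WithLp.toLp_snd, inner_neg_right, inner_smul_right]
  linear_combination c.2 * p1 - c.1 * p2

lemma exists_sub_singularPair_mem {σ : ℝ} {x : RadialSpinor × RadialSpinor}
    (hx : x ∈ (radialDirac σ 0).graph.adjoint) :
    ∃ c, x - singularPair c ∈ (radialDiracY σ 0).graph := by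
  obtain ⟨x1, x2⟩ := mem_adjoint_graph_radialDirac.1 hx
  simp only [Int.cast_zero, zero_div, add_zero, sub_zero] at x1 x2
  obtain ⟨c₁, h1⟩ := x1.exists_sub_smul_besselK
  obtain ⟨c₂, h2⟩ := x2.exists_sub_smul_besselK
  exact ⟨(c₁, c₂), mem_graph_radialDiracY.2
    ⟨Submodule.sub_mem _ hx (singularPair_mem_adjoint σ _), h1, h2⟩⟩

/-- The minimal operator is the adjoint of the maximal operator. -/
lemma adjoint_adjoint_graph_radialDirac {σ : ℝ} (hσ0 : 0 < σ) (hσ : σ ≤ 1) (k : ℤ) :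
    (radialDirac σ k).graph.adjoint.adjoint = (radialDiracY σ k).graph := by
  have hmax : (radialDirac σ k).graph.adjoint.adjoint ≤ (radialDirac σ k).graph.adjoint :=
    adjoint_antitone (radialDirac_graph_le_adjoint σ k)
  by_cases hk : k = 0
  · subst hk
    refine le_antisymm (fun x hx => ?_) fun x hx => ?_
    · obtain ⟨c, hc⟩ := exists_sub_singularPair_mem (hmax hx)
      have key : ∀ d, boundaryForm (singularPair d) (singularPair c) = 0 := fun d => by
        have h1 := mem_adjoint_iff_boundaryForm.1 hx _ (singularPair_mem_adjoint σ d)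
        have h2 := boundaryForm_eq_zero_comm.1 (boundaryForm_radialDiracY_singularPair hc d)
        rw [← sub_add_cancel x (singularPair c), boundaryForm_add_right, h2, zero_add] at h1
        exact h1
      have hK := mul_ne_zero two_ne_zero inner_besselK_self_ne_zero
      have k1 := key (0, 1)
      have k2 := key (1, 0)
      rw [boundaryForm_singularPair] at k1 k2
      have c1 : c.1 = 0 := by simpa using (mul_eq_zero.1 k1).resolve_left hK
      have c2 : c.2 = 0 := by simpa using (mul_eq_zero.1 k2).resolve_left hK
      have hc0 : singularPair c = 0 := by
        refine Prod.ext (spinor_ext ?_ ?_) (spinor_ext ?_ ?_) <;> simp [singularPair, c1, c2]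
      rwa [hc0, sub_zero] at hc
    · refine mem_adjoint_iff_boundaryForm.2 fun y hy => ?_
      obtain ⟨c, hc⟩ := exists_sub_singularPair_mem hy
      rw [← sub_add_cancel y (singularPair c), boundaryForm_add_left,
        boundaryForm_radialDiracY hc hx, zero_add]
      exact boundaryForm_eq_zero_comm.1 (boundaryForm_radialDiracY_singularPair hx c)
  · rw [adjoint_graph_radialDirac_of_ne hσ0 hσ hk] at hmax ⊢
    exact le_antisymm hmax fun x hx => mem_adjoint_iff_boundaryForm.2 fun y hy =>
      boundaryForm_radialDiracY hy hx

lemma closure_radialDirac {σ : ℝ} (hσ0 : 0 < σ) (hσ : σ ≤ 1) (k : ℤ) :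
    (radialDirac σ k).closure = radialDiracY σ k := by
  have h := (adjoint_adjoint_eq_topologicalClosure _).symm.trans
    (adjoint_adjoint_graph_radialDirac hσ0 hσ k)
  have hc : (radialDirac σ k).IsClosable := ⟨_, h⟩
  exact LinearPMap.eq_of_eq_graph (hc.graph_closure_eq_closure_graph.symm.trans h)

lemma dense_domain_radialDiracY {σ : ℝ} (hσ0 : 0 < σ) (hσ : σ ≤ 1) (k : ℤ) :
    Dense ((radialDiracY σ k).domain : Set RadialSpinor) := by
  rw [← closure_radialDirac hσ0 hσ k]
  exact (dense_domain_radialDirac σ k).mono (LinearPMap.le_closure _).1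

lemma adjoint_graph_radialDiracY {σ : ℝ} (hσ0 : 0 < σ) (hσ : σ ≤ 1) {k : ℤ} (hk : k ≠ 0) :
    (radialDiracY σ k).graph.adjoint = (radialDiracY σ k).graph := by
  rw [← adjoint_graph_radialDirac_of_ne hσ0 hσ hk, adjoint_adjoint_graph_radialDirac hσ0 hσ,
    adjoint_graph_radialDirac_of_ne hσ0 hσ hk]

lemma isSelfAdjoint_radialDiracY {σ : ℝ} (hσ0 : 0 < σ) (hσ : σ ≤ 1) {k : ℤ} (hk : k ≠ 0) :
    IsSelfAdjoint (radialDiracY σ k) :=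
  (isSelfAdjoint_iff_graph (dense_domain_radialDiracY hσ0 hσ k)).2
    (adjoint_graph_radialDiracY hσ0 hσ hk)

lemma mem_graph_radialDiracExt {σ γ : ℝ} {x : RadialSpinor × RadialSpinor} :
    x ∈ (radialDiracExt σ γ).graph ↔
      ∃ a : ℂ, x - singularPair (a • ((Real.cos γ : ℂ), (Real.sin γ : ℂ))) ∈
        (radialDiracY σ 0).graph := by
  rw [radialDiracExt, mem_graph_supSpanSingleton]
  simp only [singularPair_smul]
  rfl

lemma mem_graph_radialDiracExt_of_sub {σ γ : ℝ} {x : RadialSpinor × RadialSpinor} {c : ℂ × ℂ}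
    (hc : x - singularPair c ∈ (radialDiracY σ 0).graph)
    (h : (Real.sin γ : ℂ) * c.1 = Real.cos γ * c.2) : x ∈ (radialDiracExt σ γ).graph := by
  refine mem_graph_radialDiracExt.2 ⟨Real.cos γ * c.1 + Real.sin γ * c.2, ?_⟩
  have h1 : (Real.cos γ : ℂ) * Real.cos γ + (Real.sin γ : ℂ) * Real.sin γ = 1 := by
    rw [← Complex.ofReal_mul, ← Complex.ofReal_mul, ← Complex.ofReal_add, ← sq, ← sq,
      Real.cos_sq_add_sin_sq, Complex.ofReal_one]
  have h2 : (Real.cos γ * c.1 + Real.sin γ * c.2) • ((Real.cos γ : ℂ), (Real.sin γ : ℂ)) = c := by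
    refine Prod.ext ?_ ?_
    · simp only [Prod.smul_mk, smul_eq_mul]
      linear_combination c.1 * h1 - (Real.sin γ : ℂ) * h
    · simp only [Prod.smul_mk, smul_eq_mul]
      linear_combination c.2 * h1 + (Real.cos γ : ℂ) * h
  rwa [h2]

lemma radialDiracY_le_radialDiracExt (σ γ : ℝ) : radialDiracY σ 0 ≤ radialDiracExt σ γ :=
  LinearPMap.le_of_le_graph fun x hx => mem_graph_radialDiracExt.2 ⟨0, by
    rw [singularPair_smul, zero_smul, sub_zero]
    exact hx⟩

lemma adjoint_graph_radialDiracExt {σ : ℝ} (hσ0 : 0 < σ) (hσ : σ ≤ 1) (γ : ℝ) :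
    (radialDiracExt σ γ).graph.adjoint = (radialDiracExt σ γ).graph := by
  have hY : (radialDiracY σ 0).graph ≤ (radialDiracExt σ γ).graph :=
    LinearPMap.le_graph_of_le (radialDiracY_le_radialDiracExt σ γ)
  have hd : (radialDirac σ 0).graph ≤ (radialDiracY σ 0).graph := by
    rw [← closure_radialDirac hσ0 hσ 0]
    exact LinearPMap.le_graph_of_le (LinearPMap.le_closure _)
  refine le_antisymm (fun x hx => ?_) fun x hx => mem_adjoint_iff_boundaryForm.2 fun y hy => ?_
  · obtain ⟨c, hc⟩ := exists_sub_singularPair_mem (adjoint_antitone (hd.trans hY) hx)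
    refine mem_graph_radialDiracExt_of_sub hc ?_
    have hs : singularPair ((Real.cos γ : ℂ), (Real.sin γ : ℂ)) ∈ (radialDiracExt σ γ).graph :=
      mem_graph_radialDiracExt.2 ⟨1, by rw [one_smul, sub_self]; exact Submodule.zero_mem _⟩
    have h1 := mem_adjoint_iff_boundaryForm.1 hx _ hs
    rw [← sub_add_cancel x (singularPair c), boundaryForm_add_right,
      boundaryForm_eq_zero_comm.1 (boundaryForm_radialDiracY_singularPair hc _), zero_add,
      boundaryForm_singularPair] at h1
    have h2 := (mul_eq_zero.1 h1).resolve_left (mul_ne_zero two_ne_zero inner_besselK_self_ne_zero)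
    simp only [Complex.conj_ofReal] at h2
    linear_combination h2
  · obtain ⟨a, ha⟩ := mem_graph_radialDiracExt.1 hx
    obtain ⟨b, hb⟩ := mem_graph_radialDiracExt.1 hy
    rw [← sub_add_cancel x (singularPair (a • _)), ← sub_add_cancel y (singularPair (b • _)),
      boundaryForm_add_right, boundaryForm_add_left, boundaryForm_add_left,
      boundaryForm_radialDiracY hb ha, boundaryForm_radialDiracY_singularPair hb,
      boundaryForm_eq_zero_comm.1 (boundaryForm_radialDiracY_singularPair ha _),
      boundaryForm_singularPair]
    simp only [Prod.smul_mk, smul_eq_mul, map_mul, Complex.conj_ofReal]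
    ring

lemma mem_graph_radialDiracY_iff {σ : ℝ} {k : ℤ} {x : RadialSpinor × RadialSpinor} :
    x ∈ (radialDiracY σ k).graph ↔ ∃ φ ψ : regularSpace,
      x = (WithLp.toLp 2 ((φ : RadialL2), (ψ : RadialL2)),
        WithLp.toLp 2 (-(bessel (1 / 2 - k / σ) ψ), bessel (1 / 2 + k / σ) φ)) := by
  rw [LinearPMap.mem_graph_iff]
  constructor
  · rintro ⟨f, h1, h2⟩
    exact ⟨regularFst f, regularSnd f, Prod.ext h1.symm h2.symm⟩
  · rintro ⟨φ, ψ, rfl⟩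
    exact ⟨⟨WithLp.toLp 2 ((φ : RadialL2), (ψ : RadialL2)), φ.2, ψ.2⟩, rfl, rfl⟩

/-- Green's formula for two elements of the maximal domain with boundary values `c` and `d`. -/
lemma boundaryForm_eq_of_boundaryValues {σ : ℝ} {x y : RadialSpinor × RadialSpinor} {c d : ℂ × ℂ}
    (hx : x - singularPair c ∈ (radialDiracY σ 0).graph)
    (hy : y - singularPair d ∈ (radialDiracY σ 0).graph) :
    boundaryForm x y = 2 * inner ℂ besselKHalf besselKHalf *
      ((starRingEnd ℂ) c.2 * d.1 - (starRingEnd ℂ) c.1 * d.2) := by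
  rw [← boundaryForm_singularPair]
  nth_rw 1 [← sub_add_cancel x (singularPair c), ← sub_add_cancel y (singularPair d)]
  rw [boundaryForm_add_right, boundaryForm_add_left, boundaryForm_add_left,
    boundaryForm_radialDiracY hx hy, boundaryForm_radialDiracY_singularPair hx,
    boundaryForm_eq_zero_comm.1 (boundaryForm_radialDiracY_singularPair hy _), add_zero, zero_add,
    zero_add]

/-- A set of pairwise isotropic boundary values lies on a real line `ℂ (cos γ, sin γ)`. -/
lemma exists_angle_of_isotropic {S : Set (ℂ × ℂ)}
    (hS : ∀ c ∈ S, ∀ d ∈ S, (starRingEnd ℂ) c.2 * d.1 = (starRingEnd ℂ) c.1 * d.2) :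
    ∃ γ ∈ Ico 0 (2 * π), ∀ c ∈ S, (Real.sin γ : ℂ) * c.1 = Real.cos γ * c.2 := by
  by_cases h0 : ∀ c ∈ S, c.1 = 0
  · -- all boundary values lie on the axis `c.1 = 0`
    refine ⟨π / 2, ⟨by positivity, by linarith [Real.pi_pos]⟩, fun c hc => ?_⟩
    simp [h0 c hc]
  push Not at h0
  obtain ⟨c, hc, hc1⟩ := h0
  have hcc := hS c hc c hc
  -- isotropy of `c` itself forces the slope `c.2 / c.1` to be real
  have hreal : (starRingEnd ℂ) (c.2 / c.1) = c.2 / c.1 := by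
    have hc1' : (starRingEnd ℂ) c.1 ≠ 0 := (map_ne_zero _).2 hc1
    rw [map_div₀, div_eq_div_iff hc1' hc1, hcc, mul_comm]
  obtain ⟨t, ht⟩ := Complex.conj_eq_iff_real.1 hreal
  have hcos : 0 < Real.cos (Real.arctan t) := Real.cos_arctan_pos t
  have hsin : Real.sin (Real.arctan t) = t * Real.cos (Real.arctan t) := by
    rw [← Real.tan_mul_cos hcos.ne', Real.tan_arctan]
  refine ⟨Real.arctan t + π, ⟨?_, ?_⟩, fun d hd => ?_⟩
  · linarith [Real.neg_pi_div_two_lt_arctan t, Real.pi_pos]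
  · linarith [Real.arctan_lt_pi_div_two t, Real.pi_pos]
  · have h2 : c.2 = t * c.1 := by rw [← ht, div_mul_cancel₀ _ hc1]
    have h3 := hS c hc d hd
    rw [h2, map_mul, Complex.conj_ofReal] at h3
    have h4 : (t : ℂ) * d.1 = d.2 := by
      refine mul_left_cancel₀ ((map_ne_zero (starRingEnd ℂ)).2 hc1) ?_
      linear_combination h3
    rw [Real.sin_add_pi, Real.cos_add_pi, hsin, ← h4]
    push_cast
    ring

lemma singularPair_smul_angle (c : ℂ) (γ : ℝ) :
    singularPair (c • ((Real.cos γ : ℂ), (Real.sin γ : ℂ))) =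
      (c • singularSpinor γ, c • singularImage γ) :=
  singularPair_smul c _

/-! ### Completeness of the angular modes -/

lemma ae_eq_zero_of_forall_integral_fourier {T : ℝ} [Fact (0 < T)] {g : AddCircle T → ℂ}
    (hg : MemLp g 2 volume) (h : ∀ k : ℤ, ∫ x, fourier k x * g x = 0) : g =ᵐ[volume] 0 := by
  have hg' : MemLp g 2 AddCircle.haarAddCircle := hg.haarAddCircle
  have h0 : hg'.toLp g = 0 := by
    refine (fourierBasis (T := T)).repr.map_eq_zero_iff.1 (lp.ext (funext fun k => ?_))
    rw [fourierBasis_repr, fourierCoeff_congr_ae hg'.coeFn_toLp, fourierCoeff,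
      AddCircle.integral_haarAddCircle]
    simp only [smul_eq_mul, h, smul_zero]
    rfl
  have h1 : g =ᵐ[AddCircle.haarAddCircle] 0 :=
    hg'.coeFn_toLp.symm.trans (h0 ▸ Lp.coeFn_zero ℂ 2 _)
  rw [AddCircle.volume_eq_smul_haarAddCircle]
  exact Measure.ae_smul_measure h1 _

section Modes

variable {σ : ℝ} [Fact (0 < σ)]

/-- The angular modes are complete in `L²(X)`. -/
lemma eq_zero_of_forall_inner_scalarMode {f : ConeL2 σ}
    (h : ∀ (k : ℤ) (φ : RadialL2), inner ℂ (scalarMode σ k φ) f = 0) : f = 0 := by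
  have hsq : Integrable (fun p => ‖f p‖ ^ 2) (radialMeasure.prod volume) :=
    (memLp_two_iff_integrable_sq_norm (Lp.aestronglyMeasurable f)).1 (Lp.memLp f)
  have hslice : ∀ᵐ r ∂radialMeasure, MemLp (fun x : ConeCircle σ => f (r, x)) 2 volume := by
    filter_upwards [hsq.prod_right_ae] with r h1
    have hm : StronglyMeasurable fun x : ConeCircle σ => f (r, x) :=
      (Lp.stronglyMeasurable f).comp_measurable measurable_prodMk_left
    exact (memLp_two_iff_integrable_sq_norm hm.aestronglyMeasurable).2 h1
  have hcoef : ∀ k : ℤ, (fun r => ∫ x : ConeCircle σ, fourier k x * f (r, x)) =ᵐ[radialMeasure]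
      0 := by
    intro k
    have hfin : ∀ s, MeasurableSet s → radialMeasure s < (⊤ : ℝ≥0∞) →
        Integrable (fun p : ℝ × ConeCircle σ => fourier k p.2 * f p)
          ((radialMeasure.restrict s).prod volume) := by
      intro s hs hμ
      have : IsFiniteMeasure (radialMeasure.restrict s) := ⟨by simpa using hμ⟩
      have e : (radialMeasure.restrict s).prod (volume : Measure (ConeCircle σ)) =
          (radialMeasure.prod volume).restrict (s ×ˢ univ) := by
        rw [← Measure.prod_restrict, Measure.restrict_univ]
      have h1 : MemLp f 2 ((radialMeasure.restrict s).prod (volume : Measure (ConeCircle σ))) := by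
        rw [e]; exact (Lp.memLp f).restrict _
      have h2 : Integrable f ((radialMeasure.restrict s).prod volume) :=
        h1.integrable (by norm_num)
      have hf : Continuous fun p : ℝ × ConeCircle σ => fourier k p.2 := by fun_prop
      refine h2.bdd_mul (c := 1) hf.aestronglyMeasurable (Eventually.of_forall fun p => ?_)
      rw [fourier_apply, Circle.norm_coe]
    refine ae_eq_zero_of_forall_setIntegral_eq_of_sigmaFinite
      (fun s hs hμ => (hfin s hs hμ).integral_prod_left) fun s hs hμ => ?_
    have hφ : MemLp (s.indicator fun _ => (1 : ℂ)) 2 radialMeasure :=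
      memLp_indicator_const 2 hs 1 (Or.inr hμ.ne)
    have h1 := h k (hφ.toLp _)
    rw [L2.inner_def] at h1
    rw [← integral_prod _ (hfin s hs hμ), ← h1]
    have e : (radialMeasure.restrict s).prod (volume : Measure (ConeCircle σ)) =
        (coneMeasure σ).restrict (s ×ˢ univ) := by
      rw [coneMeasure, ← Measure.prod_restrict, Measure.restrict_univ]
    rw [e, ← integral_indicator (hs.prod MeasurableSet.univ)]
    refine integral_congr_ae ?_
    filter_upwards [(memLp_mode σ k (hφ.toLp _)).coeFn_toLp, ae_comp_fst σ hφ.coeFn_toLp]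
      with p h1 h2
    have h3 : scalarMode σ k (hφ.toLp _) p = (s.indicator fun _ => (1 : ℂ)) p.1 *
        fourier (-k) p.2 := by
      rw [← h2]; exact h1
    rw [RCLike.inner_apply, h3]
    by_cases hp : p.1 ∈ s
    · rw [indicator_of_mem (show p ∈ s ×ˢ univ from ⟨hp, trivial⟩), indicator_of_mem hp, one_mul,
        ← fourier_neg, neg_neg, mul_comm]
    · rw [indicator_of_notMem (fun h => hp h.1), indicator_of_notMem hp]
      simp
  have hae : ∀ᵐ r ∂radialMeasure, ∀ᵐ x ∂(volume : Measure (ConeCircle σ)), f (r, x) = 0 := by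
    filter_upwards [hslice, ae_all_iff.2 hcoef] with r h1 h2
    exact ae_eq_zero_of_forall_integral_fourier h1 h2
  have hmeas : MeasurableSet {p : ℝ × ConeCircle σ | f p = 0} :=
    (Lp.stronglyMeasurable f).measurable (measurableSet_singleton 0)
  have h1 : f =ᵐ[radialMeasure.prod volume] 0 := (Measure.ae_prod_iff_ae_ae hmeas).2 hae
  exact Lp.ext (h1.trans (Lp.coeFn_zero ℂ 2 (coneMeasure σ)).symm)

lemma mode_fst (k : ℤ) (f : RadialSpinor) : (mode σ k f).fst = scalarMode σ k f.fst := rfl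

lemma mode_snd (k : ℤ) (f : RadialSpinor) : (mode σ k f).snd = scalarMode σ k f.snd := rfl

lemma eq_zero_of_forall_inner_mode {f : ConeSpinor σ}
    (h : ∀ (k : ℤ) (a : RadialSpinor), inner ℂ (mode σ k a) f = 0) : f = 0 := by
  refine spinor_ext (eq_zero_of_forall_inner_scalarMode fun k φ => ?_)
    (eq_zero_of_forall_inner_scalarMode fun k φ => ?_)
  · simpa [inner_spinor, mode_fst, mode_snd] using h k (WithLp.toLp 2 (φ, 0))
  · simpa [inner_spinor, mode_fst, mode_snd] using h k (WithLp.toLp 2 (0, φ))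

lemma circumference_ne_zero : ((2 * π * σ : ℝ) : ℂ) ≠ 0 :=
  Complex.ofReal_ne_zero.2 (Fact.out (p := 0 < 2 * π * σ)).ne'

lemma norm_mode_sq (k : ℤ) (f : RadialSpinor) : ‖mode σ k f‖ ^ 2 = 2 * π * σ * ‖f‖ ^ 2 := by
  have h := inner_mode σ k k f f
  rw [if_pos rfl, inner_self_eq_norm_sq_to_K, inner_self_eq_norm_sq_to_K] at h
  refine Complex.ofReal_injective ?_
  push_cast at h ⊢
  exact h

/-- The isometric embedding of `L²(r dr)²` as the `k`-th mode, normalized by the circumference. -/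
noncomputable def normalizedMode (σ : ℝ) [Fact (0 < σ)] (k : ℤ) :
    RadialSpinor →ₗᵢ[ℂ] ConeSpinor σ where
  toLinearMap := ((√(2 * π * σ))⁻¹ : ℂ) • mode σ k
  norm_map' f := by
    have hT : 0 < 2 * π * σ := Fact.out
    have h : ‖mode σ k f‖ = √(2 * π * σ) * ‖f‖ := by
      rw [← Real.sqrt_sq (norm_nonneg (mode σ k f)), norm_mode_sq, Real.sqrt_mul hT.le,
        Real.sqrt_sq (norm_nonneg f)]
    rw [LinearMap.smul_apply, norm_smul, norm_inv, Complex.norm_real,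
      Real.norm_of_nonneg (Real.sqrt_nonneg _), h, inv_mul_cancel_left₀ (Real.sqrt_pos.2 hT).ne']

lemma normalizedMode_apply (k : ℤ) (f : RadialSpinor) :
    normalizedMode σ k f = ((√(2 * π * σ))⁻¹ : ℂ) • mode σ k f := rfl

lemma isHilbertSum_normalizedMode :
    IsHilbertSum ℂ (fun _ : ℤ => RadialSpinor) (normalizedMode σ) := by
  refine IsHilbertSum.mk (fun j k hjk a b => ?_) ?_
  · rw [normalizedMode_apply, normalizedMode_apply, inner_smul_left, inner_smul_right, inner_mode,
      if_neg hjk, mul_zero, mul_zero]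
  · rw [top_le_iff, Submodule.topologicalClosure_eq_top_iff, Submodule.eq_bot_iff]
    refine fun f hf => eq_zero_of_forall_inner_mode fun k a => ?_
    have h1 : normalizedMode σ k a ∈ ⨆ k, LinearMap.range (normalizedMode σ k).toLinearMap :=
      Submodule.mem_iSup_of_mem k ⟨a, rfl⟩
    have h2 := (Submodule.mem_orthogonal _ f).1 hf _ h1
    rw [normalizedMode_apply, inner_smul_left] at h2
    refine (mul_eq_zero.1 h2).resolve_left ?_
    have hT : 0 < 2 * π * σ := Fact.out
    exact fun h => inv_ne_zero (Complex.ofReal_ne_zero.2 (Real.sqrt_pos.2 hT).ne')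
      ((map_eq_zero (starRingEnd ℂ)).1 h)

lemma exists_hasSum_mode (f : ConeSpinor σ) :
    ∃ a : ℤ → RadialSpinor, HasSum (fun k => mode σ k (a k)) f := by
  have hV := isHilbertSum_normalizedMode (σ := σ)
  have h := hV.hasSum_linearIsometryEquiv_symm (hV.linearIsometryEquiv f)
  rw [LinearIsometryEquiv.symm_apply_apply] at h
  refine ⟨fun k => ((√(2 * π * σ))⁻¹ : ℂ) • hV.linearIsometryEquiv f k, ?_⟩
  simpa only [normalizedMode_apply, ← map_smul] using h

lemma inner_mode_of_hasSum {a : ℤ → RadialSpinor} {f : ConeSpinor σ}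
    (h : HasSum (fun k => mode σ k (a k)) f) (k : ℤ) (b : RadialSpinor) :
    inner ℂ (mode σ k b) f = (2 * π * σ : ℝ) * inner ℂ b (a k) := by
  have h1 := ContinuousLinearMap.hasSum (innerSL ℂ (mode σ k b)) h
  have h2 : ∀ j, innerSL ℂ (mode σ k b) (mode σ j (a j)) =
      if j = k then (2 * π * σ : ℝ) * inner ℂ b (a k) else 0 := fun j => by
    rw [innerSL_apply_apply, inner_mode]
    by_cases hj : k = j
    · subst hj; simp
    · rw [if_neg hj, if_neg (Ne.symm hj)]
  simp only [h2] at h1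
  exact h1.unique (hasSum_ite_eq k _)

lemma hasSum_inner_of_hasSum_mode {a b : ℤ → RadialSpinor} {f g : ConeSpinor σ}
    (hf : HasSum (fun k => mode σ k (a k)) f) (hg : HasSum (fun k => mode σ k (b k)) g) :
    HasSum (fun k => ((2 * π * σ : ℝ) : ℂ) * inner ℂ (a k) (b k)) (inner ℂ f g) := by
  have h1 := ContinuousLinearMap.hasSum (innerSL ℂ f) hg
  have h2 : ∀ k, innerSL ℂ f (mode σ k (b k)) =
      ((2 * π * σ : ℝ) : ℂ) * inner ℂ (a k) (b k) := fun k => by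
    rw [innerSL_apply_apply, ← inner_conj_symm, inner_mode_of_hasSum hf, map_mul,
      Complex.conj_ofReal, inner_conj_symm]
  have h3 : (fun k => innerSL ℂ f (mode σ k (b k))) = _ := funext h2
  rw [h3] at h1
  exact h1

lemma hasSum_boundaryForm {a b a' b' : ℤ → RadialSpinor} {f g f' g' : ConeSpinor σ}
    (hf : HasSum (fun k => mode σ k (a k)) f) (hg : HasSum (fun k => mode σ k (b k)) g)
    (hf' : HasSum (fun k => mode σ k (a' k)) f') (hg' : HasSum (fun k => mode σ k (b' k)) g') :
    HasSum (fun k => ((2 * π * σ : ℝ) : ℂ) * boundaryForm (a k, b k) (a' k, b' k))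
      (boundaryForm (f, g) (f', g')) := by
  have h := (hasSum_inner_of_hasSum_mode hg hf').sub (hasSum_inner_of_hasSum_mode hf hg')
  have h1 : (fun k => ((2 * π * σ : ℝ) : ℂ) * inner ℂ (b k) (a' k) -
      ((2 * π * σ : ℝ) : ℂ) * inner ℂ (a k) (b' k)) =
      fun k => ((2 * π * σ : ℝ) : ℂ) * boundaryForm (a k, b k) (a' k, b' k) :=
    funext fun k => (mul_sub _ _ _).symm
  rw [h1] at h
  exact h

/-! ### Orthogonal sums of self-adjoint operators -/

lemma mode_mem_modeSumGraph {A : ℤ → RadialSpinor →ₗ.[ℂ] RadialSpinor} {k : ℤ}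
    {x : RadialSpinor × RadialSpinor} (hx : x ∈ (A k).graph) :
    (mode σ k x.1, mode σ k x.2) ∈ modeSumGraph σ A := by
  classical
  refine ⟨fun j => if j = k then x.1 else 0, fun j => if j = k then x.2 else 0, fun j => ?_, ?_, ?_⟩
  · by_cases hj : j = k
    · subst hj; simpa using hx
    · simp only [if_neg hj]; exact (A j).graph.zero_mem
  · have e : (fun j => mode σ j (if j = k then x.1 else 0)) = fun j => if j = k then
        mode σ k x.1 else 0 := funext fun j => by
      by_cases hj : j = k
      · subst hj; simp
      · simp [hj]
    rw [e]
    exact hasSum_ite_eq k _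
  · have e : (fun j => mode σ j (if j = k then x.2 else 0)) = fun j => if j = k then
        mode σ k x.2 else 0 := funext fun j => by
      by_cases hj : j = k
      · subst hj; simp
      · simp [hj]
    rw [e]
    exact hasSum_ite_eq k _

lemma boundaryForm_mode {x : RadialSpinor × RadialSpinor} {k : ℤ} {a b : ℤ → RadialSpinor}
    {f g : ConeSpinor σ} (hf : HasSum (fun k => mode σ k (a k)) f)
    (hg : HasSum (fun k => mode σ k (b k)) g) :
    boundaryForm (mode σ k x.1, mode σ k x.2) (f, g) =
      (2 * π * σ : ℝ) * boundaryForm x (a k, b k) := by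
  simp only [boundaryForm]
  rw [inner_mode_of_hasSum hf, inner_mode_of_hasSum hg]
  ring

lemma adjoint_modeSumGraph {A : ℤ → RadialSpinor →ₗ.[ℂ] RadialSpinor}
    (hA : ∀ k, (A k).graph.adjoint = (A k).graph) :
    (modeSumGraph σ A).adjoint = modeSumGraph σ A := by
  refine le_antisymm ?_ ?_
  · rintro ⟨f, g⟩ hfg
    obtain ⟨a, ha⟩ := exists_hasSum_mode f
    obtain ⟨b, hb⟩ := exists_hasSum_mode g
    refine ⟨a, b, fun k => ?_, ha, hb⟩
    rw [← hA k, mem_adjoint_iff_boundaryForm]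
    intro x hx
    have h1 := mem_adjoint_iff_boundaryForm.1 hfg _ (mode_mem_modeSumGraph hx)
    rw [boundaryForm_mode ha hb] at h1
    exact (mul_eq_zero.1 h1).resolve_left circumference_ne_zero
  · rintro ⟨f, g⟩ ⟨a, b, hab, ha, hb⟩
    refine mem_adjoint_iff_boundaryForm.2 ?_
    rintro ⟨f', g'⟩ ⟨a', b', hab', ha', hb'⟩
    have h := hasSum_boundaryForm ha' hb' ha hb
    have h0 : ∀ k, boundaryForm (a' k, b' k) (a k, b k) = 0 := fun k => by
      have h1 := hab k
      rw [← hA k, mem_adjoint_iff_boundaryForm] at h1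
      exact h1 _ (hab' k)
    simp only [h0, mul_zero] at h
    exact h.unique hasSum_zero

lemma dense_domain_of_graph {E : Type*} [NormedAddCommGroup E] [InnerProductSpace ℂ E]
    [CompleteSpace E] {A : E →ₗ.[ℂ] E} (h : ∀ y, (∀ p ∈ A.graph, inner ℂ p.1 y = 0) → y = 0) :
    Dense (A.domain : Set E) :=
  dense_of_forall_inner_eq_zero fun y hy =>
    h y fun _ hp => hy _ (LinearPMap.mem_domain_of_mem_graph hp)

lemma dense_domain_modeSum {A : ℤ → RadialSpinor →ₗ.[ℂ] RadialSpinor}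
    (hA : ∀ k, Dense ((A k).domain : Set RadialSpinor)) :
    Dense ((modeSum σ A).domain : Set (ConeSpinor σ)) := by
  refine dense_domain_of_graph fun f hf => ?_
  rw [modeSum_graph] at hf
  obtain ⟨a, ha⟩ := exists_hasSum_mode f
  have h0 : ∀ k, a k = 0 := fun k => by
    refine (hA k).eq_zero_of_inner_right ℂ fun x hx => ?_
    obtain ⟨y, hy⟩ := LinearPMap.mem_domain_iff.1 hx
    have h2 := hf _ (mode_mem_modeSumGraph hy)
    rw [inner_mode_of_hasSum ha] at h2
    exact (mul_eq_zero.1 h2).resolve_left circumference_ne_zero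
  simp only [h0, map_zero] at ha
  exact ha.unique hasSum_zero

lemma isSelfAdjoint_modeSum {A : ℤ → RadialSpinor →ₗ.[ℂ] RadialSpinor}
    (hd : ∀ k, Dense ((A k).domain : Set RadialSpinor))
    (hA : ∀ k, (A k).graph.adjoint = (A k).graph) : IsSelfAdjoint (modeSum σ A) := by
  rw [isSelfAdjoint_iff_graph (dense_domain_modeSum hd), modeSum_graph, adjoint_modeSumGraph hA]

end Modes

/-! ### Symmetry of the Dirac operator -/

section Cone

variable {σ : ℝ}

lemma conj_mul_mem_coneTest {v w : ℝ × ConeCircle σ → ℂ} (hv : v ∈ coneTest σ)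
    (hw : w ∈ coneTest σ) : (fun p => (starRingEnd ℂ) (v p) * w p) ∈ coneTest σ :=
  ⟨(Complex.conjCLE.contDiff.comp hv.1).mul hw.1, hw.2.1.mul_left,
    (closure_mono fun _ hp => right_ne_zero_of_mul hp).trans hw.2.2⟩

lemma slice_mem_radialTest {u : ℝ × ConeCircle σ → ℂ} (hu : u ∈ coneTest σ) (x : ConeCircle σ) :
    (fun r => u (r, x)) ∈ radialTest := by
  have hs : tsupport (fun r => u (r, x)) ⊆ (fun r : ℝ => (r, x)) ⁻¹' tsupport u :=
    closure_minimal (fun r hr => subset_tsupport u hr)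
      ((isClosed_tsupport u).preimage (by fun_prop))
  refine ⟨?_, ?_, fun r hr => (hu.2.2 (hs hr)).1⟩
  · obtain ⟨t, rfl⟩ := QuotientAddGroup.mk_surjective x
    exact hu.1.comp (contDiff_id.prodMk contDiff_const)
  · refine (hu.2.1.isCompact.image continuous_fst).of_isClosed_subset (isClosed_tsupport _) ?_
    exact fun r hr => ⟨(r, x), hs hr, rfl⟩

lemma partialRadius_eq_zero {u : ℝ × ConeCircle σ → ℂ} {p : ℝ × ConeCircle σ}
    (hp : p ∉ tsupport u) : partialRadius u p = 0 := by
  have h1 : (fun s : ℝ => u (s, p.2)) =ᶠ[𝓝 p.1] fun _ => 0 :=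
    (Continuous.tendsto (f := fun s : ℝ => (s, p.2)) (by fun_prop) p.1).eventually
      (notMem_tsupport_iff_eventuallyEq.1 hp)
  rw [partialRadius, h1.deriv_eq, deriv_const]

lemma partialAngle_eq_zero {u : ℝ × ConeCircle σ → ℂ} {p : ℝ × ConeCircle σ}
    (hp : p ∉ tsupport u) : partialAngle u p = 0 := by
  have hc : Continuous fun t : ℝ => (p.1, p.2 + (t : ConeCircle σ)) :=
    continuous_const.prodMk (continuous_const.add (AddCircle.continuous_mk' _))
  have ht := hc.tendsto 0
  rw [AddCircle.coe_zero, add_zero] at ht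
  have h1 : (fun t : ℝ => u (p.1, p.2 + (t : ConeCircle σ))) =ᶠ[𝓝 0] fun _ => 0 :=
    ht.eventually (notMem_tsupport_iff_eventuallyEq.1 hp)
  rw [partialAngle, h1.deriv_eq, deriv_const]

lemma integral_deriv_radialTest {w : ℝ → ℂ} (hw : w ∈ radialTest) :
    ∫ r in Ioi 0, deriv w r = 0 := by
  rw [setIntegral_eq_integral_of_forall_compl_eq_zero fun r hr =>
    image_eq_zero_of_notMem_tsupport fun h => hr (hw.2.2
      (closure_minimal support_deriv_subset (isClosed_tsupport w) h))]
  exact integral_eq_zero_of_hasDerivAt_of_integrable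
    (fun r => (hw.1.differentiable (by simp) r).hasDerivAt)
    ((hw.1.continuous_deriv (by simp)).integrable_of_hasCompactSupport hw.2.1.deriv)
    (hw.1.continuous.integrable_of_hasCompactSupport hw.2.1)

lemma exists_pos_forall_coneTest_eq_zero {u : ℝ × ConeCircle σ → ℂ} (hu : u ∈ coneTest σ) :
    ∃ δ > 0, ∀ p : ℝ × ConeCircle σ, p.1 < δ → u p = 0 := by
  have hK : IsCompact (Prod.fst '' tsupport u) := hu.2.1.isCompact.image continuous_fst
  have hn : (Prod.fst '' tsupport u)ᶜ ∈ 𝓝 (0 : ℝ) := by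
    refine hK.isClosed.isOpen_compl.mem_nhds ?_
    rintro ⟨p, hp, hp0⟩
    exact (hu.2.2 hp).1.ne' hp0
  obtain ⟨δ, hδ, hb⟩ := Metric.mem_nhds_iff.1 hn
  refine ⟨δ, hδ, fun p hp => by_contra fun hne => ?_⟩
  have h1 := subset_tsupport u hne
  have h2 : 0 < p.1 := (hu.2.2 h1).1
  exact hb (by simpa [abs_of_pos h2] using hp : p.1 ∈ Metric.ball 0 δ) ⟨p, h1, rfl⟩

variable [Fact (0 < σ)]

lemma integral_partialAngle {u : ℝ × ConeCircle σ → ℂ} (hu : u ∈ coneTest σ) (r : ℝ) :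
    ∫ x : ConeCircle σ, partialAngle u (r, x) = 0 := by
  have hd : ∀ t : ℝ, HasDerivAt (fun s : ℝ => u (r, (s : ConeCircle σ)))
      (partialAngle u (r, (t : ConeCircle σ))) t := fun t => by
    have h := (hasDerivAt_angle hu r t).differentiableAt.hasDerivAt
    have h1 : HasDerivAt (fun s : ℝ => s - t) 1 t := (hasDerivAt_id t).sub_const t
    have h2 : HasDerivAt (fun s : ℝ => u (r, (t : ConeCircle σ) + (s : ConeCircle σ)))
        (partialAngle u (r, (t : ConeCircle σ))) (t - t) := by rw [sub_self]; exact h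
    replace h2 := HasDerivAt.scomp (h := fun s : ℝ => s - t) t h2 h1
    rw [one_smul] at h2
    refine h2.congr_of_eventuallyEq (Eventually.of_forall fun s => ?_)
    simp only [Function.comp_apply, ← AddCircle.coe_add, add_sub_cancel]
  have hc : Continuous fun t : ℝ => partialAngle u (r, (t : ConeCircle σ)) :=
    (continuous_partialAngle hu).comp (continuous_const.prodMk (AddCircle.continuous_mk' _))
  rw [← AddCircle.intervalIntegral_preimage (2 * π * σ) 0 fun x => partialAngle u (r, x),
    intervalIntegral.integral_eq_sub_of_hasDerivAt (fun t _ => hd t) (hc.intervalIntegrable _ _),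
    zero_add, AddCircle.coe_period, AddCircle.coe_zero, sub_self]

/-- The divergence `r⁻¹ (ε ∂_r (r W) - i ∂_θ W)` of a test function has mean zero over the cone. -/
lemma integral_divergence {W : ℝ × ConeCircle σ → ℂ} (hW : W ∈ coneTest σ) (ε : ℝ) :
    ∫ p, (ε * (partialRadius W p + (1 / p.1 : ℝ) * W p) -
      (1 / p.1 : ℝ) * (Complex.I * partialAngle W p)) ∂(coneMeasure σ) = 0 := by
  have hint : ∀ {a : ℝ → ℂ} {h : ℝ × ConeCircle σ → ℂ}, ContinuousOn a (Ioi 0) →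
      Continuous h → (∀ p, p ∉ tsupport W → h p = 0) →
      Integrable (fun p => a p.1 * h p) (coneMeasure σ) := by
    intro a h ha hh h0
    have hs : tsupport (fun p => a p.1 * h p) ⊆ tsupport W :=
      closure_minimal (fun p hp => by_contra fun hW => right_ne_zero_of_mul hp (h0 p hW))
        (isClosed_tsupport W)
    refine Continuous.integrable_of_hasCompactSupport ?_
      (hW.2.1.of_isClosed_subset (isClosed_tsupport _) hs)
    refine ContinuousOn.continuous_of_tsupport_subset ?_ (isOpen_Ioi.prod isOpen_univ)
      (hs.trans hW.2.2)
    exact (ha.comp continuousOn_fst fun p hp => hp.1).mul hh.continuousOn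
  have hinv : ContinuousOn (fun r : ℝ => ((1 / r : ℝ) : ℂ)) (Ioi 0) :=
    Complex.continuous_ofReal.comp_continuousOn
      (continuousOn_const.div continuousOn_id fun r hr => ne_of_gt hr)
  have i1 : Integrable (partialRadius W) (coneMeasure σ) := by
    simpa using hint (a := fun _ => 1) continuousOn_const (continuous_partialRadius hW)
      fun p hp => partialRadius_eq_zero hp
  have i2 := hint hinv (continuous_coneTest hW) fun p hp => image_eq_zero_of_notMem_tsupport hp
  have i3 := hint hinv (continuous_partialAngle hW) fun p hp => partialAngle_eq_zero hp
  have z1 : ∫ p, (partialRadius W p + (1 / p.1 : ℝ) * W p) ∂(coneMeasure σ) = 0 := by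
    rw [coneMeasure, integral_prod_symm (fun p => partialRadius W p + (1 / p.1 : ℝ) * W p)
      (i1.add i2)]
    refine integral_eq_zero_of_ae (Eventually.of_forall fun x => ?_)
    have hx := slice_mem_radialTest hW x
    have hr := smul_mem_radialTest (a := fun r : ℝ => (r : ℂ))
      Complex.ofRealCLM.contDiff.contDiffOn hx
    change ∫ r, (partialRadius W (r, x) + (1 / r : ℝ) * W (r, x)) ∂radialMeasure = 0
    rw [integral_radialMeasure, ← integral_deriv_radialTest hr]
    refine setIntegral_congr_fun measurableSet_Ioi fun r hr0 => ?_
    have hne : (r : ℂ) ≠ 0 := by exact_mod_cast ne_of_gt hr0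
    have hd := ((hasDerivAt_id r).ofReal_comp.mul
      (hx.1.differentiable (by simp) r).hasDerivAt).deriv
    have hd' : deriv (fun r : ℝ => (r : ℂ) * W (r, x)) r =
      ((1 : ℝ) : ℂ) * W (r, x) + (r : ℂ) * deriv (fun r => W (r, x)) r := hd
    simp only [hd', partialRadius]
    push_cast
    field_simp
    ring
  have z2 : ∫ p, ((1 / p.1 : ℝ) : ℂ) * partialAngle W p ∂(coneMeasure σ) = 0 := by
    rw [coneMeasure, integral_prod _ i3]
    refine integral_eq_zero_of_ae (Eventually.of_forall fun r => ?_)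
    change ∫ x, ((1 / r : ℝ) : ℂ) * partialAngle W (r, x) = 0
    rw [integral_const_mul, integral_partialAngle hW, mul_zero]
  have e : ∀ p : ℝ × ConeCircle σ, ((1 / p.1 : ℝ) : ℂ) * (Complex.I * partialAngle W p) =
      Complex.I * (((1 / p.1 : ℝ) : ℂ) * partialAngle W p) := fun p => by ring
  simp only [e]
  rw [integral_sub (f := fun p => (ε : ℂ) * (partialRadius W p + (1 / p.1 : ℝ) * W p))
    ((i1.add i2).const_mul (ε : ℂ)) (i3.const_mul _), integral_const_mul,
    integral_const_mul, z1, z2, mul_zero, mul_zero, sub_zero]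

lemma coneTestToL2_ae (u : coneTest σ) : coneTestToL2 σ u =ᵐ[coneMeasure σ] u.1 :=
  (memLp_coneTest u.2).coeFn_toLp

lemma coneTestExpr_ae (ε : ℝ) (u : coneTest σ) :
    coneTestExpr σ ε u =ᵐ[coneMeasure σ] coneExpr ε u.1 :=
  (memLp_coneExpr ε u.2).coeFn_toLp

/-- Integration by parts on the cone. -/
lemma inner_coneTestExpr (ε : ℝ) (v w : coneTest σ) :
    inner ℂ (coneTestExpr σ ε v) (coneTestToL2 σ w) =
      inner ℂ (coneTestToL2 σ v) (coneTestExpr σ (-ε) w) := by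
  rw [← sub_eq_zero, L2.inner_def, L2.inner_def, ← integral_sub (L2.integrable_inner _ _)
    (L2.integrable_inner _ _), ← integral_divergence (conj_mul_mem_coneTest v.2 w.2) ε]
  refine integral_congr_ae ?_
  filter_upwards [coneTestExpr_ae ε v, coneTestExpr_ae (-ε) w, coneTestToL2_ae v,
    coneTestToL2_ae w] with p h1 h2 h3 h4
  have hR : partialRadius (fun p => (starRingEnd ℂ) (v.1 p) * w.1 p) p =
      (starRingEnd ℂ) (partialRadius v.1 p) * w.1 p +
        (starRingEnd ℂ) (v.1 p) * partialRadius w.1 p :=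
    (((Complex.conjCLE : ℂ →L[ℝ] ℂ).hasFDerivAt.comp_hasDerivAt p.1
      (differentiableAt_radius v.2 p).hasDerivAt).mul
        (differentiableAt_radius w.2 p).hasDerivAt).deriv
  have hA : partialAngle (fun p => (starRingEnd ℂ) (v.1 p) * w.1 p) p =
      (starRingEnd ℂ) (partialAngle v.1 p) * w.1 p +
        (starRingEnd ℂ) (v.1 p) * partialAngle w.1 p := by
    have h := (((Complex.conjCLE : ℂ →L[ℝ] ℂ).hasFDerivAt.comp_hasDerivAt (0 : ℝ)
      (differentiableAt_angle v.2 p).hasDerivAt).mul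
        (differentiableAt_angle w.2 p).hasDerivAt).deriv
    refine h.trans ?_
    simp only [Function.comp_apply, AddCircle.coe_zero, add_zero]
    rfl
  simp only [h1, h2, h3, h4, hR, hA,
    RCLike.inner_apply, coneExpr, map_add, map_mul, Complex.conj_ofReal, Complex.conj_I]
  push_cast
  ring

lemma mem_graph_dirac {x : ConeSpinor σ × ConeSpinor σ} :
    x ∈ (dirac σ).graph ↔ ∃ u v : coneTest σ,
      x = (WithLp.toLp 2 (coneTestToL2 σ u, coneTestToL2 σ v),
        WithLp.toLp 2 (coneTestExpr σ (-1) v, coneTestExpr σ 1 u)) := by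
  rw [dirac, mem_graph_ofInjective]
  exact ⟨fun ⟨w, h⟩ => ⟨w.1, w.2, h⟩, fun ⟨u, v, h⟩ => ⟨(u, v), h⟩⟩

/-- The Dirac operator is symmetric. -/
lemma dirac_graph_le_adjoint : (dirac σ).graph ≤ (dirac σ).graph.adjoint := by
  intro y hy
  obtain ⟨u', v', rfl⟩ := mem_graph_dirac.1 hy
  refine mem_adjoint_iff_boundaryForm.2 fun x hx => ?_
  obtain ⟨u, v, rfl⟩ := mem_graph_dirac.1 hx
  have h1 := inner_coneTestExpr (-1) v u'
  have h2 := inner_coneTestExpr 1 u v'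
  rw [neg_neg] at h1
  rw [boundaryForm, inner_spinor, inner_spinor]
  simp only [WithLp.toLp_fst, WithLp.toLp_snd, h1, h2]
  ring

/-! ### The Dirac operator on the angular modes -/

lemma mode_mem_coneTest {u : ℝ → ℂ} (hu : u ∈ radialTest) (k : ℤ) :
    (fun p : ℝ × ConeCircle σ => u p.1 * fourier (-k) p.2) ∈ coneTest σ := by
  have hs : tsupport (fun p : ℝ × ConeCircle σ => u p.1 * fourier (-k) p.2) ⊆
      tsupport u ×ˢ univ :=
    closure_minimal (fun p hp => ⟨subset_tsupport u (left_ne_zero_of_mul hp), trivial⟩)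
      ((isClosed_tsupport u).prod isClosed_univ)
  refine ⟨?_, (hu.2.1.isCompact.prod isCompact_univ).of_isClosed_subset (isClosed_tsupport _) hs,
    hs.trans (prod_mono hu.2.2 Subset.rfl)⟩
  simp only [fourier_coe_apply]
  refine (hu.1.comp contDiff_fst).mul (Complex.contDiff_exp.comp ?_)
  exact (contDiff_const.mul (Complex.ofRealCLM.contDiff.comp contDiff_snd)).div_const _

/-- The test function `u(r) e^{-ikθ/σ}`. -/
noncomputable def modeTest (σ : ℝ) [Fact (0 < σ)] (k : ℤ) (u : radialTest) : coneTest σ :=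
  ⟨_, mode_mem_coneTest u.2 k⟩

lemma scalarMode_ae (k : ℤ) {f : RadialL2} {F : ℝ → ℂ} (h : f =ᵐ[radialMeasure] F) :
    scalarMode σ k f =ᵐ[coneMeasure σ] fun p => F p.1 * fourier (-k) p.2 := by
  filter_upwards [(memLp_mode σ k f).coeFn_toLp, ae_comp_fst σ h] with p h1 h2
  rw [← h2]
  exact h1

lemma scalarMode_testToL2 (k : ℤ) (u : radialTest) :
    scalarMode σ k (testToL2 u) = coneTestToL2 σ (modeTest σ k u) :=
  Lp.ext ((scalarMode_ae k (memLp_of_radialTest u.2).coeFn_toLp).trans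
    (coneTestToL2_ae (modeTest σ k u)).symm)

lemma coneExpr_modeTest (k : ℤ) (u : radialTest) (ε : ℝ) (p : ℝ × ConeCircle σ) :
    coneExpr ε (modeTest σ k u).1 p =
      (ε * besselExpr (1 / 2) u.1 p.1 + ((k / σ / p.1 : ℝ) : ℂ) * u.1 p.1) *
        fourier (-k) p.2 := by
  have hR : partialRadius (modeTest σ k u).1 p = deriv u.1 p.1 * fourier (-k) p.2 :=
    ((u.2.1.differentiable (by simp) p.1).hasDerivAt.mul_const (fourier (-k) p.2)).deriv
  have hA : partialAngle (modeTest σ k u).1 p =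
      u.1 p.1 * (-(Complex.I * (k / σ : ℝ)) * fourier (-k) p.2) := by
    obtain ⟨r, x⟩ := p
    obtain ⟨t, rfl⟩ := QuotientAddGroup.mk_surjective x
    have h := hasDerivAt_fourier (2 * π * σ) (-k) (t + 0)
    have h1 : HasDerivAt (fun s : ℝ => t + s) 1 0 := (hasDerivAt_id (0 : ℝ)).const_add t
    have h2 := ((HasDerivAt.scomp (0 : ℝ) h h1).const_mul (u.1 r)).deriv
    rw [one_smul, add_zero] at h2
    refine h2.trans ?_
    have hσ : (σ : ℂ) ≠ 0 := Complex.ofReal_ne_zero.2 (Fact.out (p := 0 < σ)).ne'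
    have hπ : (π : ℂ) ≠ 0 := Complex.ofReal_ne_zero.2 Real.pi_ne_zero
    have h3 : 2 * π * Complex.I * ((-k : ℤ) : ℂ) / ((2 * π * σ : ℝ) : ℂ) =
        -(Complex.I * (k / σ : ℝ)) := by
      push_cast
      field_simp
    rw [h3]
  rw [coneExpr, hR, hA, besselExpr]
  change _ * (_ + _ * (u.1 p.1 * fourier (-k) p.2)) + _ = _
  have e1 : ((1 / (2 * p.1) : ℝ) : ℂ) = ((1 / 2 / p.1 : ℝ) : ℂ) := by rw [div_div]
  have e2 : ((k / σ / p.1 : ℝ) : ℂ) = (k / σ : ℝ) * (1 / p.1 : ℝ) := by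
    rw [← Complex.ofReal_mul, mul_one_div]
  rw [e1, e2]
  linear_combination (-(u.1 p.1 * (k / σ : ℝ) * fourier (-k) p.2 * (1 / p.1 : ℝ))) * Complex.I_sq

lemma scalarMode_testBessel (k : ℤ) (u : radialTest) :
    scalarMode σ k (testBessel (1 / 2 + k / σ) u) = coneTestExpr σ 1 (modeTest σ k u) := by
  refine Lp.ext ((scalarMode_ae k (memLp_besselExpr _ u.2).coeFn_toLp).trans
    (EventuallyEq.trans (Eventually.of_forall fun p => ?_)
      (coneTestExpr_ae 1 (modeTest σ k u)).symm))
  simp only [coneExpr_modeTest, besselExpr, add_div]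
  push_cast
  ring

lemma scalarMode_neg_testBessel (k : ℤ) (u : radialTest) :
    scalarMode σ k (-testBessel (1 / 2 - k / σ) u) = coneTestExpr σ (-1) (modeTest σ k u) := by
  have h : (-testBessel (1 / 2 - k / σ) u : RadialL2) =ᵐ[radialMeasure]
      fun r => -besselExpr (1 / 2 - k / σ) u.1 r :=
    (Lp.coeFn_neg _).trans (memLp_besselExpr _ u.2).coeFn_toLp.neg
  refine Lp.ext ((scalarMode_ae k h).trans (EventuallyEq.trans (Eventually.of_forall fun p => ?_)
      (coneTestExpr_ae (-1) (modeTest σ k u)).symm))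
  simp only [coneExpr_modeTest, besselExpr, sub_div]
  push_cast
  ring

/-- On the `k`-th mode the Dirac operator acts as `d_k`. -/
lemma mode_mem_graph_dirac {k : ℤ} {x : RadialSpinor × RadialSpinor}
    (hx : x ∈ (radialDirac σ k).graph) : (mode σ k x.1, mode σ k x.2) ∈ (dirac σ).graph := by
  obtain ⟨u, v, rfl⟩ := mem_graph_radialDirac.1 hx
  refine mem_graph_dirac.2 ⟨modeTest σ k u, modeTest σ k v, Prod.ext ?_ ?_⟩
  · exact spinor_ext (scalarMode_testToL2 k u) (scalarMode_testToL2 k v)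
  · exact spinor_ext (scalarMode_neg_testBessel k v) (scalarMode_testBessel k u)

/-- The components of an element of the adjoint of the Dirac operator lie in the adjoints of the
radial operators. -/
lemma component_mem_adjoint {f g : ConeSpinor σ} (h : (f, g) ∈ (dirac σ).graph.adjoint)
    {a b : ℤ → RadialSpinor} (ha : HasSum (fun k => mode σ k (a k)) f)
    (hb : HasSum (fun k => mode σ k (b k)) g) (k : ℤ) :
    (a k, b k) ∈ (radialDirac σ k).graph.adjoint := by
  refine mem_adjoint_iff_boundaryForm.2 fun x hx => ?_
  have h1 := mem_adjoint_iff_boundaryForm.1 h _ (mode_mem_graph_dirac hx)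
  rw [boundaryForm_mode ha hb] at h1
  exact (mul_eq_zero.1 h1).resolve_left circumference_ne_zero

end Cone

/-! ### Self-adjoint extensions of the Dirac operator -/

section Extensions

variable {σ : ℝ} [Fact (0 < σ)]

lemma mem_graph_diracExt {γ : ℝ} {x : ConeSpinor σ × ConeSpinor σ} :
    x ∈ (diracExt σ γ).graph ↔ ∃ a b : ℤ → RadialSpinor,
      (a 0, b 0) ∈ (radialDiracExt σ γ).graph ∧
      (∀ k, k ≠ 0 → (a k, b k) ∈ (radialDiracY σ k).graph) ∧
      HasSum (fun k => mode σ k (a k)) x.1 ∧ HasSum (fun k => mode σ k (b k)) x.2 := by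
  rw [diracExt, modeSum_graph]
  constructor
  · rintro ⟨a, b, h, ha, hb⟩
    exact ⟨a, b, by simpa using h 0, fun k hk => by simpa [hk] using h k, ha, hb⟩
  · rintro ⟨a, b, h0, h, ha, hb⟩
    refine ⟨a, b, fun k => ?_, ha, hb⟩
    by_cases hk : k = 0
    · subst hk; simpa using h0
    · simpa [hk] using h k hk

lemma isSelfAdjoint_diracExt (hσ : σ ≤ 1) (γ : ℝ) : IsSelfAdjoint (diracExt σ γ) := by
  have hσ0 : 0 < σ := Fact.out
  refine isSelfAdjoint_modeSum (fun k => ?_) fun k => ?_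
  · by_cases hk : k = 0
    · rw [if_pos hk]
      exact (dense_domain_radialDiracY hσ0 hσ 0).mono (radialDiracY_le_radialDiracExt σ γ).1
    · rw [if_neg hk]
      exact dense_domain_radialDiracY hσ0 hσ k
  · by_cases hk : k = 0
    · rw [if_pos hk]
      exact adjoint_graph_radialDiracExt hσ0 hσ γ
    · rw [if_neg hk]
      exact adjoint_graph_radialDiracY hσ0 hσ hk

/-- The angular component of a test function vanishes near the tip, hence is regular there. -/
lemma memLp_div_of_inner_scalarMode {u : coneTest σ} {k : ℤ} {a : RadialL2} {c : ℂ} (hc : c ≠ 0)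
    (h : ∀ φ : RadialL2, inner ℂ (scalarMode σ k φ) (coneTestToL2 σ u) = c * inner ℂ φ a) :
    MemLp (fun r : ℝ => a r / (r : ℂ)) 2 radialMeasure := by
  obtain ⟨δ, hδ, hu⟩ := exists_pos_forall_coneTest_eq_zero u.2
  have hφ : MemLp ((Iio δ).indicator a) 2 radialMeasure :=
    (Lp.memLp a).indicator measurableSet_Iio
  have h1 : inner ℂ (scalarMode σ k (hφ.toLp _)) (coneTestToL2 σ u) = 0 := by
    rw [L2.inner_def]
    refine integral_eq_zero_of_ae ?_
    filter_upwards [scalarMode_ae k hφ.coeFn_toLp, coneTestToL2_ae u] with p h2 h3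
    rw [h2, h3, RCLike.inner_apply]
    by_cases hp : p.1 < δ
    · rw [hu p hp, zero_mul]; rfl
    · rw [indicator_of_notMem (show p.1 ∉ Iio δ from hp), zero_mul, map_zero, mul_zero]; rfl
  have h2 : inner ℂ (hφ.toLp _) a = inner ℂ (hφ.toLp _) (hφ.toLp _) := by
    rw [L2.inner_def, L2.inner_def]
    refine integral_congr_ae ?_
    filter_upwards [hφ.coeFn_toLp] with r hr
    rw [RCLike.inner_apply, RCLike.inner_apply, hr]
    by_cases hp : r ∈ Iio δ
    · rw [indicator_of_mem hp]
    · rw [indicator_of_notMem hp, map_zero, mul_zero, mul_zero]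
  have h3 : hφ.toLp _ = 0 := by
    rw [h, h2] at h1
    exact inner_self_eq_zero.1 ((mul_eq_zero.1 h1).resolve_left hc)
  have h4 : (Iio δ).indicator a =ᵐ[radialMeasure] 0 :=
    hφ.coeFn_toLp.symm.trans (h3 ▸ Lp.coeFn_zero ℂ 2 _)
  have hm : AEStronglyMeasurable (fun r : ℝ => a r / (r : ℂ)) radialMeasure :=
    ((Lp.aestronglyMeasurable a).aemeasurable.div
      Complex.measurable_ofReal.aemeasurable).aestronglyMeasurable
  refine (Lp.memLp a).of_le_mul (c := δ⁻¹) hm ?_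
  filter_upwards [h4] with r hr
  by_cases hp : r < δ
  · rw [indicator_of_mem (show r ∈ Iio δ from hp), Pi.zero_apply] at hr
    simp [hr]
  · have hr0 : δ ≤ r := not_lt.1 hp
    rw [norm_div, Complex.norm_real, Real.norm_of_nonneg (hδ.le.trans hr0), div_eq_inv_mul]
    gcongr

/-- Elements of the domain of `D_σ` have vanishing boundary values, as they vanish near the tip. -/
lemma dirac_le_diracExt (γ : ℝ) : dirac σ ≤ diracExt σ γ := by
  refine LinearPMap.le_of_le_graph fun x hx => ?_
  have hadj := dirac_graph_le_adjoint hx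
  obtain ⟨u, v, rfl⟩ := mem_graph_dirac.1 hx
  obtain ⟨a, ha⟩ := exists_hasSum_mode
    (WithLp.toLp 2 (coneTestToL2 σ u, coneTestToL2 σ v) : ConeSpinor σ)
  obtain ⟨b, hb⟩ := exists_hasSum_mode
    (WithLp.toLp 2 (coneTestExpr σ (-1) v, coneTestExpr σ 1 u) : ConeSpinor σ)
  have hY : ∀ k, (a k, b k) ∈ (radialDiracY σ k).graph := fun k => by
    refine mem_graph_radialDiracY.2 ⟨component_mem_adjoint hadj ha hb k, ?_, ?_⟩
    · refine memLp_div_of_inner_scalarMode (u := u) (k := k) (circumference_ne_zero (σ := σ)) fun φ => ?_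
      simpa [inner_spinor, mode_fst, mode_snd] using
        inner_mode_of_hasSum ha k (WithLp.toLp 2 (φ, 0))
    · refine memLp_div_of_inner_scalarMode (u := v) (k := k) (circumference_ne_zero (σ := σ)) fun φ => ?_
      simpa [inner_spinor, mode_fst, mode_snd] using
        inner_mode_of_hasSum ha k (WithLp.toLp 2 (0, φ))
  exact mem_graph_diracExt.2 ⟨a, b,
    LinearPMap.le_graph_of_le (radialDiracY_le_radialDiracExt σ γ) (hY 0), fun k _ => hY k, ha, hb⟩

/-- A self-adjoint extension has isotropic boundary values in the mode `k = 0`, hence is contained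
in one of the operators `D_{σ,γ}`; the two are equal as both are self-adjoint. -/
lemma exists_eq_diracExt (hσ : σ ≤ 1) {T : ConeSpinor σ →ₗ.[ℂ] ConeSpinor σ}
    (hT : IsSelfAdjoint T) (hle : dirac σ ≤ T) : ∃ γ ∈ Ico 0 (2 * π), T = diracExt σ γ := by
  have hσ0 : 0 < σ := Fact.out
  have hTg : T.graph.adjoint = T.graph := (isSelfAdjoint_iff_graph hT.dense_domain).1 hT
  have hmax : T.graph ≤ (dirac σ).graph.adjoint :=
    hTg ▸ adjoint_antitone (LinearPMap.le_graph_of_le hle)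
  let S : Set (ℂ × ℂ) := {c | ∃ x ∈ T.graph, ∃ a b : ℤ → RadialSpinor,
    HasSum (fun k => mode σ k (a k)) x.1 ∧ HasSum (fun k => mode σ k (b k)) x.2 ∧
      (a 0, b 0) - singularPair c ∈ (radialDiracY σ 0).graph}
  obtain ⟨γ, hγ, h⟩ := exists_angle_of_isotropic (S := S) (by
    rintro c ⟨x, hx, a, b, ha, hb, hc⟩ d ⟨y, hy, a', b', ha', hb', hd⟩
    have h1 : boundaryForm x y = 0 := by
      rw [← hTg] at hy
      exact mem_adjoint_iff_boundaryForm.1 hy x hx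
    have h2 := hasSum_boundaryForm ha hb ha' hb'
    have h3 : ∀ k, k ≠ 0 → ((2 * π * σ : ℝ) : ℂ) * boundaryForm (a k, b k) (a' k, b' k) = 0 :=
      fun k hk => by
        have hk1 := component_mem_adjoint (hmax hx) ha hb k
        have hk2 := component_mem_adjoint (hmax hy) ha' hb' k
        rw [adjoint_graph_radialDirac_of_ne hσ0 hσ hk] at hk1 hk2
        rw [boundaryForm_radialDiracY hk1 hk2, mul_zero]
    have h4 := h2.unique (hasSum_single 0 h3)
    rw [show boundaryForm (x.1, x.2) (y.1, y.2) = 0 from h1,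
      boundaryForm_eq_of_boundaryValues hc hd] at h4
    have h5 := (mul_eq_zero.1 h4.symm).resolve_left circumference_ne_zero
    exact sub_eq_zero.1
      ((mul_eq_zero.1 h5).resolve_left (mul_ne_zero two_ne_zero inner_besselK_self_ne_zero)))
  have hγT : T.graph ≤ (diracExt σ γ).graph := by
    rintro ⟨f, g⟩ hx
    obtain ⟨a, ha⟩ := exists_hasSum_mode f
    obtain ⟨b, hb⟩ := exists_hasSum_mode g
    have hk := component_mem_adjoint (hmax hx) ha hb
    obtain ⟨c, hc⟩ := exists_sub_singularPair_mem (hk 0)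
    refine mem_graph_diracExt.2 ⟨a, b, mem_graph_radialDiracExt_of_sub hc
      (h c ⟨_, hx, a, b, ha, hb, hc⟩), fun k hk0 => ?_, ha, hb⟩
    rw [← adjoint_graph_radialDirac_of_ne hσ0 hσ hk0]
    exact hk k
  have hE := isSelfAdjoint_diracExt hσ γ
  have hEg := (isSelfAdjoint_iff_graph hE.dense_domain).1 hE
  refine ⟨γ, hγ, LinearPMap.eq_of_eq_graph (le_antisymm hγT ?_)⟩
  have := adjoint_antitone hγT
  rwa [hTg, hEg] at this

/-! ### Expansion in angular modes -/

/-- Change of a single component, that of the mode `k = 0`, in an expansion. -/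
lemma hasSum_mode_update_iff {a : ℤ → RadialSpinor} {f : ConeSpinor σ} (z : RadialSpinor) :
    HasSum (fun k => mode σ k (a k - if k = 0 then z else 0)) (f - mode σ 0 z) ↔
      HasSum (fun k => mode σ k (a k)) f := by
  have hz : HasSum (fun k => mode σ k (if k = 0 then z else 0)) (mode σ 0 z) := by
    have e : (fun k => mode σ k (if k = 0 then z else 0)) =
        fun k => if k = 0 then mode σ 0 z else 0 := funext fun k => by
      by_cases hk : k = 0
      · subst hk; simp
      · simp [hk]
    rw [e]
    exact hasSum_ite_eq 0 _
  simp only [map_sub]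
  exact ⟨fun h => by simpa using h.add hz, fun h => h.sub hz⟩

lemma mem_graph_diracExt_iff {γ : ℝ} {f g : ConeSpinor σ} :
    (f, g) ∈ (diracExt σ γ).graph ↔
      ∃ (c : ℂ) (φ ψ : ℤ → regularSpace),
        HasSum (fun k : ℤ => mode σ k (WithLp.toLp 2 ((φ k : RadialL2), (ψ k : RadialL2))))
          (f - c • mode σ 0 (singularSpinor γ)) ∧
        HasSum (fun k : ℤ => mode σ k (WithLp.toLp 2
            (-(bessel (1 / 2 - k / σ) (ψ k)), bessel (1 / 2 + k / σ) (φ k))))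
          (g - c • mode σ 0 (singularImage γ)) := by
  rw [mem_graph_diracExt]
  constructor
  · rintro ⟨a, b, h0, hab, ha, hb⟩
    obtain ⟨c, hc⟩ := mem_graph_radialDiracExt.1 h0
    rw [singularPair_smul_angle] at hc
    have hY : ∀ k, (a k - (if k = 0 then c • singularSpinor γ else 0),
        b k - if k = 0 then c • singularImage γ else 0) ∈ (radialDiracY σ k).graph := fun k => by
      by_cases hk : k = 0
      · subst hk
        simpa only [↓reduceIte, Prod.mk_sub_mk] using hc
      · simpa only [if_neg hk, sub_zero] using hab k hk
    choose φ ψ hφψ using fun k => mem_graph_radialDiracY_iff.1 (hY k)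
    have e1 : ∀ k, a k - (if k = 0 then c • singularSpinor γ else 0) =
        WithLp.toLp 2 ((φ k : RadialL2), (ψ k : RadialL2)) := fun k => congrArg Prod.fst (hφψ k)
    have e2 : ∀ k, b k - (if k = 0 then c • singularImage γ else 0) =
        WithLp.toLp 2 (-(bessel (1 / 2 - k / σ) (ψ k)), bessel (1 / 2 + k / σ) (φ k)) :=
      fun k => congrArg Prod.snd (hφψ k)
    refine ⟨c, φ, ψ, ?_, ?_⟩
    · have h := (hasSum_mode_update_iff (c • singularSpinor γ)).2 ha
      simpa only [e1, map_smul] using h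
    · have h := (hasSum_mode_update_iff (c • singularImage γ)).2 hb
      simpa only [e2, map_smul] using h
  · rintro ⟨c, φ, ψ, h1, h2⟩
    rw [← map_smul] at h1 h2
    have hY : ∀ k, ((WithLp.toLp 2 ((φ k : RadialL2), (ψ k : RadialL2)) : RadialSpinor),
        (WithLp.toLp 2 (-(bessel (1 / 2 - k / σ) (ψ k)), bessel (1 / 2 + k / σ) (φ k)) :
          RadialSpinor)) ∈ (radialDiracY σ k).graph := fun k =>
      mem_graph_radialDiracY_iff.2 ⟨φ k, ψ k, rfl⟩
    refine ⟨fun k => WithLp.toLp 2 ((φ k : RadialL2), (ψ k : RadialL2)) +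
        if k = 0 then c • singularSpinor γ else 0,
      fun k => WithLp.toLp 2 (-(bessel (1 / 2 - k / σ) (ψ k)), bessel (1 / 2 + k / σ) (φ k)) +
        if k = 0 then c • singularImage γ else 0, mem_graph_radialDiracExt.2 ⟨c, ?_⟩,
      fun k hk => ?_, (hasSum_mode_update_iff (c • singularSpinor γ)).1 ?_,
      (hasSum_mode_update_iff (c • singularImage γ)).1 ?_⟩
    · simpa only [singularPair_smul_angle, Prod.mk_sub_mk, if_true, add_sub_cancel_right] using
        hY 0
    · simpa only [if_neg hk, add_zero] using hY k
    · simpa only [add_sub_cancel_right] using h1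
    · simpa only [add_sub_cancel_right] using h2

end Extensions

end DiracCone

open DiracCone
theorem theorem2p1 (σ : ℝ) [Fact (0 < σ)] (hσ : σ ≤ 1) :
    -- every radial operator `d_k` has closure with domain `Y`, acting by `∂_{1/2 ± k/σ}`
    (∀ k : ℤ, (radialDirac σ k).closure = radialDiracY σ k) ∧
    -- the modes `k ≠ 0` are essentially self-adjoint
    (∀ k : ℤ, k ≠ 0 → IsSelfAdjoint (radialDirac σ k).closure) ∧
    -- the self-adjoint extensions of `D_σ` are exactly the operators `D_{σ,γ}`
    (∀ T : ConeSpinor σ →ₗ.[ℂ] ConeSpinor σ,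
      (IsSelfAdjoint T ∧ dirac σ ≤ T) ↔ ∃ γ ∈ Ico 0 (2 * π), T = diracExt σ γ) ∧
    -- domain and action of `D_{σ,γ}`: `f` lies in the domain with `D_{σ,γ} f = g`
    -- if and only if `f` and `g` have the following expansions
    (∀ γ ∈ Ico 0 (2 * π), ∀ f g : ConeSpinor σ, (f, g) ∈ (diracExt σ γ).graph ↔
      ∃ (c : ℂ) (φ ψ : ℤ → regularSpace),
        HasSum (fun k : ℤ => mode σ k (WithLp.toLp 2 ((φ k : RadialL2), (ψ k : RadialL2))))
          (f - c • mode σ 0 (singularSpinor γ)) ∧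
        HasSum (fun k : ℤ => mode σ k (WithLp.toLp 2
            (-(bessel (1 / 2 - k / σ) (ψ k)), bessel (1 / 2 + k / σ) (φ k))))
          (g - c • mode σ 0 (singularImage γ))) := by
  have hσ0 : 0 < σ := Fact.out
  refine ⟨closure_radialDirac hσ0 hσ, fun k hk => ?_, fun T => ⟨fun h => ?_, ?_⟩,
    fun γ _ f g => mem_graph_diracExt_iff⟩
  · rw [closure_radialDirac hσ0 hσ]
    exact isSelfAdjoint_radialDiracY hσ0 hσ hk
  · exact exists_eq_diracExt hσ h.1 h.2
  · rintro ⟨γ, -, rfl⟩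
    exact ⟨isSelfAdjoint_diracExt hσ γ, dirac_le_diracExt γ⟩
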